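/- **Theorem (Morita invariance).** If two Lie groupoids $\mathcal{G}\rightrightarrows M$ and $\mathcal{H}\rightrightarrows N$ are Morita equivalent, then their deformation cohomologies are isomorphic: $H^k_{\mathrm{def}}(\mathcal{G})\cong H^k_{\mathrm{def}}(\mathcal{H})$ as real vector spaces for every $k\ge 0$. Here a Lie groupoid $\mathcal{G}\rightrightarrows M$ has smooth structure maps $s,t$ (submersions), $m,u,i$, and a product $gh$ is defined when $s(g)=t(h)$. Manifolds are finite-dimensional, the bases $M,N$ are Hausdorff and second countable, and the manifolds of arrows (and the manifold $P$ below) need not be Hausdorff. *Deformation cohomology.* Let $\mathcal{G}^{(k)}=\{(g_1,\dots,g_k): s(g_i)=t(g_{i+1})\}$, let $\bar m(g,h)=gh^{-1}$ for $s(g)=s(h)$, and let $A$ be the Lie algebroid, $A_x=\ker(d_{1_x}s)\subset T_{1_x}\mathcal{G}$. For $k\ge1$, $C^k_{\mathrm{def}}(\mathcal{G})$ consists of the smooth maps $c:\mathcal{G}^{(k)}\to T\mathcal{G}$ with $c(g_1,\dots,g_k)\in T_{g_1}\mathcal{G}$ such that $ds(c(g_1,\dots,g_k))$ does not depend on $g_1$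 (for $k=1$: it depends only on $s(g_1)$), with differential $$(\delta c)(g_1,\dots,g_{k+1})=-d\bar m\big(c(g_1g_2,g_3,\dots,g_{k+1}),c(g_2,\dots,g_{k+1})\big)+\sum_{i=2}^{k}(-1)^i c(g_1,\dots,g_ig_{i+1},\dots,g_{k+1})+(-1)^{k+1}c(g_1,\dots,g_k).$$ In degree $0$, $C^0_{\mathrm{def}}(\mathcal{G})=\Gamma(A)$ and $(\delta\alpha)(g)=r_g(\alpha_{t(g)})+l_g(di(\alpha_{s(g)}))$, where $r_g$ and $l_g$ are the differentials of right and left translation by $g$. $H^*_{\mathrm{def}}(\mathcal{G})$ is the cohomology of $(C^*_{\mathrm{def}}(\mathcal{G}),\delta)$. *Morita equivalence.* $\mathcal{G}$ and $\mathcal{H}$ are Morita equivalent if there is a manifold $P$ with a smooth left action of $\mathcal{G}$ with moment map $\alpha:P\to M$ and a smooth right action of $\mathcal{H}$ with moment map $\beta:P\to N$, such that the actions commute, $\beta$ is a principal left $\mathcal{G}$-bundle (a $\mathcal{G}$-invariant surjective submersion such that $\mathcal{G}\times_M P\to P\times_N P$, $(g,p)\mapsto(gp,p)$, is a diffeomorphism),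 and $\alpha$ is a principal right $\mathcal{H}$-bundle (an $\mathcal{H}$-invariant surjective submersion such that $P\times_N\mathcal{H}\to P\times_M P$, $(p,h)\mapsto(p,ph)$, is a diffeomorphism). -/

import Mathlib

open Set Manifold
open scoped ContDiff Topology

noncomputable section

/-- A Lie groupoid `G ⇉ M` with arrow manifold `G` (modelled on `EG`) and base manifold `M`
(modelled on `EM`). An arrow `g` goes from `src g` to `tgt g`, and `mul g h` is the product `gh`,
which is meaningful only if `src g = tgt h`. No axiom constrains the values of `mul` on pairs that
are not composable, and nothing below depends on them. -/
structure LieGroupoid (EM : Type*) [NormedAddCommGroup EM] [NormedSpace ℝ EM]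
    (M : Type*) [TopologicalSpace M] [ChartedSpace EM M] [IsManifold 𝓘(ℝ, EM) ∞ M]
    (EG : Type*) [NormedAddCommGroup EG] [NormedSpace ℝ EG]
    (G : Type*) [TopologicalSpace G] [ChartedSpace EG G] [IsManifold 𝓘(ℝ, EG) ∞ G] where
  src : G → M
  tgt : G → M
  unit : M → G
  inv : G → G
  mul : G → G → G
  isSubmersion_src : IsSubmersion 𝓘(ℝ, EG) 𝓘(ℝ, EM) ∞ src
  isSubmersion_tgt : IsSubmersion 𝓘(ℝ, EG) 𝓘(ℝ, EM) ∞ tgt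
  contMDiff_unit : ContMDiff 𝓘(ℝ, EM) 𝓘(ℝ, EG) ∞ unit
  contMDiff_inv : ContMDiff 𝓘(ℝ, EG) 𝓘(ℝ, EG) ∞ inv
  contMDiffOn_mul : ContMDiffOn (𝓘(ℝ, EG).prod 𝓘(ℝ, EG)) 𝓘(ℝ, EG) ∞
    (fun p : G × G => mul p.1 p.2) {p | src p.1 = tgt p.2}
  src_unit : ∀ x, src (unit x) = x
  tgt_unit : ∀ x, tgt (unit x) = x
  src_inv : ∀ g, src (inv g) = tgt g
  tgt_inv : ∀ g, tgt (inv g) = src g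
  src_mul : ∀ g h, src g = tgt h → src (mul g h) = src h
  tgt_mul : ∀ g h, src g = tgt h → tgt (mul g h) = tgt g
  mul_assoc : ∀ g h k, src g = tgt h → src h = tgt k → mul (mul g h) k = mul g (mul h k)
  unit_mul : ∀ g, mul (unit (tgt g)) g = g
  mul_unit : ∀ g, mul g (unit (src g)) = g
  mul_inv : ∀ g, mul g (inv g) = unit (tgt g)
  inv_mul : ∀ g, mul (inv g) g = unit (src g)

/-- Evaluation at a coordinate is a smooth map on a finite power of a manifold. -/
theorem contMDiff_eval_pi {E : Type*} [NormedAddCommGroup E] [NormedSpace ℝ E]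
    {G : Type*} [TopologicalSpace G] [ChartedSpace E G] {n : ℕ} (i : Fin n) :
    ContMDiff (ModelWithCorners.pi fun _ : Fin n => 𝓘(ℝ, E)) 𝓘(ℝ, E) ∞
      (fun g : Fin n → G => g i) := by
  intro g
  rw [contMDiffAt_iff]
  refine ⟨(continuous_apply i).continuousAt, ?_⟩
  have h1 : ContDiffWithinAt ℝ ∞ (fun y : Fin n → E => y i)
      (range (ModelWithCorners.pi fun _ : Fin n => 𝓘(ℝ, E)))
      (extChartAt (ModelWithCorners.pi fun _ : Fin n => 𝓘(ℝ, E)) g g) :=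
    (contDiff_apply ℝ E i).contDiffWithinAt
  refine h1.congr_of_eventuallyEq ?_ ?_
  · have h2 : (fun y : Fin n → E => y i) ⁻¹' (extChartAt 𝓘(ℝ, E) (g i)).target ∈
        𝓝 (extChartAt (ModelWithCorners.pi fun _ : Fin n => 𝓘(ℝ, E)) g g) :=
      by
      refine (continuous_apply i).continuousAt.preimage_mem_nhds ?_
      change _ ∈ 𝓝 (extChartAt 𝓘(ℝ, E) (g i) (g i))
      exact extChartAt_target_mem_nhds (g i)
    filter_upwards [mem_nhdsWithin_of_mem_nhds h2] with y hy
    exact (extChartAt 𝓘(ℝ, E) (g i)).right_inv hy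
  · exact (extChartAt 𝓘(ℝ, E) (g i)).right_inv (mem_extChartAt_target (g i))

section

variable {E : Type*} [NormedAddCommGroup E] [NormedSpace ℝ E]
  {X : Type*} [TopologicalSpace X] [ChartedSpace E X] [IsManifold 𝓘(ℝ, E) ∞ X]
  {E' : Type*} [NormedAddCommGroup E'] [NormedSpace ℝ E'] {H' : Type*} [TopologicalSpace H']
  {I' : ModelWithCorners ℝ E' H'} {Y : Type*} [TopologicalSpace Y] [ChartedSpace H' Y]

/-- Linear combinations of smooth vector fields along a map are smooth. -/
theorem contMDiffOn_smul_add {f : Y → X} {S : Set Y}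
    {v w : (y : Y) → TangentSpace 𝓘(ℝ, E) (f y)} (a b : ℝ)
    (hv : ContMDiffOn I' 𝓘(ℝ, E).tangent ∞ (fun y => (⟨f y, v y⟩ : TangentBundle 𝓘(ℝ, E) X)) S)
    (hw : ContMDiffOn I' 𝓘(ℝ, E).tangent ∞ (fun y => (⟨f y, w y⟩ : TangentBundle 𝓘(ℝ, E) X)) S) :
    ContMDiffOn I' 𝓘(ℝ, E).tangent ∞
      (fun y => (⟨f y, a • v y + b • w y⟩ : TangentBundle 𝓘(ℝ, E) X)) S := by
  intro y hy
  have h1 := (Bundle.contMDiffWithinAt_totalSpace).1 (hv y hy)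
  have h2 := (Bundle.contMDiffWithinAt_totalSpace).1 (hw y hy)
  refine (Bundle.contMDiffWithinAt_totalSpace).2 ⟨h1.1, ?_⟩
  let e := trivializationAt E (TangentSpace 𝓘(ℝ, E)) (f y)
  have h3 := (contMDiffWithinAt_const (I := I') (I' := 𝓘(ℝ, ℝ)) (c := a)).smul h1.2 |>.add
    ((contMDiffWithinAt_const (I := I') (I' := 𝓘(ℝ, ℝ)) (c := b)).smul h2.2)
  have hmem : f ⁻¹' e.baseSet ∈ 𝓝[S] y :=
    h1.1.continuousWithinAt.preimage_mem_nhdsWithin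
      (e.open_baseSet.mem_nhds (FiberBundle.mem_baseSet_trivializationAt' (f y)))
  have key : ∀ z, f z ∈ e.baseSet → (e ⟨f z, a • v z + b • w z⟩).2 =
      a • (e ⟨f z, v z⟩).2 + b • (e ⟨f z, w z⟩).2 := by
    intro z hz
    have hl := e.linear ℝ hz
    rw [hl.map_add, hl.map_smul, hl.map_smul]
  refine h3.congr_of_eventuallyEq ?_ ?_
  · filter_upwards [hmem] with z hz using key z hz
  · exact key y (FiberBundle.mem_baseSet_trivializationAt' (f y))

/-- A tangent vector at `x`, as a tangent vector at the same point `y = x`. No transport is needed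
because Mathlib's tangent spaces all are the model space by definition. -/
abbrev castTangent {x y : X} (_ : x = y) (v : TangentSpace 𝓘(ℝ, E) x) : TangentSpace 𝓘(ℝ, E) y := v

/-- The zero vector field along a smooth map is smooth. -/
theorem contMDiffOn_zero_along {f : Y → X} {S : Set Y} (hf : ContMDiffOn I' 𝓘(ℝ, E) ∞ f S) :
    ContMDiffOn I' 𝓘(ℝ, E).tangent ∞
      (fun y => (⟨f y, 0⟩ : TangentBundle 𝓘(ℝ, E) X)) S :=
  (Bundle.contMDiff_zeroSection ℝ (TangentSpace 𝓘(ℝ, E) : X → Type _)).comp_contMDiffOn hf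

end

namespace LieGroupoid

universe u v

variable {EM : Type*} [NormedAddCommGroup EM] [NormedSpace ℝ EM]
  {M : Type u} [TopologicalSpace M] [ChartedSpace EM M] [IsManifold 𝓘(ℝ, EM) ∞ M]
  {EG : Type v} [NormedAddCommGroup EG] [NormedSpace ℝ EG]
  {G : Type u} [TopologicalSpace G] [ChartedSpace EG G] [IsManifold 𝓘(ℝ, EG) ∞ G]
  (𝒢 : LieGroupoid EM M EG G)

/-! ### The differentials of the structure maps

`G ×ₛ G` and the source and target fibres are embedded submanifolds. For a vector tangent to such
a submanifold `S`, the value of `mfderivWithin … f S` on it is the value of the differential of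
the smooth map `f : S → G`; below, it is applied to such vectors only. -/

/-- The division map `(g, h) ↦ g h⁻¹`, meaningful if `src g = src h`. -/
def div (g h : G) : G := 𝒢.mul g (𝒢.inv h)

/-- The differential at `(g, h)`, `src g = src h`, of the division map `G ×ₛ G → G`,
applied to `(v, w)` with `ds v = ds w`. -/
def dDiv (g h : G) (v : TangentSpace 𝓘(ℝ, EG) g) (w : TangentSpace 𝓘(ℝ, EG) h) :
    TangentSpace 𝓘(ℝ, EG) (𝒢.div g h) :=
  mfderivWithin (𝓘(ℝ, EG).prod 𝓘(ℝ, EG)) 𝓘(ℝ, EG) (fun p : G × G => 𝒢.div p.1 p.2)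
    {p | 𝒢.src p.1 = 𝒢.src p.2} (g, h) ((v, w) : EG × EG)

/-- The differential `r_g` at `h`, `src h = tgt g`, of the right translation
`R_g : s⁻¹(tgt g) → s⁻¹(src g)`, `h ↦ h g`, applied to `v` with `ds v = 0`. -/
def dRight (g h : G) (v : TangentSpace 𝓘(ℝ, EG) h) : TangentSpace 𝓘(ℝ, EG) (𝒢.mul h g) :=
  mfderivWithin 𝓘(ℝ, EG) 𝓘(ℝ, EG) (fun h' => 𝒢.mul h' g) {h' | 𝒢.src h' = 𝒢.tgt g} h v

/-- The differential `l_g` at `h`, `tgt h = src g`, of the left translation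
`L_g : t⁻¹(src g) → t⁻¹(tgt g)`, `h ↦ g h`, applied to `v` with `dt v = 0`. -/
def dLeft (g h : G) (v : TangentSpace 𝓘(ℝ, EG) h) : TangentSpace 𝓘(ℝ, EG) (𝒢.mul g h) :=
  mfderivWithin 𝓘(ℝ, EG) 𝓘(ℝ, EG) (fun h' => 𝒢.mul g h') {h' | 𝒢.tgt h' = 𝒢.src g} h v

theorem dDiv_smul_add (g h : G) (a b : ℝ) (v v' : TangentSpace 𝓘(ℝ, EG) g)
    (w w' : TangentSpace 𝓘(ℝ, EG) h) :
    𝒢.dDiv g h (a • v + b • v') (a • w + b • w') = a • 𝒢.dDiv g h v w + b • 𝒢.dDiv g h v' w' := by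
  let L := mfderivWithin (𝓘(ℝ, EG).prod 𝓘(ℝ, EG)) 𝓘(ℝ, EG) (fun p : G × G => 𝒢.div p.1 p.2)
    {p | 𝒢.src p.1 = 𝒢.src p.2} (g, h)
  exact (map_add L (a • ((v, w) : EG × EG)) (b • ((v', w') : EG × EG))).trans
    (congrArg₂ (· + ·) (map_smul L a _) (map_smul L b _))

theorem dRight_smul_add (g h : G) (a b : ℝ) (v v' : TangentSpace 𝓘(ℝ, EG) h) :
    𝒢.dRight g h (a • v + b • v') = a • 𝒢.dRight g h v + b • 𝒢.dRight g h v' := by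
  unfold dRight
  rw [← map_smul, ← map_smul, ← map_add]

theorem dLeft_smul_add (g h : G) (a b : ℝ) (v v' : TangentSpace 𝓘(ℝ, EG) h) :
    𝒢.dLeft g h (a • v + b • v') = a • 𝒢.dLeft g h v + b • 𝒢.dLeft g h v' := by
  unfold dLeft
  rw [← map_smul, ← map_smul, ← map_add]

/-! ### The deformation complex -/

/-- `G^(k+1)`: the strings `(g₁, …, g_{k+1})` of composable arrows, `src gᵢ = tgt gᵢ₊₁`. -/
def composable (k : ℕ) : Set (Fin (k + 1) → G) :=
  {g | ∀ i : Fin k, 𝒢.src (g i.castSucc) = 𝒢.tgt (g i.succ)}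

/-- The ambient manifold of `G^(k)`: this is `M` for `k = 0`, and `G^k` for `k ≥ 1`. -/
abbrev Tuples (_ : LieGroupoid EM M EG G) : ℕ → Type u
  | 0 => M
  | k + 1 => Fin (k + 1) → G

/-- The arrow at which a cochain takes values: `1_x` for `x ∈ M`, and the first one of a tuple. -/
abbrev first : (k : ℕ) → 𝒢.Tuples k → G
  | 0, x => 𝒢.unit x
  | _ + 1, g => g 0

/-- Not necessarily smooth maps `c` on `G^(k)` with `c (g₁, …, g_k) ∈ T_{g₁} G`, before any
condition is imposed. -/
abbrev RawCochain (k : ℕ) : Type (max u v) :=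
  (g : 𝒢.Tuples k) → TangentSpace 𝓘(ℝ, EG) (𝒢.first k g)

/-- The conditions on a raw cochain of positive degree to be a deformation cochain: it is a smooth
map on `G^(k+1)` (functions on `G^(k+1)` are extended by zero to all tuples), and it is
`s`-projectable: `ds (c (g₁, g₂, …))` depends only on `(g₂, …)` (on `src g₁` in degree one). -/
structure IsCochain {k : ℕ} (c : 𝒢.RawCochain (k + 1)) : Prop where
  support : ∀ g : Fin (k + 1) → G, g ∉ 𝒢.composable k → c g = 0
  smooth : ContMDiffOn (ModelWithCorners.pi fun _ : Fin (k + 1) => 𝓘(ℝ, EG)) 𝓘(ℝ, EG).tangent ∞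
    (fun g : Fin (k + 1) → G => (⟨g 0, c g⟩ : TangentBundle 𝓘(ℝ, EG) G)) (𝒢.composable k)
  projectable : ∀ g ∈ 𝒢.composable k, ∀ g' ∈ 𝒢.composable k,
    𝒢.src (g 0) = 𝒢.src (g' 0) → Fin.tail g = Fin.tail g' →
    tangentMap 𝓘(ℝ, EG) 𝓘(ℝ, EM) 𝒢.src (⟨g 0, c g⟩ : TangentBundle 𝓘(ℝ, EG) G) =
      tangentMap 𝓘(ℝ, EG) 𝓘(ℝ, EM) 𝒢.src (⟨g' 0, c g'⟩ : TangentBundle 𝓘(ℝ, EG) G)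

/-- The sections of the Lie algebroid `A`, `A_x = ker (ds) ⊆ T_{1_x} G`. -/
structure IsAlgebroidSection (c : 𝒢.RawCochain 0) : Prop where
  smooth : ContMDiff 𝓘(ℝ, EM) 𝓘(ℝ, EG).tangent ∞
    (fun x : M => (⟨𝒢.unit x, c x⟩ : TangentBundle 𝓘(ℝ, EG) G))
  vertical : ∀ x : M, mfderiv 𝓘(ℝ, EG) 𝓘(ℝ, EM) 𝒢.src (𝒢.unit x) (c x) = 0

theorem isCochain_zero {k : ℕ} : 𝒢.IsCochain (0 : 𝒢.RawCochain (k + 1)) where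
  support _ _ := rfl
  smooth := contMDiffOn_zero_along (contMDiff_eval_pi 0).contMDiffOn
  projectable g _ g' _ h _ := by
    change (⟨𝒢.src (g 0), mfderiv 𝓘(ℝ, EG) 𝓘(ℝ, EM) 𝒢.src (g 0) 0⟩ : TangentBundle 𝓘(ℝ, EM) M) =
      ⟨𝒢.src (g' 0), mfderiv 𝓘(ℝ, EG) 𝓘(ℝ, EM) 𝒢.src (g' 0) 0⟩
    rw [map_zero, map_zero, h]

theorem tangentMap_smul_add {E₁ : Type*} [NormedAddCommGroup E₁] [NormedSpace ℝ E₁]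
    {X : Type*} [TopologicalSpace X] [ChartedSpace E₁ X]
    {E₂ : Type*} [NormedAddCommGroup E₂] [NormedSpace ℝ E₂]
    {Y : Type*} [TopologicalSpace Y] [ChartedSpace E₂ Y] (f : X → Y) (a b : ℝ) (x x' : X)
    (v w : TangentSpace 𝓘(ℝ, E₁) x) (v' w' : TangentSpace 𝓘(ℝ, E₁) x')
    (h : tangentMap 𝓘(ℝ, E₁) 𝓘(ℝ, E₂) f (⟨x, v⟩ : TangentBundle 𝓘(ℝ, E₁) X) =
      tangentMap 𝓘(ℝ, E₁) 𝓘(ℝ, E₂) f (⟨x', v'⟩ : TangentBundle 𝓘(ℝ, E₁) X))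
    (h' : tangentMap 𝓘(ℝ, E₁) 𝓘(ℝ, E₂) f (⟨x, w⟩ : TangentBundle 𝓘(ℝ, E₁) X) =
      tangentMap 𝓘(ℝ, E₁) 𝓘(ℝ, E₂) f (⟨x', w'⟩ : TangentBundle 𝓘(ℝ, E₁) X)) :
    tangentMap 𝓘(ℝ, E₁) 𝓘(ℝ, E₂) f (⟨x, a • v + b • w⟩ : TangentBundle 𝓘(ℝ, E₁) X) =
      tangentMap 𝓘(ℝ, E₁) 𝓘(ℝ, E₂) f (⟨x', a • v' + b • w'⟩ : TangentBundle 𝓘(ℝ, E₁) X) := by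
  simp only [tangentMap, Bundle.TotalSpace.mk.injEq] at h h' ⊢
  refine ⟨h.1, ?_⟩
  have h1 : (mfderiv 𝓘(ℝ, E₁) 𝓘(ℝ, E₂) f x v : E₂) = mfderiv 𝓘(ℝ, E₁) 𝓘(ℝ, E₂) f x' v' :=
    eq_of_heq h.2
  have h2 : (mfderiv 𝓘(ℝ, E₁) 𝓘(ℝ, E₂) f x w : E₂) = mfderiv 𝓘(ℝ, E₁) 𝓘(ℝ, E₂) f x' w' :=
    eq_of_heq h'.2
  apply heq_of_eq
  rw [map_add, map_add, map_smul, map_smul, map_smul, map_smul]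
  exact congrArg₂ (fun p q : E₂ => a • p + b • q) h1 h2

theorem IsCochain.smul_add {k : ℕ} {c c' : 𝒢.RawCochain (k + 1)} (hc : 𝒢.IsCochain c) (a b : ℝ)
    (hc' : 𝒢.IsCochain c') : 𝒢.IsCochain (a • c + b • c') where
  support g hg := by
    change a • c g + b • c' g = 0
    rw [hc.support g hg, hc'.support g hg,
      smul_zero, smul_zero, add_zero]
  smooth := contMDiffOn_smul_add a b hc.smooth hc'.smooth
  projectable g hg g' hg' h h' := tangentMap_smul_add 𝒢.src a b _ _ _ _ _ _
    (hc.projectable g hg g' hg' h h') (hc'.projectable g hg g' hg' h h')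

theorem isAlgebroidSection_zero : 𝒢.IsAlgebroidSection (0 : 𝒢.RawCochain 0) where
  smooth := contMDiffOn_univ.1 (contMDiffOn_zero_along 𝒢.contMDiff_unit.contMDiffOn)
  vertical _ := map_zero _

theorem IsAlgebroidSection.smul_add {c c' : 𝒢.RawCochain 0} (hc : 𝒢.IsAlgebroidSection c)
    (a b : ℝ) (hc' : 𝒢.IsAlgebroidSection c') : 𝒢.IsAlgebroidSection (a • c + b • c') where
  smooth := contMDiffOn_univ.1
    (contMDiffOn_smul_add a b hc.smooth.contMDiffOn hc'.smooth.contMDiffOn)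
  vertical x := by
    have h1 := hc.vertical x
    have h2 := hc'.vertical x
    change mfderiv 𝓘(ℝ, EG) 𝓘(ℝ, EM) 𝒢.src (𝒢.unit x) (a • c x + b • c' x) = 0
    refine (map_add _ _ _).trans ?_
    refine (congrArg₂ (· + ·) (map_smul _ a _) (map_smul _ b _)).trans ?_
    rw [h1, h2, smul_zero, smul_zero, add_zero]

/-- The vector space `C^k_def(𝒢)` of deformation `k`-cochains. -/
def cochains : (k : ℕ) → Submodule ℝ (𝒢.RawCochain k)
  | 0 =>
    { carrier := {c | 𝒢.IsAlgebroidSection c}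
      zero_mem' := 𝒢.isAlgebroidSection_zero
      add_mem' := fun hc hc' => by simpa only [one_smul, mem_ofPred_eq] using hc.smul_add 𝒢 1 1 hc'
      smul_mem' := fun a c hc => by
        simpa only [zero_smul, add_zero, mem_ofPred_eq] using hc.smul_add 𝒢 a 0 hc }
  | k + 1 =>
    { carrier := {c | 𝒢.IsCochain c}
      zero_mem' := 𝒢.isCochain_zero
      add_mem' := fun hc hc' => by simpa only [one_smul, mem_ofPred_eq] using hc.smul_add 𝒢 1 1 hc'
      smul_mem' := fun a c hc => by
        simpa only [zero_smul, add_zero, mem_ofPred_eq] using hc.smul_add 𝒢 a 0 hc }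

theorem inv_unit (x : M) : 𝒢.inv (𝒢.unit x) = 𝒢.unit x := by
  have h := 𝒢.unit_mul (𝒢.inv (𝒢.unit x))
  rw [𝒢.tgt_inv, 𝒢.src_unit] at h
  rw [← h]
  simpa only [𝒢.tgt_unit] using 𝒢.mul_inv (𝒢.unit x)

theorem div_contract {k : ℕ} {g : Fin (k + 2) → G} (hg : g ∈ 𝒢.composable (k + 1)) :
    𝒢.div (Fin.contractNth 0 𝒢.mul g 0) (Fin.tail g 0) = g 0 := by
  have h : 𝒢.src (g 0) = 𝒢.tgt (g 1) := hg 0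
  change 𝒢.mul (𝒢.mul (g 0) (g 1)) (𝒢.inv (g 1)) = g 0
  rw [𝒢.mul_assoc _ _ _ h (𝒢.tgt_inv _).symm, 𝒢.mul_inv, ← h, 𝒢.mul_unit]

theorem contractNth_succ_zero {k : ℕ} (g : Fin (k + 2) → G) (j : Fin k) :
    Fin.contractNth j.succ.castSucc 𝒢.mul g 0 = g 0 :=
  Fin.contractNth_apply_of_lt _ _ _ _ (by simp)

/-- The differential of a section `α` of `A`: the sum of the right and the left invariant vector
fields of `α`, that is `g ↦ r_g (α (tgt g)) + l_g (di (α (src g)))`. -/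
def dZero (α : 𝒢.RawCochain 0) : 𝒢.RawCochain 1 := fun g : Fin 1 → G =>
  castTangent (𝒢.unit_mul (g 0))
      (𝒢.dRight (g 0) (𝒢.unit (𝒢.tgt (g 0))) (α (𝒢.tgt (g 0)))) +
    castTangent (𝒢.mul_unit (g 0))
      (𝒢.dLeft (g 0) (𝒢.unit (𝒢.src (g 0))) (castTangent (𝒢.inv_unit (𝒢.src (g 0)))
        (mfderiv 𝓘(ℝ, EG) 𝓘(ℝ, EG) 𝒢.inv (𝒢.unit (𝒢.src (g 0))) (α (𝒢.src (g 0))))))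

open scoped Classical in
/-- The differential of a cochain `c` of degree `k + 1 ≥ 1`: on `(g₁, …, g_{k+2})` it is
`- dm̄ (c (g₁g₂, g₃, …), c (g₂, g₃, …)) + ∑_{i=2}^{k+1} (-1)^i c (g₁, …, gᵢgᵢ₊₁, …)
  + (-1)^{k+2} c (g₁, …, g_{k+1})`,
where `m̄` is the division map. Here `i = j + 2` for `j : Fin k`, and `gᵢgᵢ₊₁` is the product of
the entries with zero-based indices `j + 1` and `j + 2`. -/
def dSucc (k : ℕ) (c : 𝒢.RawCochain (k + 1)) : 𝒢.RawCochain (k + 2) :=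
  fun g : Fin (k + 2) → G =>
    if hg : g ∈ 𝒢.composable (k + 1) then
      -castTangent (𝒢.div_contract hg)
          (𝒢.dDiv (Fin.contractNth 0 𝒢.mul g 0) (Fin.tail g 0)
            (c (Fin.contractNth 0 𝒢.mul g)) (c (Fin.tail g))) +
        ∑ j : Fin k, (-1 : ℝ) ^ ((j : ℕ) + 2) •
          castTangent (𝒢.contractNth_succ_zero g j) (c (Fin.contractNth j.succ.castSucc 𝒢.mul g)) +
        (-1 : ℝ) ^ (k + 2) • castTangent (y := g 0) rfl (c (Fin.init g))
    else 0

theorem dSucc_of_mem (k : ℕ) (c : 𝒢.RawCochain (k + 1)) {g : Fin (k + 2) → G}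
    (hg : g ∈ 𝒢.composable (k + 1)) : 𝒢.dSucc k c g =
      -castTangent (𝒢.div_contract hg)
          (𝒢.dDiv (Fin.contractNth 0 𝒢.mul g 0) (Fin.tail g 0)
            (c (Fin.contractNth 0 𝒢.mul g)) (c (Fin.tail g))) +
        ∑ j : Fin k, (-1 : ℝ) ^ ((j : ℕ) + 2) •
          castTangent (𝒢.contractNth_succ_zero g j) (c (Fin.contractNth j.succ.castSucc 𝒢.mul g)) +
        (-1 : ℝ) ^ (k + 2) • castTangent (y := g 0) rfl (c (Fin.init g)) :=
  dif_pos hg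

theorem dSucc_of_notMem (k : ℕ) (c : 𝒢.RawCochain (k + 1)) {g : Fin (k + 2) → G}
    (hg : g ∉ 𝒢.composable (k + 1)) : 𝒢.dSucc k c g = 0 :=
  dif_neg hg

theorem dZero_smul_add (a b : ℝ) (α α' : 𝒢.RawCochain 0) :
    𝒢.dZero (a • α + b • α') = a • 𝒢.dZero α + b • 𝒢.dZero α' := by
  funext (g : Fin 1 → G)
  have h1 := 𝒢.dRight_smul_add (g 0) (𝒢.unit (𝒢.tgt (g 0))) a b (α (𝒢.tgt (g 0)))
    (α' (𝒢.tgt (g 0)))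
  have h2 : mfderiv 𝓘(ℝ, EG) 𝓘(ℝ, EG) 𝒢.inv (𝒢.unit (𝒢.src (g 0)))
      (a • α (𝒢.src (g 0)) + b • α' (𝒢.src (g 0))) = _ :=
    (map_add _ _ _).trans (congrArg₂ (· + ·) (map_smul _ a _) (map_smul _ b _))
  have h3 := 𝒢.dLeft_smul_add (g 0) (𝒢.unit (𝒢.src (g 0))) a b
    (castTangent (𝒢.inv_unit (𝒢.src (g 0)))
      (mfderiv 𝓘(ℝ, EG) 𝓘(ℝ, EG) 𝒢.inv (𝒢.unit (𝒢.src (g 0))) (α (𝒢.src (g 0)))))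
    (castTangent (𝒢.inv_unit (𝒢.src (g 0)))
      (mfderiv 𝓘(ℝ, EG) 𝓘(ℝ, EG) 𝒢.inv (𝒢.unit (𝒢.src (g 0))) (α' (𝒢.src (g 0)))))
  have h4 : ∀ p q r s : EG, (a • p + b • q) + (a • r + b • s) = a • (p + r) + b • (q + s) := by
    intro p q r s
    module
  refine Eq.trans ?_ (h4 _ _ _ _)
  exact congrArg₂ (fun x y : EG => x + y) h1
    ((congrArg (𝒢.dLeft (g 0) (𝒢.unit (𝒢.src (g 0)))) h2).trans h3)

theorem dSucc_smul_add (k : ℕ) (a b : ℝ) (c c' : 𝒢.RawCochain (k + 1)) :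
    𝒢.dSucc k (a • c + b • c') = a • 𝒢.dSucc k c + b • 𝒢.dSucc k c' := by
  funext (g : Fin (k + 2) → G)
  by_cases hg : g ∈ 𝒢.composable (k + 1)
  · have h1 := 𝒢.dDiv_smul_add (Fin.contractNth 0 𝒢.mul g 0) (Fin.tail g 0) a b
      (c (Fin.contractNth 0 𝒢.mul g)) (c' (Fin.contractNth 0 𝒢.mul g))
      (c (Fin.tail g)) (c' (Fin.tail g))
    have h4 : ∀ (p p' r r' : EG) (q q' : Fin k → EG),
        -(a • p + b • p') + ∑ j : Fin k, (-1 : ℝ) ^ ((j : ℕ) + 2) • (a • q j + b • q' j) +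
          (-1 : ℝ) ^ (k + 2) • (a • r + b • r') =
        a • (-p + ∑ j : Fin k, (-1 : ℝ) ^ ((j : ℕ) + 2) • q j + (-1 : ℝ) ^ (k + 2) • r) +
        b • (-p' + ∑ j : Fin k, (-1 : ℝ) ^ ((j : ℕ) + 2) • q' j + (-1 : ℝ) ^ (k + 2) • r') := by
      intro p p' r r' q q'
      simp only [smul_add, Finset.smul_sum, Finset.sum_add_distrib, smul_comm a, smul_comm b]
      module
    have h5 := fun c'' : 𝒢.RawCochain (k + 1) => 𝒢.dSucc_of_mem k c'' hg
    change 𝒢.dSucc k (a • c + b • c') g = a • 𝒢.dSucc k c g + b • 𝒢.dSucc k c' g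
    rw [h5, h5, h5]
    refine Eq.trans ?_ (h4 _ _ _ _ _ _)
    exact congrArg (fun x : EG => -x + _ + _) h1
  · change 𝒢.dSucc k (a • c + b • c') g = a • 𝒢.dSucc k c g + b • 𝒢.dSucc k c' g
    have h5 := fun c'' : 𝒢.RawCochain (k + 1) => 𝒢.dSucc_of_notMem k c'' hg
    rw [h5, h5, h5, smul_zero, smul_zero, add_zero]

/-- The differential `δ` of the deformation complex. -/
def d : (k : ℕ) → 𝒢.RawCochain k →ₗ[ℝ] 𝒢.RawCochain (k + 1)
  | 0 =>
    { toFun := 𝒢.dZero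
      map_add' := fun α α' => by simpa only [one_smul] using 𝒢.dZero_smul_add 1 1 α α'
      map_smul' := fun a α => by
        simpa only [zero_smul, add_zero, RingHom.id_apply] using 𝒢.dZero_smul_add a 0 α 0 }
  | k + 1 =>
    { toFun := 𝒢.dSucc k
      map_add' := fun c c' => by simpa only [one_smul] using 𝒢.dSucc_smul_add k 1 1 c c'
      map_smul' := fun a c => by
        simpa only [zero_smul, add_zero, RingHom.id_apply] using 𝒢.dSucc_smul_add k a 0 c 0 }

/-- The cocycles in `C^k_def(𝒢)`. -/
def cocycles (k : ℕ) : Submodule ℝ (𝒢.RawCochain k) :=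
  𝒢.cochains k ⊓ LinearMap.ker (𝒢.d k)

/-- The coboundaries in `C^k_def(𝒢)`, zero for `k = 0`. -/
def coboundaries : (k : ℕ) → Submodule ℝ (𝒢.RawCochain k)
  | 0 => ⊥
  | k + 1 => 𝒢.cochains (k + 1) ⊓ (𝒢.cochains k).map (𝒢.d k)

/-- The deformation cohomology `H^k_def(𝒢)`: cocycles modulo the coboundaries among them. -/
abbrev DefCohomology (k : ℕ) : Type (max u v) :=
  𝒢.cocycles k ⧸ (𝒢.coboundaries k).comap (𝒢.cocycles k).subtype

end LieGroupoid
end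

noncomputable section

namespace LieGroupoid

/-! ### Principal bibundles and Morita equivalence -/

/-- `f` restricts to a diffeomorphism from `S` to `T`. Below, `S` and `T` are embedded
submanifolds (fibred products along submersions) of the ambient manifolds `X` and `Y`. -/
def IsDiffeoBetween {E : Type*} [NormedAddCommGroup E] [NormedSpace ℝ E]
    {A : Type*} [TopologicalSpace A] (I : ModelWithCorners ℝ E A)
    {E' : Type*} [NormedAddCommGroup E'] [NormedSpace ℝ E']
    {A' : Type*} [TopologicalSpace A'] (J : ModelWithCorners ℝ E' A')
    {X : Type*} [TopologicalSpace X] [ChartedSpace A X]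
    {Y : Type*} [TopologicalSpace Y] [ChartedSpace A' Y]
    (f : X → Y) (S : Set X) (T : Set Y) : Prop :=
  MapsTo f S T ∧ ContMDiffOn I J ∞ f S ∧
    ∃ f' : Y → X, MapsTo f' T S ∧ ContMDiffOn J I ∞ f' T ∧ InvOn f' f S T

section

variable {EM : Type*} [NormedAddCommGroup EM] [NormedSpace ℝ EM]
  {M : Type*} [TopologicalSpace M] [ChartedSpace EM M] [IsManifold 𝓘(ℝ, EM) ∞ M]
  {EG : Type*} [NormedAddCommGroup EG] [NormedSpace ℝ EG]
  {G : Type*} [TopologicalSpace G] [ChartedSpace EG G] [IsManifold 𝓘(ℝ, EG) ∞ G]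

/-- A left action of `𝒢` on a manifold `P`; `act g p = g · p` is meaningful only if
`src g = moment p`, and its other values are irrelevant. -/
structure LeftAction (𝒢 : LieGroupoid EM M EG G)
    (EP : Type*) [NormedAddCommGroup EP] [NormedSpace ℝ EP]
    (P : Type*) [TopologicalSpace P] [ChartedSpace EP P] where
  moment : P → M
  act : G → P → P
  contMDiff_moment : ContMDiff 𝓘(ℝ, EP) 𝓘(ℝ, EM) ∞ moment
  contMDiffOn_act : ContMDiffOn (𝓘(ℝ, EG).prod 𝓘(ℝ, EP)) 𝓘(ℝ, EP) ∞
    (fun a : G × P => act a.1 a.2) {a | 𝒢.src a.1 = moment a.2}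
  moment_act : ∀ g p, 𝒢.src g = moment p → moment (act g p) = 𝒢.tgt g
  unit_act : ∀ p, act (𝒢.unit (moment p)) p = p
  mul_act : ∀ g g' p, 𝒢.src g = 𝒢.tgt g' → 𝒢.src g' = moment p →
    act (𝒢.mul g g') p = act g (act g' p)

/-- A right action of `𝒢` on a manifold `P`; `act p g = p · g` is meaningful only if
`moment p = tgt g`, and its other values are irrelevant. -/
structure RightAction (𝒢 : LieGroupoid EM M EG G)
    (EP : Type*) [NormedAddCommGroup EP] [NormedSpace ℝ EP]
    (P : Type*) [TopologicalSpace P] [ChartedSpace EP P] where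
  moment : P → M
  act : P → G → P
  contMDiff_moment : ContMDiff 𝓘(ℝ, EP) 𝓘(ℝ, EM) ∞ moment
  contMDiffOn_act : ContMDiffOn (𝓘(ℝ, EP).prod 𝓘(ℝ, EG)) 𝓘(ℝ, EP) ∞
    (fun a : P × G => act a.1 a.2) {a | moment a.1 = 𝒢.tgt a.2}
  moment_act : ∀ p g, moment p = 𝒢.tgt g → moment (act p g) = 𝒢.src g
  act_unit : ∀ p, act p (𝒢.unit (moment p)) = p
  act_mul : ∀ p g g', moment p = 𝒢.tgt g → 𝒢.src g = 𝒢.tgt g' →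
    act p (𝒢.mul g g') = act (act p g) g'

variable {𝒢 : LieGroupoid EM M EG G}
  {EP : Type*} [NormedAddCommGroup EP] [NormedSpace ℝ EP]
  {P : Type*} [TopologicalSpace P] [ChartedSpace EP P]
  {EB : Type*} [NormedAddCommGroup EB] [NormedSpace ℝ EB]
  {B : Type*} [TopologicalSpace B] [ChartedSpace EB B]

/-- `π : P → B` is a principal left `𝒢`-bundle: `π` is an invariant surjective submersion and
`𝒢 ×_M P → P ×_B P`, `(g, p) ↦ (g · p, p)`, is a diffeomorphism. -/
structure LeftAction.IsPrincipalBundle (a : LeftAction 𝒢 EP P) (π : P → B) : Prop where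
  isSubmersion : IsSubmersion 𝓘(ℝ, EP) 𝓘(ℝ, EB) ∞ π
  surjective : Function.Surjective π
  invariant : ∀ g p, 𝒢.src g = a.moment p → π (a.act g p) = π p
  isDiffeo : IsDiffeoBetween (𝓘(ℝ, EG).prod 𝓘(ℝ, EP)) (𝓘(ℝ, EP).prod 𝓘(ℝ, EP))
    (fun x : G × P => (a.act x.1 x.2, x.2)) {x | 𝒢.src x.1 = a.moment x.2} {y | π y.1 = π y.2}

/-- `π : P → B` is a principal right `𝒢`-bundle: `π` is an invariant surjective submersion and
`P ×_M 𝒢 → P ×_B P`, `(p, g) ↦ (p, p · g)`, is a diffeomorphism. -/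
structure RightAction.IsPrincipalBundle (a : RightAction 𝒢 EP P) (π : P → B) : Prop where
  isSubmersion : IsSubmersion 𝓘(ℝ, EP) 𝓘(ℝ, EB) ∞ π
  surjective : Function.Surjective π
  invariant : ∀ p g, a.moment p = 𝒢.tgt g → π (a.act p g) = π p
  isDiffeo : IsDiffeoBetween (𝓘(ℝ, EP).prod 𝓘(ℝ, EG)) (𝓘(ℝ, EP).prod 𝓘(ℝ, EP))
    (fun x : P × G => (x.1, a.act x.1 x.2)) {x | a.moment x.1 = 𝒢.tgt x.2} {y | π y.1 = π y.2}

end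

/-- `𝒢` and `ℋ` are Morita equivalent: there are a manifold `P` and commuting left and right
actions of `𝒢` and `ℋ` on it, with moment maps `α : P → M` and `β : P → N`, such that `β` is a
principal left `𝒢`-bundle and `α` is a principal right `ℋ`-bundle. -/
def MoritaEquivalent.{w, p₁, p₂, p₃, p₄, q₁, q₂, q₃, q₄}
    {EM : Type p₁} [NormedAddCommGroup EM] [NormedSpace ℝ EM]
    {M : Type p₂} [TopologicalSpace M] [ChartedSpace EM M] [IsManifold 𝓘(ℝ, EM) ∞ M]
    {EG : Type p₃} [NormedAddCommGroup EG] [NormedSpace ℝ EG]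
    {G : Type p₄} [TopologicalSpace G] [ChartedSpace EG G] [IsManifold 𝓘(ℝ, EG) ∞ G]
    {EN : Type q₁} [NormedAddCommGroup EN] [NormedSpace ℝ EN]
    {N : Type q₂} [TopologicalSpace N] [ChartedSpace EN N] [IsManifold 𝓘(ℝ, EN) ∞ N]
    {EH : Type q₃} [NormedAddCommGroup EH] [NormedSpace ℝ EH]
    {H : Type q₄} [TopologicalSpace H] [ChartedSpace EH H] [IsManifold 𝓘(ℝ, EH) ∞ H]
    (𝒢 : LieGroupoid EM M EG G) (ℋ : LieGroupoid EN N EH H) : Prop :=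
  ∃ (n : ℕ) (P : Type w) (_ : TopologicalSpace P)
    (_ : ChartedSpace (EuclideanSpace ℝ (Fin n)) P)
    (_ : IsManifold 𝓘(ℝ, EuclideanSpace ℝ (Fin n)) ∞ P)
    (a : LeftAction 𝒢 (EuclideanSpace ℝ (Fin n)) P)
    (b : RightAction ℋ (EuclideanSpace ℝ (Fin n)) P),
    a.IsPrincipalBundle (EB := EN) b.moment ∧ b.IsPrincipalBundle (EB := EM) a.moment ∧
    ∀ g p h, 𝒢.src g = a.moment p → b.moment p = ℋ.tgt h →
      b.act (a.act g p) h = a.act g (b.act p h)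

end LieGroupoid
end

universe u₁ u₂ w

set_option linter.unusedSectionVars false

/-! A principal bibundle P allows one to conjugate arrows of ℋ into arrows of 𝒢. If σ and σ' are
local sections of β near t(h) and s(h), there is exactly one g with σ(t h) h = g σ'(s h)
(`LSec.conj`). Conjugation is multiplicative when the same section is used at a common vertex
(`LSec.conj_mul`).

The values of deformation cochains are tangent vectors, so vectors must be carried from T_gG back to
T_hH. For this a local section also carries linear right inverses of dα along σ. Moving g with
velocity v, and the two points of P with the lifts of dt(v) and ds(v), the expression h = σ⁻¹ g σ'
acquires a velocity, which is `LSec.dconj`. This linear map respects the differential of division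
(`LSec.dconj_ddiv`). It also turns projectable values into projectable ones (`LSec.dsrc_dconj`).
Hence, for fixed sections at the vertices of a string, pulling back commutes with δ (`LSec.pull_d`,
`LSec.pull_d_zero`).

Global cochains arise from averages. Take a family of local sections with a subordinate partition of
unity (`Dist`), label every vertex of a string by a member of the family, and weight a labelling by
the product of the weights at the vertices. As the weights add up to one, labels of absent vertices
can be inserted or forgotten (`Dist.avg_face`). So all faces of a string can be averaged over the
labellings of the whole string, and the averaged pullback is a cochain map (`Dist.d_map`).

Transport along P followed by transport along the opposite bibundle is transport along 𝒢 itself, for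
a composite family of sections (`Dist.map_comp`). For the unit section of 𝒢 the pullback is the
identity. Replacing the labels by the unit section one vertex at a time, from the last to the first,
gives a prism homotopy. On cocycles it shows that transport along 𝒢 differs from the identity by a
coboundary (`LSec.altSum_prismSum`, `Dist.d_homSucc`, `Dist.d_homOne`). The prism that replaces
every label but the first takes its values over a unit; its vertical part is therefore right
translated to the arrow in question. In degree zero, transport along 𝒢 fixes cocycles
(`Dist.map_zero_eq`). Two such composites show that the map induced by the opposite bibundle is
bijective.

Infinitesimal identities are proved with curves: a vector tangent to a fibred product along a
submersion is the velocity of a curve inside it (`IsSubmersion.exists_lift`), so a pointwise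
identity along curves yields the identity of the differentials. -/

noncomputable section

/-! ### Submersions: moving points between fibres -/

section Submersion

variable {E : Type*} [NormedAddCommGroup E] [NormedSpace ℝ E]
  {X : Type*} [TopologicalSpace X] [ChartedSpace E X]
  {F : Type*} [NormedAddCommGroup F] [NormedSpace ℝ F]
  {Y : Type*} [TopologicalSpace Y] [ChartedSpace F Y]

/-- Near a point, a submersion `π : X → Y` admits a smooth map `e : X × Y → X` that moves a point
`x` to a point `e (x, y)` in the fibre over `y`, and does not move `x` if `y = π x`. -/
theorem Manifold.IsSubmersion.exists_adjust {π : X → Y}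
    (hπ : IsSubmersion 𝓘(ℝ, E) 𝓘(ℝ, F) ∞ π) (x₀ : X) :
    ∃ (e : X × Y → X) (O : Set (X × Y)), IsOpen O ∧ (x₀, π x₀) ∈ O ∧
      ContMDiffOn (𝓘(ℝ, E).prod 𝓘(ℝ, F)) 𝓘(ℝ, E) ∞ e O ∧
      (∀ p ∈ O, π (e p) = p.2) ∧ ∀ x, (x, π x) ∈ O → e (x, π x) = x := by
  obtain ⟨C, _, _, h⟩ := hπ.isSubmersionAt x₀
  let φ := h.domChart
  let ψ := h.codChart
  let L := h.equiv
  have hw : ∀ z ∈ φ.target, ψ (π (φ.symm z)) = (L z).1 := fun z hz =>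
    h.writtenInCharts (show z ∈ (φ.extend 𝓘(ℝ, E)).target by simpa using hz)
  have hφψ : ∀ x ∈ φ.source, π x ∈ ψ.source := fun x hx => h.source_subset_preimage_source hx
  have hφs : ContMDiffOn 𝓘(ℝ, E) 𝓘(ℝ, E) ∞ φ φ.source :=
    contMDiffOn_of_mem_maximalAtlas h.domChart_mem_maximalAtlas
  have hφt : ContMDiffOn 𝓘(ℝ, E) 𝓘(ℝ, E) ∞ φ.symm φ.target :=
    contMDiffOn_symm_of_mem_maximalAtlas h.domChart_mem_maximalAtlas
  have hψs : ContMDiffOn 𝓘(ℝ, F) 𝓘(ℝ, F) ∞ ψ ψ.source :=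
    contMDiffOn_of_mem_maximalAtlas h.codChart_mem_maximalAtlas
  -- In the charts π is the projection to the first factor. Taking the first coordinate from y and
  -- the second from x moves x into the fibre over y.
  let q : X × Y → E := fun p => L.symm (ψ p.2, (L (φ p.1)).2)
  have hq : ContMDiffOn (𝓘(ℝ, E).prod 𝓘(ℝ, F)) 𝓘(ℝ, E) ∞ q (φ.source ×ˢ ψ.source) := by
    have h1 : ContMDiffOn (𝓘(ℝ, E).prod 𝓘(ℝ, F)) 𝓘(ℝ, F) ∞ (fun p : X × Y => ψ p.2)
        (φ.source ×ˢ ψ.source) := hψs.comp contMDiffOn_snd fun p hp => hp.2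
    have h2 : ContMDiffOn (𝓘(ℝ, E).prod 𝓘(ℝ, F)) 𝓘(ℝ, E) ∞ (fun p : X × Y => φ p.1)
        (φ.source ×ˢ ψ.source) := hφs.comp contMDiffOn_fst fun p hp => hp.1
    have h3 : ContMDiff 𝓘(ℝ, E) 𝓘(ℝ, C) ∞ (fun z : E => (L z).2) :=
      (contDiff_snd.comp L.contDiff).contMDiff
    exact L.symm.contDiff.contMDiff.comp_contMDiffOn (h1.prodMk_space (h3.comp_contMDiffOn h2))
  have hqx : ∀ x ∈ φ.source, q (x, π x) = φ x := by
    intro x hx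
    have h1 := hw (φ x) (φ.map_source hx)
    rw [φ.left_inv hx] at h1
    change L.symm (ψ (π x), (L (φ x)).2) = φ x
    rw [h1, L.symm_apply_apply]
  have hx₀ : x₀ ∈ φ.source := h.mem_domChart_source
  refine ⟨fun p => φ.symm (q p), (φ.source ×ˢ ψ.source) ∩ q ⁻¹' φ.target,
    hq.continuousOn.isOpen_inter_preimage (φ.open_source.prod ψ.open_source) φ.open_target,
    ⟨⟨hx₀, hφψ _ hx₀⟩, ?_⟩, ?_, ?_, ?_⟩
  · change q (x₀, π x₀) ∈ φ.target
    rw [hqx _ hx₀]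
    exact φ.map_source hx₀
  · exact hφt.comp (hq.mono inter_subset_left) fun p hp => hp.2
  · rintro p ⟨⟨hp1, hp2⟩, hp3⟩
    have h1 := hw _ hp3
    rw [show L (q p) = _ from L.apply_symm_apply _] at h1
    exact ψ.injOn (hφψ _ (φ.map_target hp3)) hp2 h1
  · rintro x ⟨⟨hp1, hp2⟩, hp3⟩
    change φ.symm (q (x, π x)) = x
    rw [hqx x hp1, φ.left_inv hp1]

end Submersion

section Pi

variable {E : Type*} [NormedAddCommGroup E] [NormedSpace ℝ E]
  {X : Type*} [TopologicalSpace X] [ChartedSpace E X]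
  {E' : Type*} [NormedAddCommGroup E'] [NormedSpace ℝ E'] {H' : Type*} [TopologicalSpace H']
  {I' : ModelWithCorners ℝ E' H'} {Y : Type*} [TopologicalSpace Y] [ChartedSpace H' Y]

/-- A map to a finite power of a manifold is smooth if its components are. -/
theorem contMDiffWithinAt_pi_of_forall {n : ℕ} {f : Y → Fin n → X} {S : Set Y} {y : Y}
    (h : ∀ i, ContMDiffWithinAt I' 𝓘(ℝ, E) ∞ (fun y => f y i) S y) :
    ContMDiffWithinAt I' (ModelWithCorners.pi fun _ : Fin n => 𝓘(ℝ, E)) ∞ f S y := by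
  rw [contMDiffWithinAt_iff]
  refine ⟨continuousWithinAt_pi.2 fun i => (h i).continuousWithinAt, ?_⟩
  exact contDiffWithinAt_pi.2 fun i => ((contMDiffWithinAt_iff.1 (h i)).2)

end Pi

/-! ### Velocities of curves -/

section Velocity

variable {E : Type*} [NormedAddCommGroup E] [NormedSpace ℝ E] {H : Type*} [TopologicalSpace H]
  {I : ModelWithCorners ℝ E H} {X : Type*} [TopologicalSpace X] [ChartedSpace H X]
  {E' : Type*} [NormedAddCommGroup E'] [NormedSpace ℝ E'] {H' : Type*} [TopologicalSpace H']
  {I' : ModelWithCorners ℝ E' H'} {X' : Type*} [TopologicalSpace X'] [ChartedSpace H' X']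

variable (I) in
/-- The curve `γ` has velocity `v` at time `0`. -/
def HasVel (γ : ℝ → X) (v : E) : Prop :=
  HasMFDerivAt 𝓘(ℝ, ℝ) I γ 0 (ContinuousLinearMap.toSpanSingleton ℝ v)

theorem HasVel.unique {γ : ℝ → X} {v w : E} (hv : HasVel I γ v) (hw : HasVel I γ w) : v = w := by
  have h := hasMFDerivAt_unique hv hw
  have h1 := congrArg (fun L : ℝ →L[ℝ] E => L 1) h
  exact (one_smul ℝ v).symm.trans (h1.trans (one_smul ℝ w))

theorem HasVel.congr {γ γ' : ℝ → X} {v : E} (hv : HasVel I γ v) (h : ∀ᶠ t in 𝓝 0, γ' t = γ t) :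
    HasVel I γ' v :=
  HasMFDerivAt.congr_of_eventuallyEq (f := γ) (f₁ := γ') hv h

/-- The main tool for identities between differentials: two expressions that agree along curves near
time 0 have the same velocity there. -/
theorem HasVel.eq_of_eventually {γ γ' : ℝ → X} {v w : E} (hv : HasVel I γ v) (hw : HasVel I γ' w)
    (h : ∀ᶠ t in 𝓝 0, γ t = γ' t) : v = w :=
  hv.unique (hw.congr h)

theorem HasVel.continuousAt {γ : ℝ → X} {v : E} (hv : HasVel I γ v) : ContinuousAt γ 0 :=
  hv.1

theorem HasVel.prodMk {γ : ℝ → X} {γ' : ℝ → X'} {v : E} {w : E'} (hv : HasVel I γ v)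
    (hw : HasVel I' γ' w) : HasVel (I.prod I') (fun t => (γ t, γ' t)) (v, w) := by
  have h := HasMFDerivAt.prodMk hv hw
  refine h.congr_mfderiv ?_
  refine ContinuousLinearMap.ext fun (t : ℝ) => ?_
  exact (Prod.smul_mk t v w).symm

/-- On a set such as a fibred product the derivative within `S` need not be unique, and
`mfderivWithin` is one choice. Because the curve stays in `S`, the chain rule holds for whichever
derivative is chosen, and so its value on `v` is the velocity of the image curve. -/
theorem HasVel.comp_within {γ : ℝ → X} {v : E} (hv : HasVel I γ v) {f : X → X'} {S : Set X}
    {x : X} (hx : γ 0 = x) (hf : MDifferentiableWithinAt I I' f S x) (hS : ∀ᶠ t in 𝓝 0, γ t ∈ S) :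
    HasVel I' (fun t => f (γ t)) (mfderivWithin I I' f S x v : E') := by
  subst hx
  have h := HasMFDerivWithinAt.comp (0 : ℝ) hf.hasMFDerivWithinAt
    (HasMFDerivAt.hasMFDerivWithinAt (s := γ ⁻¹' S) hv) subset_rfl
  have h2 : HasMFDerivAt 𝓘(ℝ, ℝ) I' (f ∘ γ) 0 _ := h.hasMFDerivAt hS
  refine h2.congr_mfderiv (ContinuousLinearMap.ext fun (t : ℝ) => ?_)
  exact map_smul (mfderivWithin I I' f S (γ 0)) t v

theorem HasVel.comp {γ : ℝ → X} {v : E} (hv : HasVel I γ v) {f : X → X'} {x : X}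
    (hx : γ 0 = x) (hf : MDifferentiableAt I I' f x) :
    HasVel I' (fun t => f (γ t)) (mfderiv I I' f x v : E') := by
  rw [← mfderivWithin_univ]
  exact hv.comp_within hx hf.mdifferentiableWithinAt (by simp)

theorem hasVel_const (x : X) : HasVel I (fun _ => x) (0 : E) := by
  have h := hasMFDerivAt_const (I := 𝓘(ℝ, ℝ)) (I' := I) x (0 : ℝ)
  refine h.congr_mfderiv (ContinuousLinearMap.ext fun (t : ℝ) => ?_)
  exact (smul_zero (A := E) t).symm

theorem exists_hasVel {F : Type*} [NormedAddCommGroup F] [NormedSpace ℝ F] {Y : Type*}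
    [TopologicalSpace Y] [ChartedSpace F Y] (y : Y) (v : F) :
    ∃ γ : ℝ → Y, γ 0 = y ∧ HasVel 𝓘(ℝ, F) γ v := by
  let φ := extChartAt 𝓘(ℝ, F) y
  have h0 : φ.symm (φ y + (0 : ℝ) • v) = y := by simp [φ]
  have hc : Continuous fun t : ℝ => φ y + t • v := by fun_prop
  refine ⟨fun t => φ.symm (φ y + t • v), h0, ?_, ?_⟩
  · have h1 : ContinuousAt φ.symm (φ y + (0 : ℝ) • v) := by
      simpa [φ] using continuousAt_extChartAt_symm (I := 𝓘(ℝ, F)) y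
    exact ContinuousAt.comp (f := fun t : ℝ => φ y + t • v) h1 hc.continuousAt
  · have h2 : HasFDerivAt (fun t : ℝ => φ y + t • v) (ContinuousLinearMap.toSpanSingleton ℝ v)
        (0 : ℝ) := by
      have := ((hasDerivAt_id (0 : ℝ)).smul_const v).const_add (φ y)
      simpa using this.hasFDerivAt
    have hev : ∀ᶠ t in 𝓝 (0 : ℝ), φ y + t • v ∈ φ.target := by
      refine hc.continuousAt.eventually_mem ?_
      simpa [φ] using extChartAt_target_mem_nhds (I := 𝓘(ℝ, F)) y
    refine HasFDerivAt.hasFDerivWithinAt ?_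
    simp only [writtenInExtChartAt, h0, extChartAt_model_space_eq_id, PartialEquiv.refl_coe, id]
    refine h2.congr_of_eventuallyEq ?_
    filter_upwards [hev] with t ht
    simp only [Function.comp, PartialEquiv.refl_symm, PartialEquiv.refl_coe, id]
    exact φ.right_inv ht

end Velocity

/-! ### Lifting curves along submersions -/

section Lifting

variable {E : Type*} [NormedAddCommGroup E] [NormedSpace ℝ E]
  {X : Type*} [TopologicalSpace X] [ChartedSpace E X]
  {F : Type*} [NormedAddCommGroup F] [NormedSpace ℝ F]
  {Y : Type*} [TopologicalSpace Y] [ChartedSpace F Y]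

/-- Curves and their velocities can be lifted along submersions. -/
theorem Manifold.IsSubmersion.exists_lift {π : X → Y}
    (hπ : IsSubmersion 𝓘(ℝ, E) 𝓘(ℝ, F) ∞ π) {η : ℝ → Y} {x : X} {v : E} (hx : η 0 = π x)
    (hη : HasVel 𝓘(ℝ, F) η (mfderiv 𝓘(ℝ, E) 𝓘(ℝ, F) π x v : F)) :
    ∃ γ : ℝ → X, γ 0 = x ∧ HasVel 𝓘(ℝ, E) γ v ∧ ∀ᶠ t in 𝓝 0, π (γ t) = η t := by
  obtain ⟨e, O, hO, hxO, he, he1, he2⟩ := hπ.exists_adjust x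
  obtain ⟨γ, hγ0, hγ⟩ := exists_hasVel x v
  have hmd : MDifferentiableAt (𝓘(ℝ, E).prod 𝓘(ℝ, F)) 𝓘(ℝ, E) e (x, π x) :=
    ((he _ hxO).contMDiffAt (hO.mem_nhds hxO)).mdifferentiableAt (by simp)
  have hpi := (hπ.contMDiff x).mdifferentiableAt (by simp)
  have h1 := (hγ.prodMk hη).comp (x := (x, π x)) (by rw [hγ0, hx]) hmd
  have h2 := (hγ.prodMk (hγ.comp hγ0 hpi)).comp (x := (x, π x)) (by rw [hγ0]) hmd
  have hc2 : ContinuousAt (fun t => (γ t, π (γ t))) 0 :=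
    (hγ.prodMk (hγ.comp hγ0 hpi)).continuousAt
  have hc1 : ContinuousAt (fun t => (γ t, η t)) 0 := (hγ.prodMk hη).continuousAt
  have h3 : ∀ᶠ t in 𝓝 0, (γ t, π (γ t)) ∈ O :=
    hc2.eventually_mem (by rw [hγ0]; exact hO.mem_nhds hxO)
  have h4 : ∀ᶠ t in 𝓝 0, (γ t, η t) ∈ O :=
    hc1.eventually_mem (by rw [hγ0, hx]; exact hO.mem_nhds hxO)
  -- The curves `e (γ, η)` and `e (γ, π γ)` have the same velocity, because `η` and `π ∘ γ` do. The
  -- second curve is `γ` near time 0, so this velocity is `v`.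
  have h5 := h2.eq_of_eventually hγ (h3.mono fun t ht => he2 _ ht)
  rw [h5] at h1
  refine ⟨fun t => e (γ t, η t), ?_, h1, h4.mono fun t ht => he1 _ ht⟩
  change e (γ 0, η 0) = x
  rw [hγ0, hx, he2 x hxO]

end Lifting

/-! ### Smooth vector fields along maps -/

section SmoothAlong

variable {E : Type*} [NormedAddCommGroup E] [NormedSpace ℝ E]
  {X : Type*} [TopologicalSpace X] [ChartedSpace E X] [IsManifold 𝓘(ℝ, E) ∞ X]
  {E₁ : Type*} [NormedAddCommGroup E₁] [NormedSpace ℝ E₁]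
  {X₁ : Type*} [TopologicalSpace X₁] [ChartedSpace E₁ X₁] [IsManifold 𝓘(ℝ, E₁) ∞ X₁]
  {F : Type*} [NormedAddCommGroup F] [NormedSpace ℝ F]
  {Z : Type*} [TopologicalSpace Z] [ChartedSpace F Z] [IsManifold 𝓘(ℝ, F) ∞ Z]
  {E' : Type*} [NormedAddCommGroup E'] [NormedSpace ℝ E'] {H' : Type*} [TopologicalSpace H']
  {I' : ModelWithCorners ℝ E' H'} {Y : Type*} [TopologicalSpace Y] [ChartedSpace H' Y]

variable (I') in
/-- `v` is a smooth vector field along `f`, within `S` at `y`. -/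
def SmoothAlong (f : Y → X) (v : Y → E) (S : Set Y) (y : Y) : Prop :=
  ContMDiffWithinAt I' 𝓘(ℝ, E).tangent ∞ (fun y => (⟨f y, v y⟩ : TangentBundle 𝓘(ℝ, E) X)) S y

variable {f : Y → X} {v w : Y → E} {S : Set Y} {y : Y}

theorem SmoothAlong.base (h : SmoothAlong I' f v S y) : ContMDiffWithinAt I' 𝓘(ℝ, E) ∞ f S y :=
  ((Bundle.contMDiffWithinAt_totalSpace).1 h).1

theorem SmoothAlong.congr {f' : Y → X} {v' : Y → E} (h : SmoothAlong I' f v S y) (hy : y ∈ S)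
    (hf : ∀ᶠ z in 𝓝[S] y, f' z = f z) (hv : ∀ᶠ z in 𝓝[S] y, v' z = v z) :
    SmoothAlong I' f' v' S y := by
  have key : ∀ z, f' z = f z → v' z = v z → (⟨f' z, v' z⟩ : TangentBundle 𝓘(ℝ, E) X) =
      ⟨f z, v z⟩ := by
    intro z h1 h2
    rw [h1, h2]
  refine ContMDiffWithinAt.congr_of_eventuallyEq h ?_ ?_
  · filter_upwards [hf, hv] with z h1 h2 using key z h1 h2
  · exact key y (hf.self_of_nhdsWithin hy) (hv.self_of_nhdsWithin hy)

theorem smoothAlong_zero (hf : ContMDiffWithinAt I' 𝓘(ℝ, E) ∞ f S y) :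
    SmoothAlong I' f (fun _ => (0 : E)) S y :=
  (Bundle.contMDiff_zeroSection ℝ (TangentSpace 𝓘(ℝ, E) : X → Type _)).contMDiffAt.comp_contMDiffWithinAt
    y hf

theorem SmoothAlong.smul_add_smul {a b : Y → ℝ} (hv : SmoothAlong I' f v S y)
    (hw : SmoothAlong I' f w S y) (ha : ContMDiffWithinAt I' 𝓘(ℝ, ℝ) ∞ a S y)
    (hb : ContMDiffWithinAt I' 𝓘(ℝ, ℝ) ∞ b S y) :
    SmoothAlong I' f (fun z => a z • v z + b z • w z) S y := by
  have h1 := (Bundle.contMDiffWithinAt_totalSpace).1 hv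
  have h2 := (Bundle.contMDiffWithinAt_totalSpace).1 hw
  refine (Bundle.contMDiffWithinAt_totalSpace).2 ⟨h1.1, ?_⟩
  let e := trivializationAt E (TangentSpace 𝓘(ℝ, E)) (f y)
  have h3 := (ha.smul h1.2).add (hb.smul h2.2)
  have hmem : f ⁻¹' e.baseSet ∈ 𝓝[S] y :=
    h1.1.continuousWithinAt.preimage_mem_nhdsWithin
      (e.open_baseSet.mem_nhds (FiberBundle.mem_baseSet_trivializationAt' (f y)))
  have key : ∀ z, f z ∈ e.baseSet → (e (⟨f z, a z • v z + b z • w z⟩ : TangentBundle 𝓘(ℝ, E) X)).2 =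
      a z • (e (⟨f z, v z⟩ : TangentBundle 𝓘(ℝ, E) X)).2 +
        b z • (e (⟨f z, w z⟩ : TangentBundle 𝓘(ℝ, E) X)).2 := by
    intro z hz
    have hl := e.linear ℝ hz
    exact (hl.map_add _ _).trans (congrArg₂ (· + ·) (hl.map_smul _ _) (hl.map_smul _ _))
  refine h3.congr_of_eventuallyEq ?_ ?_
  · filter_upwards [hmem] with z hz using key z hz
  · exact key y (FiberBundle.mem_baseSet_trivializationAt' (f y))

theorem SmoothAlong.add (hv : SmoothAlong I' f v S y) (hw : SmoothAlong I' f w S y) :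
    SmoothAlong I' f (fun z => v z + w z) S y := by
  simpa only [one_smul] using hv.smul_add_smul hw (a := fun _ => 1) (b := fun _ => 1)
    contMDiffWithinAt_const contMDiffWithinAt_const

theorem SmoothAlong.sub (hv : SmoothAlong I' f v S y) (hw : SmoothAlong I' f w S y) :
    SmoothAlong I' f (fun z => v z - w z) S y := by
  simpa only [one_smul, neg_smul, ← sub_eq_add_neg] using
    hv.smul_add_smul hw (a := fun _ => 1) (b := fun _ => -1)
    contMDiffWithinAt_const contMDiffWithinAt_const

theorem SmoothAlong.smul {a : Y → ℝ} (hv : SmoothAlong I' f v S y)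
    (ha : ContMDiffWithinAt I' 𝓘(ℝ, ℝ) ∞ a S y) :
    SmoothAlong I' f (fun z => a z • v z) S y := by
  simpa only [zero_smul, add_zero] using hv.smul_add_smul hv ha (b := fun _ => 0)
    contMDiffWithinAt_const

theorem SmoothAlong.sum {ι : Type*} {s : Finset ι} {u : ι → Y → E}
    (hf : ContMDiffWithinAt I' 𝓘(ℝ, E) ∞ f S y) (hu : ∀ i ∈ s, SmoothAlong I' f (u i) S y) :
    SmoothAlong I' f (fun z => ∑ i ∈ s, u i z) S y := by
  classical
  induction s using Finset.induction_on with
  | empty => simpa using smoothAlong_zero hf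
  | insert i s hi ih =>
    simp only [Finset.sum_insert hi]
    exact (hu i (by simp)).add (ih fun j hj => hu j (by simp [hj]))

theorem SmoothAlong.mfderivOn {e : X → Z} {O : Set X} (hO : IsOpen O)
    (he : ContMDiffOn 𝓘(ℝ, E) 𝓘(ℝ, F) ∞ e O) (h : SmoothAlong I' f v S y) (hy : f y ∈ O)
    (hyS : y ∈ S) :
    SmoothAlong I' (fun z => e (f z))
      (fun z => (mfderiv 𝓘(ℝ, E) 𝓘(ℝ, F) e (f z) (v z) : F)) S y := by
  have h1 : ContMDiffOn _ _ ∞ (tangentMapWithin 𝓘(ℝ, E) 𝓘(ℝ, F) e O) _ :=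
    he.contMDiffOn_tangentMapWithin (m := ∞) (by simp) hO.uniqueMDiffOn
  have h2 : Bundle.TotalSpace.proj ⁻¹' O ∈
      𝓝 ((⟨f y, v y⟩ : TangentBundle 𝓘(ℝ, E) X)) :=
    (FiberBundle.continuous_proj E (TangentSpace 𝓘(ℝ, E) : X → Type _)).continuousAt.preimage_mem_nhds
      (hO.mem_nhds hy)
  have h3 := (h1 (⟨f y, v y⟩ : TangentBundle 𝓘(ℝ, E) X) hy).contMDiffAt h2
  have h4 := ContMDiffAt.comp_contMDiffWithinAt y h3 h
  refine SmoothAlong.congr (f := fun z => e (f z))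
    (v := fun z => mfderivWithin 𝓘(ℝ, E) 𝓘(ℝ, F) e O (f z) (v z)) h4 hyS
    (Filter.Eventually.of_forall fun _ => rfl) ?_
  have h5 : ∀ᶠ z in 𝓝[S] y, f z ∈ O :=
    h.base.continuousWithinAt.eventually_mem (hO.mem_nhds hy)
  filter_upwards [h5] with z hz
  rw [mfderivWithin_of_isOpen hO hz]

theorem SmoothAlong.mfderiv {e : X → Z} (he : ContMDiff 𝓘(ℝ, E) 𝓘(ℝ, F) ∞ e)
    (h : SmoothAlong I' f v S y) (hyS : y ∈ S) :
    SmoothAlong I' (fun z => e (f z))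
      (fun z => (_root_.mfderiv 𝓘(ℝ, E) 𝓘(ℝ, F) e (f z) (v z) : F)) S y :=
  h.mfderivOn isOpen_univ he.contMDiffOn (mem_univ _) hyS

theorem SmoothAlong.mfderivOn₂ {e : X × X₁ → Z} {O : Set (X × X₁)} (hO : IsOpen O)
    (he : ContMDiffOn (𝓘(ℝ, E).prod 𝓘(ℝ, E₁)) 𝓘(ℝ, F) ∞ e O) {g : Y → X₁} {u : Y → E₁}
    (h : SmoothAlong I' f v S y) (h' : SmoothAlong I' g u S y) (hy : (f y, g y) ∈ O)
    (hyS : y ∈ S) :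
    SmoothAlong I' (fun z => e (f z, g z))
      (fun z => (_root_.mfderiv (𝓘(ℝ, E).prod 𝓘(ℝ, E₁)) 𝓘(ℝ, F) e (f z, g z)
        ((v z, u z) : E × E₁) : F)) S y := by
  have h0 : ContMDiffWithinAt I' (𝓘(ℝ, E).prod 𝓘(ℝ, E₁)).tangent ∞
      (fun z => (⟨(f z, g z), ((v z, u z) : E × E₁)⟩ :
        TangentBundle (𝓘(ℝ, E).prod 𝓘(ℝ, E₁)) (X × X₁))) S y :=
    ContMDiffAt.comp_contMDiffWithinAt y
      (contMDiff_equivTangentBundleProd_symm (I := 𝓘(ℝ, E)) (M := X) (I' := 𝓘(ℝ, E₁)) (M' := X₁)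
        (n := ∞)).contMDiffAt (ContMDiffWithinAt.prodMk h h')
  have h1 : ContMDiffOn _ _ ∞ (tangentMapWithin (𝓘(ℝ, E).prod 𝓘(ℝ, E₁)) 𝓘(ℝ, F) e O) _ :=
    he.contMDiffOn_tangentMapWithin (m := ∞) (by simp) hO.uniqueMDiffOn
  have h2 : Bundle.TotalSpace.proj ⁻¹' O ∈
      𝓝 ((⟨(f y, g y), ((v y, u y) : E × E₁)⟩ :
        TangentBundle (𝓘(ℝ, E).prod 𝓘(ℝ, E₁)) (X × X₁))) :=
    (FiberBundle.continuous_proj (E × E₁)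
      (TangentSpace (𝓘(ℝ, E).prod 𝓘(ℝ, E₁)) : X × X₁ → Type _)).continuousAt.preimage_mem_nhds
      (hO.mem_nhds hy)
  have h3 := (h1 (⟨(f y, g y), ((v y, u y) : E × E₁)⟩ :
        TangentBundle (𝓘(ℝ, E).prod 𝓘(ℝ, E₁)) (X × X₁)) hy).contMDiffAt h2
  have h4 := ContMDiffAt.comp_contMDiffWithinAt y h3 h0
  refine SmoothAlong.congr (f := fun z => e (f z, g z))
    (v := fun z => mfderivWithin (𝓘(ℝ, E).prod 𝓘(ℝ, E₁)) 𝓘(ℝ, F) e O (f z, g z)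
      ((v z, u z) : E × E₁)) h4 hyS
    (Filter.Eventually.of_forall fun _ => rfl) ?_
  have h5 : ∀ᶠ z in 𝓝[S] y, (f z, g z) ∈ O :=
    (h.base.continuousWithinAt.prodMk h'.base.continuousWithinAt).eventually_mem (hO.mem_nhds hy)
  filter_upwards [h5] with z hz
  rw [mfderivWithin_of_isOpen hO hz]

end SmoothAlong

/-! ### Differentials of maps defined on fibred products -/

section FibreProduct

variable {E : Type*} [NormedAddCommGroup E] [NormedSpace ℝ E]
  {X : Type*} [TopologicalSpace X] [ChartedSpace E X] [IsManifold 𝓘(ℝ, E) ∞ X]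
  {E₁ : Type*} [NormedAddCommGroup E₁] [NormedSpace ℝ E₁]
  {X₁ : Type*} [TopologicalSpace X₁] [ChartedSpace E₁ X₁] [IsManifold 𝓘(ℝ, E₁) ∞ X₁]
  {EB : Type*} [NormedAddCommGroup EB] [NormedSpace ℝ EB]
  {B : Type*} [TopologicalSpace B] [ChartedSpace EB B] [IsManifold 𝓘(ℝ, EB) ∞ B]
  {F : Type*} [NormedAddCommGroup F] [NormedSpace ℝ F]
  {Z : Type*} [TopologicalSpace Z] [ChartedSpace F Z] [IsManifold 𝓘(ℝ, F) ∞ Z]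
  {E' : Type*} [NormedAddCommGroup E'] [NormedSpace ℝ E'] {H' : Type*} [TopologicalSpace H']
  {I' : ModelWithCorners ℝ E' H'} {Y : Type*} [TopologicalSpace Y] [ChartedSpace H' Y]

/-- The differential of a map `F` on a set of pairs, applied to a pair of tangent vectors. -/
def fderivPair (Φ : X × X₁ → Z) (S : Set (X × X₁)) (x : X) (x₁ : X₁) (v : E) (w : E₁) : F :=
  mfderivWithin (𝓘(ℝ, E).prod 𝓘(ℝ, E₁)) 𝓘(ℝ, F) Φ S (x, x₁) ((v, w) : E × E₁)

theorem fderivPair_add (Φ : X × X₁ → Z) (S : Set (X × X₁)) (x : X) (x₁ : X₁) (v v' : E)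
    (w w' : E₁) : (fderivPair Φ S x x₁ (v + v') (w + w') : F) =
      fderivPair Φ S x x₁ v w + fderivPair Φ S x x₁ v' w' :=
  map_add (mfderivWithin (𝓘(ℝ, E).prod 𝓘(ℝ, E₁)) 𝓘(ℝ, F) Φ S (x, x₁)) ((v, w) : E × E₁)
    ((v', w') : E × E₁)

theorem fderivPair_smul (Φ : X × X₁ → Z) (S : Set (X × X₁)) (x : X) (x₁ : X₁) (a : ℝ) (v : E)
    (w : E₁) : (fderivPair Φ S x x₁ (a • v) (a • w) : F) = a • fderivPair Φ S x x₁ v w :=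
  map_smul (mfderivWithin (𝓘(ℝ, E).prod 𝓘(ℝ, E₁)) 𝓘(ℝ, F) Φ S (x, x₁)) a ((v, w) : E × E₁)

theorem HasVel.fderivPair {Φ : X × X₁ → Z} {S : Set (X × X₁)}
    (hΦ : ContMDiffOn (𝓘(ℝ, E).prod 𝓘(ℝ, E₁)) 𝓘(ℝ, F) ∞ Φ S) {γ : ℝ → X} {γ₁ : ℝ → X₁} {x : X}
    {x₁ : X₁} {v : E} {w : E₁} (hx : γ 0 = x) (hx₁ : γ₁ 0 = x₁) (hv : HasVel 𝓘(ℝ, E) γ v)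
    (hw : HasVel 𝓘(ℝ, E₁) γ₁ w) (hS : ∀ᶠ t in 𝓝 0, (γ t, γ₁ t) ∈ S) :
    HasVel 𝓘(ℝ, F) (fun t => Φ (γ t, γ₁ t)) (fderivPair Φ S x x₁ v w) := by
  subst hx hx₁
  exact (hv.prodMk hw).comp_within rfl ((hΦ _ hS.self_of_nhds).mdifferentiableWithinAt (by simp)) hS

/-- `Φ` is smooth only on the fibred product, so it is first extended to an open set by a local
retraction `r`. The ordinary tangent map of the extension depends smoothly on its argument, and on
vectors tangent to the fibred product it agrees with the derivative within. -/
theorem SmoothAlong.fderivPair {π : X → B} {π₁ : X₁ → B}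
    (hπ : IsSubmersion 𝓘(ℝ, E) 𝓘(ℝ, EB) ∞ π) (hπ₁ : ContMDiff 𝓘(ℝ, E₁) 𝓘(ℝ, EB) ∞ π₁)
    {Φ : X × X₁ → Z}
    (hΦ : ContMDiffOn (𝓘(ℝ, E).prod 𝓘(ℝ, E₁)) 𝓘(ℝ, F) ∞ Φ {p | π p.1 = π₁ p.2})
    {f : Y → X} {v : Y → E} {f₁ : Y → X₁} {v₁ : Y → E₁} {S : Set Y} {y : Y} (hyS : y ∈ S)
    (h : SmoothAlong I' f v S y) (h₁ : SmoothAlong I' f₁ v₁ S y)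
    (hf : ∀ᶠ z in 𝓝[S] y, π (f z) = π₁ (f₁ z))
    (hv : ∀ᶠ z in 𝓝[S] y, (_root_.mfderiv 𝓘(ℝ, E) 𝓘(ℝ, EB) π (f z) (v z) : EB) =
      _root_.mfderiv 𝓘(ℝ, E₁) 𝓘(ℝ, EB) π₁ (f₁ z) (v₁ z)) :
    SmoothAlong I' (fun z => Φ (f z, f₁ z))
      (fun z => (_root_.fderivPair Φ {p | π p.1 = π₁ p.2} (f z) (f₁ z) (v z) (v₁ z) : F)) S y := by
  obtain ⟨e, O, hO, hxO, he, he1, he2⟩ := hπ.exists_adjust (f y)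
  let r : X × X₁ → X × X₁ := fun p => (e (p.1, π₁ p.2), p.2)
  let O' : Set (X × X₁) := {p | (p.1, π₁ p.2) ∈ O}
  have hc : ContMDiff (𝓘(ℝ, E).prod 𝓘(ℝ, E₁)) (𝓘(ℝ, E).prod 𝓘(ℝ, EB)) ∞
      (fun p : X × X₁ => (p.1, π₁ p.2)) :=
    contMDiff_fst.prodMk (hπ₁.comp contMDiff_snd)
  have hO' : IsOpen O' := hO.preimage hc.continuous
  have hr : ContMDiffOn (𝓘(ℝ, E).prod 𝓘(ℝ, E₁)) (𝓘(ℝ, E).prod 𝓘(ℝ, E₁)) ∞ r O' :=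
    (he.comp hc.contMDiffOn fun p hp => hp).prodMk contMDiffOn_snd
  have hrS : ∀ p ∈ O', r p ∈ {p : X × X₁ | π p.1 = π₁ p.2} := fun p hp => he1 _ hp
  have hr1 : ∀ p ∈ O', π p.1 = π₁ p.2 → r p = p := by
    intro p hp hp'
    refine Prod.ext ?_ rfl
    change e (p.1, π₁ p.2) = p.1
    rw [← hp', he2]
    rw [hp']
    exact hp
  have hΨ : ContMDiffOn (𝓘(ℝ, E).prod 𝓘(ℝ, E₁)) 𝓘(ℝ, F) ∞ (fun p => Φ (r p)) O' := hΦ.comp hr hrS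
  have hyO : (f y, f₁ y) ∈ O' := by
    change (f y, π₁ (f₁ y)) ∈ O
    rwa [← hf.self_of_nhdsWithin hyS]
  have h5 : ∀ᶠ z in 𝓝[S] y, (f z, f₁ z) ∈ O' :=
    (h.base.continuousWithinAt.prodMk h₁.base.continuousWithinAt).eventually_mem (hO'.mem_nhds hyO)
  refine SmoothAlong.congr (h.mfderivOn₂ hO' hΨ h₁ hyO hyS) hyS ?_ ?_
  · filter_upwards [hf, h5] with z hz hz'
    rw [hr1 _ hz' hz]
  · filter_upwards [hf, hv, h5] with z hz hvz hz'
    -- Both derivatives are compared on a curve in the fibred product with velocity `(v z, v₁ z)`,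
    -- where `Φ` and `Φ ∘ r` coincide.
    obtain ⟨γ₁, hγ₁0, hγ₁⟩ := exists_hasVel (f₁ z) (v₁ z)
    have h6 := hγ₁.comp hγ₁0 ((hπ₁ (f₁ z)).mdifferentiableAt (by simp))
    obtain ⟨γ, hγ0, hγ, hγπ⟩ := hπ.exists_lift (η := fun t => π₁ (γ₁ t)) (x := f z) (v := v z)
      (by rw [hγ₁0, hz]) (by rw [hvz]; exact h6)
    have h7 := HasVel.fderivPair hΦ hγ0 hγ₁0 hγ hγ₁ hγπ
    have h8 := (hγ.prodMk hγ₁).comp (x := (f z, f₁ z)) (by rw [hγ0, hγ₁0])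
      (((hΨ _ hz').contMDiffAt (hO'.mem_nhds hz')).mdifferentiableAt (by simp))
    refine h7.eq_of_eventually h8 ?_
    have h9 : ∀ᶠ t in 𝓝 0, (γ t, γ₁ t) ∈ O' :=
      (hγ.prodMk hγ₁).continuousAt.eventually_mem
        (by rw [hγ0, hγ₁0]; exact hO'.mem_nhds hz')
    filter_upwards [hγπ, h9] with t ht ht'
    rw [hr1 _ ht' ht]

end FibreProduct

/-! ### Groupoid identities and their differentials -/

namespace LieGroupoid

universe u

section Algebra

variable {EM : Type*} [NormedAddCommGroup EM] [NormedSpace ℝ EM]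
  {M : Type u} [TopologicalSpace M] [ChartedSpace EM M] [IsManifold 𝓘(ℝ, EM) ∞ M]
  {EG : Type*} [NormedAddCommGroup EG] [NormedSpace ℝ EG]
  {G : Type u} [TopologicalSpace G] [ChartedSpace EG G] [IsManifold 𝓘(ℝ, EG) ∞ G]
  (𝒢 : LieGroupoid EM M EG G)

theorem inv_mul_cancel {g h : G} (H : 𝒢.src g = 𝒢.tgt h) : 𝒢.mul (𝒢.inv g) (𝒢.mul g h) = h := by
  rw [← 𝒢.mul_assoc _ _ _ (𝒢.src_inv g) H, 𝒢.inv_mul, H, 𝒢.unit_mul]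

theorem mul_inv_cancel {g h : G} (H : 𝒢.src g = 𝒢.tgt h) :
    𝒢.mul (𝒢.mul g h) (𝒢.inv h) = g := by
  rw [𝒢.mul_assoc _ _ _ H (𝒢.tgt_inv h).symm, 𝒢.mul_inv, ← H, 𝒢.mul_unit]

theorem inv_mul_mul_cancel {g h : G} (H : 𝒢.tgt g = 𝒢.tgt h) :
    𝒢.mul g (𝒢.mul (𝒢.inv g) h) = h := by
  rw [← 𝒢.mul_assoc _ _ _ (𝒢.tgt_inv g).symm ((𝒢.src_inv g).trans H), 𝒢.mul_inv, H, 𝒢.unit_mul]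

theorem src_div {g h : G} (H : 𝒢.src g = 𝒢.src h) : 𝒢.src (𝒢.div g h) = 𝒢.tgt h := by
  rw [div, 𝒢.src_mul _ _ (H.trans (𝒢.tgt_inv h).symm), 𝒢.src_inv]

theorem tgt_div {g h : G} (H : 𝒢.src g = 𝒢.src h) : 𝒢.tgt (𝒢.div g h) = 𝒢.tgt g := by
  rw [div, 𝒢.tgt_mul _ _ (H.trans (𝒢.tgt_inv h).symm)]

theorem div_mul {g h : G} (H : 𝒢.src g = 𝒢.src h) : 𝒢.mul (𝒢.div g h) h = g := by
  rw [div, 𝒢.mul_assoc _ _ _ (H.trans (𝒢.tgt_inv h).symm) (𝒢.src_inv h), 𝒢.inv_mul, ← H,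
    𝒢.mul_unit]

theorem mul_div {g h : G} (H : 𝒢.src g = 𝒢.tgt h) : 𝒢.div (𝒢.mul g h) h = g :=
  𝒢.mul_inv_cancel H

theorem mul_right_cancel {g g' h : G} (H : 𝒢.src g = 𝒢.tgt h) (H' : 𝒢.src g' = 𝒢.tgt h)
    (e : 𝒢.mul g h = 𝒢.mul g' h) : g = g' := by
  rw [← 𝒢.mul_inv_cancel H, e, 𝒢.mul_inv_cancel H']

theorem div_self (g : G) : 𝒢.div g g = 𝒢.unit (𝒢.tgt g) := 𝒢.mul_inv g

theorem div_unit (g : G) : 𝒢.div g (𝒢.unit (𝒢.src g)) = g := by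
  rw [div, inv_unit, mul_unit]

theorem div_mul_mul {g h k : G} (H : 𝒢.src g = 𝒢.src h) (H' : 𝒢.src h = 𝒢.tgt k) :
    𝒢.div (𝒢.mul g k) (𝒢.mul h k) = 𝒢.div g h := by
  have e : 𝒢.src (𝒢.mul g k) = 𝒢.src (𝒢.mul h k) := by
    rw [𝒢.src_mul _ _ (H.trans H'), 𝒢.src_mul _ _ H']
  refine 𝒢.mul_right_cancel (h := 𝒢.mul h k) (𝒢.src_div e) ?_ ?_
  · rw [𝒢.src_div H, 𝒢.tgt_mul _ _ H']
  · rw [𝒢.div_mul e, ← 𝒢.mul_assoc _ _ _ (𝒢.src_div H) H', 𝒢.div_mul H]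

theorem mul_div_div {g h k : G} (H : 𝒢.src g = 𝒢.src h) (H' : 𝒢.src h = 𝒢.src k) :
    𝒢.mul (𝒢.div g h) (𝒢.div h k) = 𝒢.div g k := by
  have e : 𝒢.src (𝒢.div g h) = 𝒢.tgt (𝒢.div h k) := by rw [𝒢.src_div H, 𝒢.tgt_div H']
  refine 𝒢.mul_right_cancel (h := k) ?_ (𝒢.src_div (H.trans H')) ?_
  · rw [𝒢.src_mul _ _ e, 𝒢.src_div H']
  · rw [𝒢.mul_assoc _ _ _ e (𝒢.src_div H'), 𝒢.div_mul H', 𝒢.div_mul H,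
      𝒢.div_mul (H.trans H')]

theorem div_div_div {g h k : G} (H : 𝒢.src g = 𝒢.src k) (H' : 𝒢.src h = 𝒢.src k) :
    𝒢.div (𝒢.div g k) (𝒢.div h k) = 𝒢.div g h := by
  have e : 𝒢.src (𝒢.div g k) = 𝒢.src (𝒢.div h k) := by rw [𝒢.src_div H, 𝒢.src_div H']
  have e' := H.trans H'.symm
  refine 𝒢.mul_right_cancel (h := 𝒢.div h k) (𝒢.src_div e) ?_ ?_
  · rw [𝒢.src_div e', 𝒢.tgt_div H']
  · rw [𝒢.div_mul e, 𝒢.mul_div_div e' H']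

theorem contMDiffOn_div : ContMDiffOn (𝓘(ℝ, EG).prod 𝓘(ℝ, EG)) 𝓘(ℝ, EG) ∞
    (fun p : G × G => 𝒢.div p.1 p.2) {p | 𝒢.src p.1 = 𝒢.src p.2} := by
  have h : ContMDiff (𝓘(ℝ, EG).prod 𝓘(ℝ, EG)) (𝓘(ℝ, EG).prod 𝓘(ℝ, EG)) ∞
      (fun p : G × G => (p.1, 𝒢.inv p.2)) :=
    contMDiff_fst.prodMk (𝒢.contMDiff_inv.comp contMDiff_snd)
  exact 𝒢.contMDiffOn_mul.comp h.contMDiffOn fun p (hp : 𝒢.src p.1 = 𝒢.src p.2) =>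
    hp.trans (𝒢.tgt_inv _).symm

/-- The differential of the source map. -/
def dsrc (g : G) (v : EG) : EM := mfderiv 𝓘(ℝ, EG) 𝓘(ℝ, EM) 𝒢.src g v

/-- The differential of the target map. -/
def dtgt (g : G) (v : EG) : EM := mfderiv 𝓘(ℝ, EG) 𝓘(ℝ, EM) 𝒢.tgt g v

/-- The differential of the unit map. -/
def dunit (x : M) (z : EM) : EG := mfderiv 𝓘(ℝ, EM) 𝓘(ℝ, EG) 𝒢.unit x z

/-- The differential of the multiplication. -/
def dmul (g h : G) (v w : EG) : EG :=
  fderivPair (fun p : G × G => 𝒢.mul p.1 p.2) {p | 𝒢.src p.1 = 𝒢.tgt p.2} g h v w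

/-- The differential of the division map. -/
def ddiv (g h : G) (v w : EG) : EG :=
  fderivPair (fun p : G × G => 𝒢.div p.1 p.2) {p | 𝒢.src p.1 = 𝒢.src p.2} g h v w

theorem dsrc_add (g : G) (v w : EG) : 𝒢.dsrc g (v + w) = 𝒢.dsrc g v + 𝒢.dsrc g w :=
  map_add (mfderiv 𝓘(ℝ, EG) 𝓘(ℝ, EM) 𝒢.src g) v w

theorem dsrc_smul (g : G) (a : ℝ) (v : EG) : 𝒢.dsrc g (a • v) = a • 𝒢.dsrc g v :=
  map_smul (mfderiv 𝓘(ℝ, EG) 𝓘(ℝ, EM) 𝒢.src g) a v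

theorem dtgt_add (g : G) (v w : EG) : 𝒢.dtgt g (v + w) = 𝒢.dtgt g v + 𝒢.dtgt g w :=
  map_add (mfderiv 𝓘(ℝ, EG) 𝓘(ℝ, EM) 𝒢.tgt g) v w

theorem dtgt_smul (g : G) (a : ℝ) (v : EG) : 𝒢.dtgt g (a • v) = a • 𝒢.dtgt g v :=
  map_smul (mfderiv 𝓘(ℝ, EG) 𝓘(ℝ, EM) 𝒢.tgt g) a v

theorem dunit_add (x : M) (v w : EM) : 𝒢.dunit x (v + w) = 𝒢.dunit x v + 𝒢.dunit x w :=
  map_add (mfderiv 𝓘(ℝ, EM) 𝓘(ℝ, EG) 𝒢.unit x) v w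

theorem dunit_smul (x : M) (a : ℝ) (v : EM) : 𝒢.dunit x (a • v) = a • 𝒢.dunit x v :=
  map_smul (mfderiv 𝓘(ℝ, EM) 𝓘(ℝ, EG) 𝒢.unit x) a v

variable {𝒢}

theorem _root_.HasVel.src {γ : ℝ → G} {v : EG} (h : HasVel 𝓘(ℝ, EG) γ v) :
    HasVel 𝓘(ℝ, EM) (fun t => 𝒢.src (γ t)) (𝒢.dsrc (γ 0) v) :=
  h.comp rfl ((𝒢.isSubmersion_src.contMDiff _).mdifferentiableAt (by simp))

theorem _root_.HasVel.tgt {γ : ℝ → G} {v : EG} (h : HasVel 𝓘(ℝ, EG) γ v) :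
    HasVel 𝓘(ℝ, EM) (fun t => 𝒢.tgt (γ t)) (𝒢.dtgt (γ 0) v) :=
  h.comp rfl ((𝒢.isSubmersion_tgt.contMDiff _).mdifferentiableAt (by simp))

theorem _root_.HasVel.unit {γ : ℝ → M} {z : EM} (h : HasVel 𝓘(ℝ, EM) γ z) :
    HasVel 𝓘(ℝ, EG) (fun t => 𝒢.unit (γ t)) (𝒢.dunit (γ 0) z) :=
  h.comp rfl ((𝒢.contMDiff_unit _).mdifferentiableAt (by simp))

theorem _root_.HasVel.mul {γ η : ℝ → G} {v w : EG} (hv : HasVel 𝓘(ℝ, EG) γ v)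
    (hw : HasVel 𝓘(ℝ, EG) η w) (H : ∀ᶠ t in 𝓝 0, 𝒢.src (γ t) = 𝒢.tgt (η t)) :
    HasVel 𝓘(ℝ, EG) (fun t => 𝒢.mul (γ t) (η t)) (𝒢.dmul (γ 0) (η 0) v w) :=
  HasVel.fderivPair 𝒢.contMDiffOn_mul rfl rfl hv hw H

theorem _root_.HasVel.div {γ η : ℝ → G} {v w : EG} (hv : HasVel 𝓘(ℝ, EG) γ v)
    (hw : HasVel 𝓘(ℝ, EG) η w) (H : ∀ᶠ t in 𝓝 0, 𝒢.src (γ t) = 𝒢.src (η t)) :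
    HasVel 𝓘(ℝ, EG) (fun t => 𝒢.div (γ t) (η t)) (𝒢.ddiv (γ 0) (η 0) v w) :=
  HasVel.fderivPair 𝒢.contMDiffOn_div rfl rfl hv hw H

variable (𝒢)

theorem exists_curve_src {η : ℝ → M} {g : G} {v : EG} (h0 : η 0 = 𝒢.src g)
    (h : HasVel 𝓘(ℝ, EM) η (𝒢.dsrc g v)) :
    ∃ γ : ℝ → G, γ 0 = g ∧ HasVel 𝓘(ℝ, EG) γ v ∧ ∀ᶠ t in 𝓝 0, 𝒢.src (γ t) = η t :=
  𝒢.isSubmersion_src.exists_lift h0 h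

/-- Every vector tangent to G ×ₛ G is represented by a curve in it: choose any curve with velocity
`w`, and lift its source to a curve with velocity `v`. -/
theorem exists_curve_pair {g h : G} {v w : EG} (H : 𝒢.src g = 𝒢.src h)
    (e : 𝒢.dsrc g v = 𝒢.dsrc h w) :
    ∃ γ η : ℝ → G, γ 0 = g ∧ η 0 = h ∧ HasVel 𝓘(ℝ, EG) γ v ∧ HasVel 𝓘(ℝ, EG) η w ∧
      ∀ᶠ t in 𝓝 0, 𝒢.src (γ t) = 𝒢.src (η t) := by
  obtain ⟨η, h0, hη⟩ := exists_hasVel h w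
  subst h0
  obtain ⟨γ, h1, hγ, h2⟩ := 𝒢.exists_curve_src (η := fun t => 𝒢.src (η t)) (v := v) H.symm
    (by rw [e]; exact hη.src)
  exact ⟨γ, η, h1, rfl, hγ, hη, h2⟩

theorem exists_curve_vertical {g : G} {v : EG} (e : 𝒢.dsrc g v = 0) :
    ∃ γ : ℝ → G, γ 0 = g ∧ HasVel 𝓘(ℝ, EG) γ v ∧ ∀ᶠ t in 𝓝 0, 𝒢.src (γ t) = 𝒢.src g :=
  𝒢.exists_curve_src (η := fun _ => 𝒢.src g) rfl (by rw [e]; exact hasVel_const _)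

theorem dtgt_ddiv {g h : G} {v w : EG} (H : 𝒢.src g = 𝒢.src h) (e : 𝒢.dsrc g v = 𝒢.dsrc h w) :
    𝒢.dtgt (𝒢.div g h) (𝒢.ddiv g h v w) = 𝒢.dtgt g v := by
  obtain ⟨γ, η, rfl, rfl, hγ, hη, h2⟩ := 𝒢.exists_curve_pair H e
  exact (hγ.div hη h2).tgt.eq_of_eventually hγ.tgt (h2.mono fun t ht => 𝒢.tgt_div ht)

theorem dsrc_ddiv {g h : G} {v w : EG} (H : 𝒢.src g = 𝒢.src h) (e : 𝒢.dsrc g v = 𝒢.dsrc h w) :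
    𝒢.dsrc (𝒢.div g h) (𝒢.ddiv g h v w) = 𝒢.dtgt h w := by
  obtain ⟨γ, η, rfl, rfl, hγ, hη, h2⟩ := 𝒢.exists_curve_pair H e
  exact (hγ.div hη h2).src.eq_of_eventually hη.tgt (h2.mono fun t ht => 𝒢.src_div ht)

theorem dsrc_dmul_zero {g : G} {x : M} (hx : x = 𝒢.tgt g) {v : EG}
    (e : 𝒢.dsrc (𝒢.unit x) v = 0) : 𝒢.dsrc g (𝒢.dmul (𝒢.unit x) g v 0) = 0 := by
  obtain ⟨γ, h0, hγ, h2⟩ := 𝒢.exists_curve_vertical e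
  rw [𝒢.src_unit] at h2
  have h3 := hγ.mul (η := fun _ => g) (hasVel_const g) (h2.mono fun t ht => ht.trans hx)
  have h5 := h3.src.eq_of_eventually (hasVel_const (𝒢.src g))
    (h2.mono fun t ht => 𝒢.src_mul _ _ (ht.trans hx))
  simp only [h0] at h5
  rw [hx] at h5 ⊢
  rwa [𝒢.unit_mul] at h5

/-- The differential of a section of the algebroid, in terms of the division map. -/
theorem ddiv_eq_dRight_add_dLeft (g : G) {a b : EG} (ha : 𝒢.dsrc (𝒢.unit (𝒢.tgt g)) a = 0)
    (hb : 𝒢.dsrc (𝒢.unit (𝒢.src g)) b = 0) :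
    𝒢.ddiv g (𝒢.unit (𝒢.src g)) (𝒢.dmul (𝒢.unit (𝒢.tgt g)) g a 0) b =
      HAdd.hAdd (α := EG) (β := EG) (γ := EG) (𝒢.dRight g (𝒢.unit (𝒢.tgt g)) a)
        (𝒢.dLeft g (𝒢.unit (𝒢.src g))
          (mfderiv 𝓘(ℝ, EG) 𝓘(ℝ, EG) 𝒢.inv (𝒢.unit (𝒢.src g)) b)) := by
  obtain ⟨α, hα0, hα, hα1⟩ := 𝒢.exists_curve_vertical ha
  obtain ⟨β, hβ0, hβ, hβ1⟩ := 𝒢.exists_curve_vertical hb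
  rw [𝒢.src_unit] at hα1 hβ1
  have h1 : HasVel 𝓘(ℝ, EG) (fun t => 𝒢.mul (α t) g) (𝒢.dmul (𝒢.unit (𝒢.tgt g)) g a 0) := by
    rw [← hα0]
    exact hα.mul (η := fun _ => g) (hasVel_const g) hα1
  have h10 : 𝒢.mul (α 0) g = g := by rw [hα0, 𝒢.unit_mul]
  have e1 : (𝒢.dRight g (𝒢.unit (𝒢.tgt g)) a : EG) = 𝒢.dmul (𝒢.unit (𝒢.tgt g)) g a 0 := by
    have hm : MDifferentiableWithinAt 𝓘(ℝ, EG) 𝓘(ℝ, EG) (fun h' => 𝒢.mul h' g)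
        {h' | 𝒢.src h' = 𝒢.tgt g} (𝒢.unit (𝒢.tgt g)) := by
      have := 𝒢.contMDiffOn_mul.comp (s := {h' | 𝒢.src h' = 𝒢.tgt g})
        ((contMDiff_id (I := 𝓘(ℝ, EG)).prodMk (contMDiff_const (c := g))).contMDiffOn)
        (fun h' hh => hh)
      exact (this _ (𝒢.src_unit _)).mdifferentiableWithinAt (by simp)
    exact (hα.comp_within hα0 hm hα1).unique h1
  have hinv := hβ.comp hβ0 ((𝒢.contMDiff_inv _).mdifferentiableAt (by simp))
  have e2 : HasVel 𝓘(ℝ, EG) (fun t => 𝒢.div g (β t))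
      (𝒢.dLeft g (𝒢.unit (𝒢.src g))
        (mfderiv 𝓘(ℝ, EG) 𝓘(ℝ, EG) 𝒢.inv (𝒢.unit (𝒢.src g)) b) : EG) := by
    have hm : MDifferentiableWithinAt 𝓘(ℝ, EG) 𝓘(ℝ, EG) (fun h' => 𝒢.mul g h')
        {h' | 𝒢.tgt h' = 𝒢.src g} (𝒢.unit (𝒢.src g)) := by
      have := 𝒢.contMDiffOn_mul.comp (s := {h' | 𝒢.tgt h' = 𝒢.src g})
        (((contMDiff_const (c := g)).prodMk (contMDiff_id (I := 𝓘(ℝ, EG)))).contMDiffOn)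
        (fun h' hh => hh.symm)
      exact (this _ (𝒢.tgt_unit _)).mdifferentiableWithinAt (by simp)
    exact hinv.comp_within (by rw [hβ0, 𝒢.inv_unit]) hm
      (hβ1.mono fun t ht => (𝒢.tgt_inv _).trans ht)
  have e3 := (hasVel_const g).div hβ (hβ1.mono fun t ht => ht.symm)
  have e4 := h1.div (hasVel_const (𝒢.unit (𝒢.src g)))
    (hα1.mono fun t ht => by rw [𝒢.src_mul _ _ ht, 𝒢.src_unit])
  have e5 := e4.eq_of_eventually h1 (hα1.mono fun t ht => by
    have := 𝒢.div_unit (𝒢.mul (α t) g)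
    rwa [𝒢.src_mul _ _ ht] at this)
  have e6 := e3.unique e2
  rw [h10] at e5
  rw [hβ0] at e6
  -- The pair of vectors is split as (·, 0) + (0, b). The first part is the velocity of α(t) g
  -- divided by a constant unit, hence the right translate; the second is the velocity of g β(t)⁻¹,
  -- hence the left translate of di(b).
  refine Eq.trans ?_ ((fderivPair_add (F := EG) (fun p : G × G => 𝒢.div p.1 p.2)
    {p | 𝒢.src p.1 = 𝒢.src p.2} g (𝒢.unit (𝒢.src g)) (𝒢.dmul (𝒢.unit (𝒢.tgt g)) g a 0)
    0 0 b).trans (congrArg₂ (fun x y : EG => x + y) (e5.trans e1.symm) e6))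
  rw [add_zero, zero_add]
  rfl

end Algebra

end LieGroupoid

/-! ### Principal bibundles, opposites and the unit bibundle -/

namespace LieGroupoid

universe u u'

variable {EM : Type*} [NormedAddCommGroup EM] [NormedSpace ℝ EM]
  {M : Type u} [TopologicalSpace M] [ChartedSpace EM M] [IsManifold 𝓘(ℝ, EM) ∞ M]
  {EG : Type*} [NormedAddCommGroup EG] [NormedSpace ℝ EG]
  {G : Type u} [TopologicalSpace G] [ChartedSpace EG G] [IsManifold 𝓘(ℝ, EG) ∞ G]
  {EN : Type*} [NormedAddCommGroup EN] [NormedSpace ℝ EN]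
  {N : Type u'} [TopologicalSpace N] [ChartedSpace EN N] [IsManifold 𝓘(ℝ, EN) ∞ N]
  {EH : Type*} [NormedAddCommGroup EH] [NormedSpace ℝ EH]
  {H : Type u'} [TopologicalSpace H] [ChartedSpace EH H] [IsManifold 𝓘(ℝ, EH) ∞ H]

/-- A Morita bibundle between Lie groupoids: a principal bibundle with total space `P`, with the
two division maps as part of the data. -/
structure Bibundle (𝒢 : LieGroupoid EM M EG G) (ℋ : LieGroupoid EN N EH H)
    (EP : Type*) [NormedAddCommGroup EP] [NormedSpace ℝ EP]
    (P : Type*) [TopologicalSpace P] [ChartedSpace EP P] where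
  α : P → M
  β : P → N
  l : G → P → P
  r : P → H → P
  divL : P → P → G
  divR : P → P → H
  isSubmersion_α : IsSubmersion 𝓘(ℝ, EP) 𝓘(ℝ, EM) ∞ α
  isSubmersion_β : IsSubmersion 𝓘(ℝ, EP) 𝓘(ℝ, EN) ∞ β
  surjective_α : Function.Surjective α
  surjective_β : Function.Surjective β
  contMDiffOn_l : ContMDiffOn (𝓘(ℝ, EG).prod 𝓘(ℝ, EP)) 𝓘(ℝ, EP) ∞
    (fun a : G × P => l a.1 a.2) {a | 𝒢.src a.1 = α a.2}
  contMDiffOn_r : ContMDiffOn (𝓘(ℝ, EP).prod 𝓘(ℝ, EH)) 𝓘(ℝ, EP) ∞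
    (fun a : P × H => r a.1 a.2) {a | β a.1 = ℋ.tgt a.2}
  contMDiffOn_divL : ContMDiffOn (𝓘(ℝ, EP).prod 𝓘(ℝ, EP)) 𝓘(ℝ, EG) ∞
    (fun a : P × P => divL a.1 a.2) {a | β a.1 = β a.2}
  contMDiffOn_divR : ContMDiffOn (𝓘(ℝ, EP).prod 𝓘(ℝ, EP)) 𝓘(ℝ, EH) ∞
    (fun a : P × P => divR a.1 a.2) {a | α a.1 = α a.2}
  α_l : ∀ g p, 𝒢.src g = α p → α (l g p) = 𝒢.tgt g
  β_l : ∀ g p, 𝒢.src g = α p → β (l g p) = β p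
  α_r : ∀ p h, β p = ℋ.tgt h → α (r p h) = α p
  β_r : ∀ p h, β p = ℋ.tgt h → β (r p h) = ℋ.src h
  unit_l : ∀ p, l (𝒢.unit (α p)) p = p
  r_unit : ∀ p, r p (ℋ.unit (β p)) = p
  mul_l : ∀ g g' p, 𝒢.src g = 𝒢.tgt g' → 𝒢.src g' = α p → l (𝒢.mul g g') p = l g (l g' p)
  r_mul : ∀ p h h', β p = ℋ.tgt h → ℋ.src h = ℋ.tgt h' → r p (ℋ.mul h h') = r (r p h) h'
  comm : ∀ g p h, 𝒢.src g = α p → β p = ℋ.tgt h → r (l g p) h = l g (r p h)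
  src_divL : ∀ p q, β p = β q → 𝒢.src (divL p q) = α q
  tgt_divR : ∀ p q, α p = α q → ℋ.tgt (divR p q) = β p
  l_divL : ∀ p q, β p = β q → l (divL p q) q = p
  r_divR : ∀ p q, α p = α q → r p (divR p q) = q
  divL_l : ∀ g p, 𝒢.src g = α p → divL (l g p) p = g
  divR_r : ∀ p h, β p = ℋ.tgt h → divR p (r p h) = h

namespace Bibundle

variable {𝒢 : LieGroupoid EM M EG G} {ℋ : LieGroupoid EN N EH H}
  {EP : Type*} [NormedAddCommGroup EP] [NormedSpace ℝ EP]
  {P : Type*} [TopologicalSpace P] [ChartedSpace EP P] [IsManifold 𝓘(ℝ, EP) ∞ P]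

/-- The opposite bibundle. -/
def op (B : Bibundle 𝒢 ℋ EP P) : Bibundle ℋ 𝒢 EP P where
  α := B.β
  β := B.α
  l h p := B.r p (ℋ.inv h)
  r p g := B.l (𝒢.inv g) p
  divL p q := B.divR p q
  divR p q := B.divL p q
  isSubmersion_α := B.isSubmersion_β
  isSubmersion_β := B.isSubmersion_α
  surjective_α := B.surjective_β
  surjective_β := B.surjective_α
  contMDiffOn_l := B.contMDiffOn_r.comp
    (contMDiff_snd.prodMk (ℋ.contMDiff_inv.comp contMDiff_fst)).contMDiffOn
    fun a (ha : ℋ.src a.1 = B.β a.2) => ha.symm.trans (ℋ.tgt_inv a.1).symm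
  contMDiffOn_r := B.contMDiffOn_l.comp
    ((𝒢.contMDiff_inv.comp contMDiff_snd).prodMk contMDiff_fst).contMDiffOn
    fun a (ha : B.α a.1 = 𝒢.tgt a.2) => (𝒢.src_inv a.2).trans ha.symm
  contMDiffOn_divL := B.contMDiffOn_divR
  contMDiffOn_divR := B.contMDiffOn_divL
  α_l h p e := (B.β_r _ _ (e.symm.trans (ℋ.tgt_inv h).symm)).trans (ℋ.src_inv h)
  β_l h p e := B.α_r _ _ (e.symm.trans (ℋ.tgt_inv h).symm)
  α_r p g e := B.β_l _ _ ((𝒢.src_inv g).trans e.symm)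
  β_r p g e := (B.α_l _ _ ((𝒢.src_inv g).trans e.symm)).trans (𝒢.tgt_inv g)
  unit_l p := by rw [ℋ.inv_unit, B.r_unit]
  r_unit p := by rw [𝒢.inv_unit, B.unit_l]
  mul_l h h' p e e' := by
    have e1 := e'.symm.trans (ℋ.tgt_inv h').symm
    have e2 : B.β (B.r p (ℋ.inv h')) = ℋ.tgt (ℋ.inv h) := by
      rw [B.β_r _ _ e1, ℋ.src_inv, ℋ.tgt_inv, e]
    have e0 : B.β p = ℋ.tgt (ℋ.inv (ℋ.mul h h')) := by rw [ℋ.tgt_inv, ℋ.src_mul _ _ e, e']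
    have e3 : B.r (B.r p (ℋ.inv h')) (ℋ.inv h) = B.r p (ℋ.mul (ℋ.inv h') (ℋ.inv h)) :=
      (B.r_mul _ _ _ e1 (by rw [ℋ.src_inv, ℋ.tgt_inv, e])).symm
    rw [e3]
    -- What remains is (h h')⁻¹ = h'⁻¹ h⁻¹.
    congr 1
    have e4 : ℋ.tgt (ℋ.mul (ℋ.inv h') (ℋ.inv h)) = ℋ.src h' := by
      rw [ℋ.tgt_mul _ _ (by rw [ℋ.src_inv, ℋ.tgt_inv, e]), ℋ.tgt_inv]
    have e5 : ℋ.mul (ℋ.mul h h') (ℋ.mul (ℋ.inv h') (ℋ.inv h)) = ℋ.unit (ℋ.tgt h) := by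
      rw [ℋ.mul_assoc _ _ _ e e4.symm, ℋ.inv_mul_mul_cancel (by rw [ℋ.tgt_inv, e]), ℋ.mul_inv]
    have e6 := ℋ.inv_mul_cancel (g := ℋ.mul h h') (h := ℋ.mul (ℋ.inv h') (ℋ.inv h))
      (by rw [ℋ.src_mul _ _ e, e4])
    rw [e5] at e6
    rw [← e6, ← ℋ.tgt_mul _ _ e, ← ℋ.src_inv, ℋ.mul_unit]
  r_mul p g g' e e' := by
    have e1 : 𝒢.src (𝒢.inv g) = B.α p := by rw [𝒢.src_inv, e]
    have e2 : 𝒢.src (𝒢.inv g') = 𝒢.tgt (𝒢.inv g) := by rw [𝒢.src_inv, 𝒢.tgt_inv, e']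
    rw [← B.mul_l _ _ _ e2 e1]
    congr 1
    have e4 : 𝒢.tgt (𝒢.mul (𝒢.inv g') (𝒢.inv g)) = 𝒢.src g' := by
      rw [𝒢.tgt_mul _ _ e2, 𝒢.tgt_inv]
    have e5 : 𝒢.mul (𝒢.mul g g') (𝒢.mul (𝒢.inv g') (𝒢.inv g)) = 𝒢.unit (𝒢.tgt g) := by
      rw [𝒢.mul_assoc _ _ _ e' e4.symm, 𝒢.inv_mul_mul_cancel (by rw [𝒢.tgt_inv, e']), 𝒢.mul_inv]
    have e6 := 𝒢.inv_mul_cancel (g := 𝒢.mul g g') (h := 𝒢.mul (𝒢.inv g') (𝒢.inv g))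
      (by rw [𝒢.src_mul _ _ e', e4])
    rw [e5] at e6
    rw [← e6, ← 𝒢.tgt_mul _ _ e', ← 𝒢.src_inv, 𝒢.mul_unit]
  comm h p g e e' := (B.comm _ _ _ ((𝒢.src_inv g).trans e'.symm)
    (e.symm.trans (ℋ.tgt_inv h).symm)).symm
  src_divL p q e := by
    rw [← B.β_r p (B.divR p q) (B.tgt_divR _ _ e).symm, B.r_divR _ _ e]
  tgt_divR p q e := by
    have := B.α_l _ _ (B.src_divL _ _ e)
    rw [B.l_divL _ _ e] at this
    exact this.symm
  l_divL p q e := by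
    have e1 := B.tgt_divR _ _ e
    have e2 := B.r_mul p (B.divR p q) (ℋ.inv (B.divR p q)) e1.symm (ℋ.tgt_inv _).symm
    rw [B.r_divR _ _ e, ℋ.mul_inv, e1, B.r_unit] at e2
    exact e2.symm
  r_divR p q e := by
    have e1 := B.src_divL _ _ e
    have e2 := B.mul_l (𝒢.inv (B.divL p q)) (B.divL p q) q (𝒢.src_inv _) e1
    rw [B.l_divL _ _ e, 𝒢.inv_mul, e1, B.unit_l] at e2
    exact e2.symm
  divL_l h p e := by
    have e1 : B.β p = ℋ.tgt (ℋ.inv h) := by rw [ℋ.tgt_inv, e]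
    have e2 : B.β (B.r p (ℋ.inv h)) = ℋ.tgt h := by rw [B.β_r _ _ e1, ℋ.src_inv]
    have e3 : B.r (B.r p (ℋ.inv h)) h = p := by
      rw [← B.r_mul _ _ _ e1 (ℋ.src_inv h), ℋ.inv_mul, e, B.r_unit]
    have e4 := B.divR_r _ _ e2
    rwa [e3] at e4
  divR_r p g e := by
    have e1 : 𝒢.src (𝒢.inv g) = B.α p := by rw [𝒢.src_inv, e]
    have e2 : 𝒢.src g = B.α (B.l (𝒢.inv g) p) := by rw [B.α_l _ _ e1, 𝒢.tgt_inv]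
    have e3 : B.l g (B.l (𝒢.inv g) p) = p := by
      rw [← B.mul_l _ _ _ (𝒢.tgt_inv g).symm e1, 𝒢.mul_inv, ← e, B.unit_l]
    have e4 := B.divL_l _ _ e2
    rwa [e3] at e4

variable (𝒢) in
/-- The groupoid as a bibundle from itself to itself. -/
def unitBundle : Bibundle 𝒢 𝒢 EG G where
  α := 𝒢.tgt
  β := 𝒢.src
  l := 𝒢.mul
  r := 𝒢.mul
  divL := 𝒢.div
  divR p q := 𝒢.mul (𝒢.inv p) q
  isSubmersion_α := 𝒢.isSubmersion_tgt
  isSubmersion_β := 𝒢.isSubmersion_src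
  surjective_α x := ⟨𝒢.unit x, 𝒢.tgt_unit x⟩
  surjective_β x := ⟨𝒢.unit x, 𝒢.src_unit x⟩
  contMDiffOn_l := 𝒢.contMDiffOn_mul
  contMDiffOn_r := 𝒢.contMDiffOn_mul
  contMDiffOn_divL := 𝒢.contMDiffOn_div
  contMDiffOn_divR := 𝒢.contMDiffOn_mul.comp
    ((𝒢.contMDiff_inv.comp contMDiff_fst).prodMk contMDiff_snd).contMDiffOn
    fun a (ha : 𝒢.tgt a.1 = 𝒢.tgt a.2) => (𝒢.src_inv a.1).trans ha
  α_l := 𝒢.tgt_mul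
  β_l := 𝒢.src_mul
  α_r := 𝒢.tgt_mul
  β_r := 𝒢.src_mul
  unit_l := 𝒢.unit_mul
  r_unit := 𝒢.mul_unit
  mul_l := 𝒢.mul_assoc
  r_mul p h h' e e' := (𝒢.mul_assoc p h h' e e').symm
  comm := 𝒢.mul_assoc
  src_divL p q e := 𝒢.src_div e
  tgt_divR p q e := by rw [𝒢.tgt_mul _ _ ((𝒢.src_inv p).trans e), 𝒢.tgt_inv]
  l_divL p q e := 𝒢.div_mul e
  r_divR p q e := 𝒢.inv_mul_mul_cancel e
  divL_l g p e := 𝒢.mul_div e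
  divR_r p h e := 𝒢.inv_mul_cancel e

end Bibundle

end LieGroupoid

/-! ### Local sections with lifts, and conjugation of arrows -/

namespace LieGroupoid

universe u u'

variable {EM : Type*} [NormedAddCommGroup EM] [NormedSpace ℝ EM]
  {M : Type u} [TopologicalSpace M] [ChartedSpace EM M] [IsManifold 𝓘(ℝ, EM) ∞ M]
  {EG : Type*} [NormedAddCommGroup EG] [NormedSpace ℝ EG]
  {G : Type u} [TopologicalSpace G] [ChartedSpace EG G] [IsManifold 𝓘(ℝ, EG) ∞ G]
  {EN : Type*} [NormedAddCommGroup EN] [NormedSpace ℝ EN]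
  {N : Type u'} [TopologicalSpace N] [ChartedSpace EN N] [IsManifold 𝓘(ℝ, EN) ∞ N]
  {EH : Type*} [NormedAddCommGroup EH] [NormedSpace ℝ EH]
  {H : Type u'} [TopologicalSpace H] [ChartedSpace EH H] [IsManifold 𝓘(ℝ, EH) ∞ H]

namespace Bibundle

variable {𝒢 : LieGroupoid EM M EG G} {ℋ : LieGroupoid EN N EH H}
  {EP : Type*} [NormedAddCommGroup EP] [NormedSpace ℝ EP]
  {P : Type*} [TopologicalSpace P] [ChartedSpace EP P] [IsManifold 𝓘(ℝ, EP) ∞ P]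
  (B : Bibundle 𝒢 ℋ EP P)

theorem tgt_divL {p q : P} (e : B.β p = B.β q) : 𝒢.tgt (B.divL p q) = B.α p := by
  rw [← B.α_l _ _ (B.src_divL _ _ e), B.l_divL _ _ e]

theorem src_divR {p q : P} (e : B.α p = B.α q) : ℋ.src (B.divR p q) = B.β q := by
  rw [← B.β_r _ _ (B.tgt_divR _ _ e).symm, B.r_divR _ _ e]

/-- Freeness of the action in the form in which it proves identities: an arrow that carries `p` to
`q` has to be the quotient. -/
theorem eq_divR {p q : P} {h : H} (e : B.β p = ℋ.tgt h) (e' : B.r p h = q) : h = B.divR p q := by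
  rw [← e', B.divR_r _ _ e]

theorem eq_divL {p q : P} {g : G} (e : 𝒢.src g = B.α q) (e' : B.l g q = p) : g = B.divL p q := by
  rw [← e', B.divL_l _ _ e]

theorem divR_l {p q : P} {g : G} (e : 𝒢.src g = B.α p) (e' : B.α p = B.α q) :
    B.divR (B.l g p) (B.l g q) = B.divR p q := by
  have e1 := B.tgt_divR _ _ e'
  refine (B.eq_divR ?_ ?_).symm
  · rw [B.β_l _ _ e, e1]
  · rw [B.comm _ _ _ e e1.symm, B.r_divR _ _ e']

theorem mul_divR {p q s : P} (e : B.α p = B.α q) (e' : B.α q = B.α s) :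
    ℋ.mul (B.divR p q) (B.divR q s) = B.divR p s := by
  have e1 := B.tgt_divR _ _ e
  have e2 : ℋ.src (B.divR p q) = ℋ.tgt (B.divR q s) := by rw [B.src_divR e, B.tgt_divR _ _ e']
  refine B.eq_divR ?_ ?_
  · rw [ℋ.tgt_mul _ _ e2, e1]
  · rw [B.r_mul _ _ _ e1.symm e2, B.r_divR _ _ e, B.r_divR _ _ e']

theorem div_divR {p q s : P} (e : B.α p = B.α s) (e' : B.α q = B.α s) :
    ℋ.div (B.divR p s) (B.divR q s) = B.divR p q := by
  rw [← B.mul_divR (e.trans e'.symm) e', ℋ.mul_div]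
  rw [B.src_divR (e.trans e'.symm), B.tgt_divR _ _ e']

theorem mul_divL {p q s : P} (e : B.β p = B.β q) (e' : B.β q = B.β s) :
    𝒢.mul (B.divL p q) (B.divL q s) = B.divL p s := by
  have e2 : 𝒢.src (B.divL p q) = 𝒢.tgt (B.divL q s) := by rw [B.src_divL _ _ e, B.tgt_divL e']
  have e3 := B.src_divL _ _ e'
  refine B.eq_divL ?_ ?_
  · rw [𝒢.src_mul _ _ e2, e3]
  · rw [B.mul_l _ _ _ e2 e3, B.l_divL _ _ e', B.l_divL _ _ e]

theorem div_divL {p q s : P} (e : B.β p = B.β s) (e' : B.β q = B.β s) :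
    𝒢.div (B.divL p s) (B.divL q s) = B.divL p q := by
  rw [← B.mul_divL (e.trans e'.symm) e', 𝒢.mul_div]
  rw [B.src_divL _ _ (e.trans e'.symm), B.tgt_divL e']

theorem divL_r {p q : P} {h : H} (e : B.β p = ℋ.tgt h) (e' : B.β p = B.β q) :
    B.divL (B.r p h) (B.r q h) = B.divL p q := by
  have e1 := B.src_divL _ _ e'
  have e2 := e'.symm.trans e
  refine (B.eq_divL ?_ ?_).symm
  · rw [e1, B.α_r _ _ e2]
  · rw [← B.comm _ _ _ e1 e2, B.l_divL _ _ e']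

/-- The differential of the left action. -/
def dl (g : G) (p : P) (v : EG) (w : EP) : EP :=
  fderivPair (fun a : G × P => B.l a.1 a.2) {a | 𝒢.src a.1 = B.α a.2} g p v w

/-- The differential of the right division map. -/
def ddivR (p q : P) (v w : EP) : EH :=
  fderivPair (fun a : P × P => B.divR a.1 a.2) {a | B.α a.1 = B.α a.2} p q v w

/-- The differential of the left division map. -/
def ddivL (p q : P) (v w : EP) : EG :=
  fderivPair (fun a : P × P => B.divL a.1 a.2) {a | B.β a.1 = B.β a.2} p q v w

/-- The differential of the left moment map. -/
def dα (p : P) (v : EP) : EM := mfderiv 𝓘(ℝ, EP) 𝓘(ℝ, EM) B.α p v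

/-- The differential of the right moment map. -/
def dβ (p : P) (v : EP) : EN := mfderiv 𝓘(ℝ, EP) 𝓘(ℝ, EN) B.β p v

variable {B}

theorem _root_.HasVel.alpha {γ : ℝ → P} {v : EP} (h : HasVel 𝓘(ℝ, EP) γ v) :
    HasVel 𝓘(ℝ, EM) (fun t => B.α (γ t)) (B.dα (γ 0) v) :=
  h.comp rfl ((B.isSubmersion_α.contMDiff _).mdifferentiableAt (by simp))

theorem _root_.HasVel.beta {γ : ℝ → P} {v : EP} (h : HasVel 𝓘(ℝ, EP) γ v) :
    HasVel 𝓘(ℝ, EN) (fun t => B.β (γ t)) (B.dβ (γ 0) v) :=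
  h.comp rfl ((B.isSubmersion_β.contMDiff _).mdifferentiableAt (by simp))

theorem _root_.HasVel.l {γ : ℝ → G} {η : ℝ → P} {v : EG} {w : EP} (hv : HasVel 𝓘(ℝ, EG) γ v)
    (hw : HasVel 𝓘(ℝ, EP) η w) (H : ∀ᶠ t in 𝓝 0, 𝒢.src (γ t) = B.α (η t)) :
    HasVel 𝓘(ℝ, EP) (fun t => B.l (γ t) (η t)) (B.dl (γ 0) (η 0) v w) :=
  HasVel.fderivPair B.contMDiffOn_l rfl rfl hv hw H

theorem _root_.HasVel.divR {γ η : ℝ → P} {v w : EP} (hv : HasVel 𝓘(ℝ, EP) γ v)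
    (hw : HasVel 𝓘(ℝ, EP) η w) (H : ∀ᶠ t in 𝓝 0, B.α (γ t) = B.α (η t)) :
    HasVel 𝓘(ℝ, EH) (fun t => B.divR (γ t) (η t)) (B.ddivR (γ 0) (η 0) v w) :=
  HasVel.fderivPair B.contMDiffOn_divR rfl rfl hv hw H

theorem _root_.HasVel.divL {γ η : ℝ → P} {v w : EP} (hv : HasVel 𝓘(ℝ, EP) γ v)
    (hw : HasVel 𝓘(ℝ, EP) η w) (H : ∀ᶠ t in 𝓝 0, B.β (γ t) = B.β (η t)) :
    HasVel 𝓘(ℝ, EG) (fun t => B.divL (γ t) (η t)) (B.ddivL (γ 0) (η 0) v w) :=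
  HasVel.fderivPair B.contMDiffOn_divL rfl rfl hv hw H

variable (B)

theorem dα_dl {g : G} {p : P} {v : EG} {w : EP} (e : 𝒢.src g = B.α p)
    (e' : 𝒢.dsrc g v = B.dα p w) : B.dα (B.l g p) (B.dl g p v w) = 𝒢.dtgt g v := by
  obtain ⟨η, rfl, hη⟩ := exists_hasVel p w
  obtain ⟨γ, rfl, hγ, h2⟩ := 𝒢.exists_curve_src (η := fun t => B.α (η t)) (v := v) e.symm
    (by rw [e']; exact hη.alpha)
  exact (hγ.l hη h2).alpha.eq_of_eventually hγ.tgt (h2.mono fun t ht => B.α_l _ _ ht)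

/-- A smooth local section `σ` of the right moment map `β : P → N`, together with linear lifts of
tangent vectors of `M` at `α (σ x)` to tangent vectors of `P` at `σ x`. -/
structure LSec where
  W : Set N
  isOpen : IsOpen W
  σ : N → P
  lift : N → EM →ₗ[ℝ] EP
  β_σ : ∀ x ∈ W, B.β (σ x) = x
  smooth_σ : ContMDiffOn 𝓘(ℝ, EN) 𝓘(ℝ, EP) ∞ σ W
  dα_lift : ∀ x ∈ W, ∀ z, B.dα (σ x) (lift x z) = z
  smooth_lift : ContMDiffOn (𝓘(ℝ, EN).prod 𝓘(ℝ, EM).tangent) 𝓘(ℝ, EP).tangent ∞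
    (fun a : N × TangentBundle 𝓘(ℝ, EM) M =>
      (⟨σ a.1, lift a.1 a.2.2⟩ : TangentBundle 𝓘(ℝ, EP) P))
    {a | a.1 ∈ W ∧ a.2.proj = B.α (σ a.1)}

variable {B}

namespace LSec

section

variable {E' : Type*} [NormedAddCommGroup E'] [NormedSpace ℝ E'] {H' : Type*} [TopologicalSpace H']
  {I' : ModelWithCorners ℝ E' H'} {Y : Type*} [TopologicalSpace Y] [ChartedSpace H' Y]

theorem smoothAlong_lift (s : LSec B) {ξ : Y → N} {z : Y → EM} {S : Set Y} {y : Y} (hyS : y ∈ S)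
    (hξ : ContMDiffWithinAt I' 𝓘(ℝ, EN) ∞ ξ S y) (hy : ξ y ∈ s.W) {f : Y → M}
    (hz : SmoothAlong I' f z S y) (hf : ∀ᶠ x in 𝓝[S] y, f x = B.α (s.σ (ξ x))) :
    SmoothAlong I' (fun x => s.σ (ξ x)) (fun x => s.lift (ξ x) (z x)) S y := by
  have h1 : ∀ᶠ x in 𝓝[S] y, ξ x ∈ s.W :=
    hξ.continuousWithinAt.eventually_mem (s.isOpen.mem_nhds hy)
  have h2 := ContMDiffWithinAt.comp' (f := fun x => (ξ x, (⟨f x, z x⟩ : TangentBundle 𝓘(ℝ, EM) M)))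
    y (s.smooth_lift (ξ y, (⟨f y, z y⟩ : TangentBundle 𝓘(ℝ, EM) M))
      ⟨hy, hf.self_of_nhdsWithin hyS⟩) (ContMDiffWithinAt.prodMk hξ hz)
  refine ContMDiffWithinAt.mono_of_mem_nhdsWithin h2 (Filter.inter_mem self_mem_nhdsWithin ?_)
  filter_upwards [h1, hf] with x hx hx' using ⟨hx, hx'⟩

end

theorem exists_curve (s : LSec B) {x : N} (hx : x ∈ s.W) {η : ℝ → M} {z : EM}
    (h0 : η 0 = B.α (s.σ x)) (h : HasVel 𝓘(ℝ, EM) η z) :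
    ∃ p : ℝ → P, p 0 = s.σ x ∧ HasVel 𝓘(ℝ, EP) p (s.lift x z) ∧ ∀ᶠ t in 𝓝 0, B.α (p t) = η t :=
  B.isSubmersion_α.exists_lift h0 (by
    have := s.dα_lift x hx z
    rw [dα] at this
    rw [this]
    exact h)

/-- Conjugation of the arrow `h` with local sections at its target and its source. -/
def conj (s s' : LSec B) (h : H) : G := B.divL (B.r (s.σ (ℋ.tgt h)) h) (s'.σ (ℋ.src h))

variable {s s' s'' : LSec B} {h h' : H}

theorem β_r_σ (h0 : ℋ.tgt h ∈ s.W) : B.β (B.r (s.σ (ℋ.tgt h)) h) = ℋ.src h :=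
  B.β_r _ _ (s.β_σ _ h0)

theorem β_eq (h0 : ℋ.tgt h ∈ s.W) (h1 : ℋ.src h ∈ s'.W) :
    B.β (B.r (s.σ (ℋ.tgt h)) h) = B.β (s'.σ (ℋ.src h)) := by
  rw [β_r_σ h0, s'.β_σ _ h1]

theorem src_conj (h0 : ℋ.tgt h ∈ s.W) (h1 : ℋ.src h ∈ s'.W) :
    𝒢.src (conj s s' h) = B.α (s'.σ (ℋ.src h)) :=
  B.src_divL _ _ (β_eq h0 h1)

theorem tgt_conj (h0 : ℋ.tgt h ∈ s.W) (h1 : ℋ.src h ∈ s'.W) :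
    𝒢.tgt (conj s s' h) = B.α (s.σ (ℋ.tgt h)) := by
  rw [conj, B.tgt_divL (β_eq h0 h1), B.α_r _ _ (s.β_σ _ h0)]

theorem l_conj (h0 : ℋ.tgt h ∈ s.W) (h1 : ℋ.src h ∈ s'.W) :
    B.l (conj s s' h) (s'.σ (ℋ.src h)) = B.r (s.σ (ℋ.tgt h)) h :=
  B.l_divL _ _ (β_eq h0 h1)

theorem divR_l_conj (h0 : ℋ.tgt h ∈ s.W) (h1 : ℋ.src h ∈ s'.W) :
    B.divR (s.σ (ℋ.tgt h)) (B.l (conj s s' h) (s'.σ (ℋ.src h))) = h := by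
  rw [l_conj h0 h1, B.divR_r _ _ (s.β_σ _ h0)]

theorem conj_unit {x : N} (hx : x ∈ s.W) : conj s s (ℋ.unit x) = 𝒢.unit (B.α (s.σ x)) := by
  have e := B.r_unit (s.σ x)
  rw [s.β_σ x hx] at e
  rw [conj, ℋ.tgt_unit, ℋ.src_unit, e]
  refine (B.eq_divL (𝒢.src_unit _) (B.unit_l _)).symm

/-- From σ(t h) h = g σ'(s h) and σ'(t h') h' = g' σ''(s h') follows σ(t h) h h' = g g' σ''(s h').
The section at the middle vertex must be the same on both sides for it to drop out. -/
theorem conj_mul (e : ℋ.src h = ℋ.tgt h') (h0 : ℋ.tgt h ∈ s.W) (h1 : ℋ.src h ∈ s'.W)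
    (h2 : ℋ.src h' ∈ s''.W) :
    conj s s'' (ℋ.mul h h') = 𝒢.mul (conj s s' h) (conj s' s'' h') := by
  have h1' : ℋ.tgt h' ∈ s'.W := e ▸ h1
  have e0 : B.β (s.σ (ℋ.tgt h)) = ℋ.tgt h := s.β_σ _ h0
  have e1 : B.β (B.r (s.σ (ℋ.tgt h)) h) = ℋ.tgt h' := by rw [β_r_σ h0, e]
  have e2 : B.β (B.r (s.σ (ℋ.tgt h)) h) = B.β (s'.σ (ℋ.src h)) := β_eq h0 h1
  have e3 : conj s s' h = B.divL (B.r (B.r (s.σ (ℋ.tgt h)) h) h') (B.r (s'.σ (ℋ.src h)) h') := by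
    rw [B.divL_r e1 e2, conj]
  rw [e3, conj, conj, ℋ.tgt_mul _ _ e, ℋ.src_mul _ _ e, ← e, B.mul_divL, B.r_mul _ _ _ e0 e]
  · rw [B.β_r _ _ e1, e, β_r_σ h1']
  · rw [e]
    exact β_eq h1' h2

theorem conj_div (e : ℋ.src h = ℋ.src h') (h0 : ℋ.tgt h ∈ s.W) (h1 : ℋ.tgt h' ∈ s'.W)
    (h2 : ℋ.src h' ∈ s''.W) :
    conj s s' (ℋ.div h h') = 𝒢.div (conj s s'' h) (conj s' s'' h') := by
  have e1 := ℋ.src_div e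
  have e2 := ℋ.tgt_div e
  have h3 := conj_mul (s := s) (s' := s') (s'' := s'') e1 (e2 ▸ h0) (e1 ▸ h1) h2
  rw [ℋ.div_mul e] at h3
  rw [h3, 𝒢.mul_div]
  rw [src_conj (e2 ▸ h0) (e1 ▸ h1), tgt_conj h1 h2, e1]

/-- The linear map from the tangent space at a conjugated arrow to the tangent space at the
original arrow, given by the lifts. -/
def dconj (s s' : LSec B) (h : H) (v : EG) : EH :=
  B.ddivR (s.σ (ℋ.tgt h)) (B.l (conj s s' h) (s'.σ (ℋ.src h)))
    (s.lift (ℋ.tgt h) (𝒢.dtgt (conj s s' h) v))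
    (B.dl (conj s s' h) (s'.σ (ℋ.src h)) v (s'.lift (ℋ.src h) (𝒢.dsrc (conj s s' h) v)))

theorem dconj_add (s s' : LSec B) (h : H) (v w : EG) :
    dconj s s' h (v + w) = dconj s s' h v + dconj s s' h w := by
  simp only [dconj, dtgt_add, dsrc_add, map_add, dl, ddivR, fderivPair_add]

theorem dconj_smul (s s' : LSec B) (h : H) (a : ℝ) (v : EG) :
    dconj s s' h (a • v) = a • dconj s s' h v := by
  simp only [dconj, dtgt_smul, dsrc_smul, map_smul, dl, ddivR, fderivPair_smul]

/-- `dconj` as a linear map. -/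
def dconjₗ (s s' : LSec B) (h : H) : EG →ₗ[ℝ] EH where
  toFun := dconj s s' h
  map_add' := dconj_add s s' h
  map_smul' := dconj_smul s s' h

/-- `dconj` is the velocity of p⁻¹ γ q for any curves `p`, `q` in P that lie over the target and the
source of `γ` and start at the section values with the lifted velocities. The curves need not follow
the sections, and the freedom in choosing them is what the proofs below exploit. -/
theorem hasVel_dconj {γ : ℝ → G} {v : EG}
    (hγ0 : γ 0 = conj s s' h) (hγ : HasVel 𝓘(ℝ, EG) γ v) {p q : ℝ → P}
    (hp0 : p 0 = s.σ (ℋ.tgt h)) (hq0 : q 0 = s'.σ (ℋ.src h))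
    (hp : HasVel 𝓘(ℝ, EP) p (s.lift (ℋ.tgt h) (𝒢.dtgt (conj s s' h) v)))
    (hq : HasVel 𝓘(ℝ, EP) q (s'.lift (ℋ.src h) (𝒢.dsrc (conj s s' h) v)))
    (hpα : ∀ᶠ t in 𝓝 0, B.α (p t) = 𝒢.tgt (γ t)) (hqα : ∀ᶠ t in 𝓝 0, B.α (q t) = 𝒢.src (γ t)) :
    HasVel 𝓘(ℝ, EH) (fun t => B.divR (p t) (B.l (γ t) (q t))) (dconj s s' h v) := by
  have e1 := hγ.l hq (hqα.mono fun t ht => ht.symm)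
  have e2 := hp.divR e1 (by
    filter_upwards [hpα, hqα] with t ht ht'
    rw [ht, B.α_l _ _ ht'.symm])
  simp only [hγ0, hp0, hq0] at e2
  exact e2

theorem exists_curves (h0 : ℋ.tgt h ∈ s.W) (h1 : ℋ.src h ∈ s'.W) {γ : ℝ → G} {v : EG}
    (hγ0 : γ 0 = conj s s' h) (hγ : HasVel 𝓘(ℝ, EG) γ v) :
    ∃ p q : ℝ → P, p 0 = s.σ (ℋ.tgt h) ∧ q 0 = s'.σ (ℋ.src h) ∧
      HasVel 𝓘(ℝ, EP) p (s.lift (ℋ.tgt h) (𝒢.dtgt (conj s s' h) v)) ∧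
      HasVel 𝓘(ℝ, EP) q (s'.lift (ℋ.src h) (𝒢.dsrc (conj s s' h) v)) ∧
      (∀ᶠ t in 𝓝 0, B.α (p t) = 𝒢.tgt (γ t)) ∧ (∀ᶠ t in 𝓝 0, B.α (q t) = 𝒢.src (γ t)) := by
  obtain ⟨p, hp⟩ := s.exists_curve h0 (η := fun t => 𝒢.tgt (γ t)) (by rw [hγ0, tgt_conj h0 h1])
    hγ.tgt
  obtain ⟨q, hq⟩ := s'.exists_curve h1 (η := fun t => 𝒢.src (γ t)) (by rw [hγ0, src_conj h0 h1])
    hγ.src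
  rw [hγ0] at hp hq
  exact ⟨p, q, hp.1, hq.1, hp.2.1, hq.2.1, hp.2.2, hq.2.2⟩

/-- The source of p⁻¹ γ q is β(q). Hence the answer depends on `v` only through ds(v), and on the
section at the source only; this is why projectability survives conjugation. -/
theorem dsrc_dconj (h0 : ℋ.tgt h ∈ s.W) (h1 : ℋ.src h ∈ s'.W) (v : EG) :
    ℋ.dsrc h (dconj s s' h v) =
      B.dβ (s'.σ (ℋ.src h)) (s'.lift (ℋ.src h) (𝒢.dsrc (conj s s' h) v)) := by
  obtain ⟨γ, hγ0, hγ⟩ := exists_hasVel (conj s s' h) v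
  obtain ⟨p, q, hp0, hq0, hp, hq, hpα, hqα⟩ := exists_curves h0 h1 hγ0 hγ
  have e1 := hasVel_dconj hγ0 hγ hp0 hq0 hp hq hpα hqα
  have e2 := e1.src.eq_of_eventually hq.beta (by
    filter_upwards [hpα, hqα] with t ht ht'
    rw [B.src_divR (by rw [ht, B.α_l _ _ ht'.symm]), B.β_l _ _ ht'.symm])
  rwa [hp0, hγ0, hq0, divR_l_conj h0 h1] at e2

theorem dtgt_dconj (h0 : ℋ.tgt h ∈ s.W) (h1 : ℋ.src h ∈ s'.W) (v : EG) :
    ℋ.dtgt h (dconj s s' h v) =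
      B.dβ (s.σ (ℋ.tgt h)) (s.lift (ℋ.tgt h) (𝒢.dtgt (conj s s' h) v)) := by
  obtain ⟨γ, hγ0, hγ⟩ := exists_hasVel (conj s s' h) v
  obtain ⟨p, q, hp0, hq0, hp, hq, hpα, hqα⟩ := exists_curves h0 h1 hγ0 hγ
  have e1 := hasVel_dconj hγ0 hγ hp0 hq0 hp hq hpα hqα
  have e2 := e1.tgt.eq_of_eventually hp.beta (by
    filter_upwards [hpα, hqα] with t ht ht'
    rw [B.tgt_divR _ _ (by rw [ht, B.α_l _ _ ht'.symm])])
  rwa [hp0, hγ0, hq0, divR_l_conj h0 h1] at e2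

/-- Differentiate (p⁻¹ γ q)(p'⁻¹ η q)⁻¹ = p⁻¹ (γ η⁻¹) p'. One curve `q` serves both factors because
ds(v) = ds(w). The curve `p'` over the target of η lies over the source of γ η⁻¹, so it can also be
used on the right. -/
theorem dconj_ddiv (e : ℋ.src h = ℋ.src h') (h0 : ℋ.tgt h ∈ s.W) (h1 : ℋ.tgt h' ∈ s'.W)
    (h2 : ℋ.src h' ∈ s''.W) {v w : EG}
    (hvw : 𝒢.dsrc (conj s s'' h) v = 𝒢.dsrc (conj s' s'' h') w) :
    dconj s s' (ℋ.div h h') (𝒢.ddiv (conj s s'' h) (conj s' s'' h') v w) =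
      ℋ.ddiv h h' (dconj s s'' h v) (dconj s' s'' h' w) := by
  have h2' : ℋ.src h ∈ s''.W := e ▸ h2
  have e1 := ℋ.src_div e
  have e2 := ℋ.tgt_div e
  have ec : 𝒢.src (conj s s'' h) = 𝒢.src (conj s' s'' h') := by
    rw [src_conj h0 h2', src_conj h1 h2, e]
  obtain ⟨γ, η, hγ0, hη0, hγ, hη, hγη⟩ := 𝒢.exists_curve_pair ec hvw
  obtain ⟨p, q, hp0, hq0, hp, hq, hpα, hqα⟩ := exists_curves h0 h2' hγ0 hγ
  obtain ⟨p', q', hp0', -, hp', -, hpα', -⟩ := exists_curves h1 h2 hη0 hη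
  have hqα' : ∀ᶠ t in 𝓝 0, B.α (q t) = 𝒢.src (η t) := by
    filter_upwards [hqα, hγη] with t ht ht' using ht.trans ht'
  have a1 := hasVel_dconj hγ0 hγ hp0 hq0 hp hq hpα hqα
  have a2 := hasVel_dconj hη0 hη hp0' (hq0.trans (by rw [e])) hp'
    (by rwa [hvw, e] at hq) hpα' hqα'
  have a3 := hγ.div hη hγη
  rw [hγ0, hη0] at a3
  have a4 := hasVel_dconj (s := s) (s' := s') (h := ℋ.div h h')
    (by simp only [hγ0, hη0]; exact (conj_div e h0 h1 h2).symm) a3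
    (p := p) (q := p') (hp0.trans (by rw [e2])) (hp0'.trans (by rw [e1]))
    (by rwa [conj_div e h0 h1 h2, 𝒢.dtgt_ddiv ec hvw, e2])
    (by rwa [conj_div e h0 h1 h2, 𝒢.dsrc_ddiv ec hvw, e1])
    (by filter_upwards [hpα, hγη] with t ht ht'; rw [ht, 𝒢.tgt_div ht'])
    (by filter_upwards [hpα', hγη] with t ht ht'; rw [ht, 𝒢.src_div ht'])
  have key : ∀ᶠ t in 𝓝 0, B.α (p t) = B.α (B.l (γ t) (q t)) ∧
      B.α (p' t) = B.α (B.l (η t) (q t)) ∧ B.α (B.l (γ t) (q t)) =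
        B.α (B.l (𝒢.div (γ t) (η t)) (p' t)) ∧
      B.divR (p' t) (B.l (η t) (q t)) =
        B.divR (B.l (𝒢.div (γ t) (η t)) (p' t)) (B.l (γ t) (q t)) ∧
      B.β (B.l (γ t) (q t)) = B.β (B.l (η t) (q t)) := by
    filter_upwards [hpα, hqα, hpα', hqα', hγη] with t ht1 ht2 ht3 ht4 ht5
    have c1 := 𝒢.src_div ht5
    have c2 : B.l (γ t) (q t) = B.l (𝒢.div (γ t) (η t)) (B.l (η t) (q t)) := by
      rw [← B.mul_l _ _ _ c1 ht4.symm, 𝒢.div_mul ht5]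
    have c3 := B.α_l _ _ ht4.symm
    refine ⟨by rw [B.α_l _ _ ht2.symm, ht1], by rw [c3, ht3], ?_, ?_,
      by rw [B.β_l _ _ ht2.symm, B.β_l _ _ ht4.symm]⟩
    · rw [B.α_l _ _ ht2.symm, B.α_l _ _ (c1.trans ht3.symm), 𝒢.tgt_div ht5]
    · rw [c2, B.divR_l (c1.trans ht3.symm) (ht3.trans c3.symm)]
  have a5 := a1.div a2 (by
    filter_upwards [key] with t ht
    rw [B.src_divR ht.1, B.src_divR ht.2.1, ht.2.2.2.2])
  have a6 := a4.eq_of_eventually a5 (by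
    filter_upwards [key] with t ht
    rw [ht.2.2.2.1, B.div_divR ht.1 ht.2.2.1.symm])
  simp only [hp0, hγ0, hq0, hp0', hη0] at a6
  rw [divR_l_conj h0 h2'] at a6
  rw [e, divR_l_conj h1 h2] at a6
  exact a6

end LSec

end Bibundle

end LieGroupoid

/-! ### Smoothness, existence and composition of local sections -/

namespace LieGroupoid

universe u u'

variable {EM : Type*} [NormedAddCommGroup EM] [NormedSpace ℝ EM]
  {M : Type u} [TopologicalSpace M] [ChartedSpace EM M] [IsManifold 𝓘(ℝ, EM) ∞ M]
  {EG : Type*} [NormedAddCommGroup EG] [NormedSpace ℝ EG]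
  {G : Type u} [TopologicalSpace G] [ChartedSpace EG G] [IsManifold 𝓘(ℝ, EG) ∞ G]
  {EN : Type*} [NormedAddCommGroup EN] [NormedSpace ℝ EN]
  {N : Type u'} [TopologicalSpace N] [ChartedSpace EN N] [IsManifold 𝓘(ℝ, EN) ∞ N]
  {EH : Type*} [NormedAddCommGroup EH] [NormedSpace ℝ EH]
  {H : Type u'} [TopologicalSpace H] [ChartedSpace EH H] [IsManifold 𝓘(ℝ, EH) ∞ H]

namespace Bibundle

variable {𝒢 : LieGroupoid EM M EG G} {ℋ : LieGroupoid EN N EH H}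
  {EP : Type*} [NormedAddCommGroup EP] [NormedSpace ℝ EP]
  {P : Type*} [TopologicalSpace P] [ChartedSpace EP P] [IsManifold 𝓘(ℝ, EP) ∞ P]
  {B : Bibundle 𝒢 ℋ EP P}

theorem _root_.ContMDiffOn.comp_within {E₁ : Type*} [NormedAddCommGroup E₁] [NormedSpace ℝ E₁]
    {H₁ : Type*} [TopologicalSpace H₁] {I₁ : ModelWithCorners ℝ E₁ H₁}
    {X₁ : Type*} [TopologicalSpace X₁] [ChartedSpace H₁ X₁]
    {E₂ : Type*} [NormedAddCommGroup E₂] [NormedSpace ℝ E₂]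
    {H₂ : Type*} [TopologicalSpace H₂] {I₂ : ModelWithCorners ℝ E₂ H₂}
    {X₂ : Type*} [TopologicalSpace X₂] [ChartedSpace H₂ X₂]
    {E₃ : Type*} [NormedAddCommGroup E₃] [NormedSpace ℝ E₃]
    {H₃ : Type*} [TopologicalSpace H₃] {I₃ : ModelWithCorners ℝ E₃ H₃}
    {X₃ : Type*} [TopologicalSpace X₃] [ChartedSpace H₃ X₃]
    {g : X₂ → X₃} {T : Set X₂} {f : X₁ → X₂} {S : Set X₁} {x : X₁}
    (hg : ContMDiffOn I₂ I₃ ∞ g T) (hf : ContMDiffWithinAt I₁ I₂ ∞ f S x) (hx : x ∈ S)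
    (h : ∀ᶠ z in 𝓝[S] x, f z ∈ T) : ContMDiffWithinAt I₁ I₃ ∞ (fun z => g (f z)) S x := by
  have h2 := ContMDiffWithinAt.comp' x (hg (f x) (h.self_of_nhdsWithin hx)) hf
  exact ContMDiffWithinAt.mono_of_mem_nhdsWithin h2 (Filter.inter_mem self_mem_nhdsWithin h)

theorem dβ_add (B : Bibundle 𝒢 ℋ EP P) (p : P) (v w : EP) :
    B.dβ p (v + w) = B.dβ p v + B.dβ p w :=
  map_add (mfderiv 𝓘(ℝ, EP) 𝓘(ℝ, EN) B.β p) v w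

theorem dβ_smul (B : Bibundle 𝒢 ℋ EP P) (p : P) (a : ℝ) (v : EP) :
    B.dβ p (a • v) = a • B.dβ p v :=
  map_smul (mfderiv 𝓘(ℝ, EP) 𝓘(ℝ, EN) B.β p) a v

theorem divR_r_mul {p q : P} {h : H} (e : B.α p = B.α q) (e' : B.β q = ℋ.tgt h) :
    B.divR p (B.r q h) = ℋ.mul (B.divR p q) h := by
  have e1 := B.tgt_divR _ _ e
  have e2 : ℋ.src (B.divR p q) = ℋ.tgt h := by rw [B.src_divR e, e']
  refine (B.eq_divR ?_ ?_).symm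
  · rw [ℋ.tgt_mul _ _ e2, e1]
  · rw [B.r_mul _ _ _ e1.symm e2, B.r_divR _ _ e]

namespace LSec

section Smooth

variable {E' : Type*} [NormedAddCommGroup E'] [NormedSpace ℝ E'] {H' : Type*} [TopologicalSpace H']
  {I' : ModelWithCorners ℝ E' H'} {Y : Type*} [TopologicalSpace Y] [ChartedSpace H' Y]
  {s s' : LSec B} {f : Y → H} {S : Set Y} {y : Y}

theorem contMDiffWithinAt_σ {ξ : Y → N} (s : LSec B) (hyS : y ∈ S)
    (hξ : ContMDiffWithinAt I' 𝓘(ℝ, EN) ∞ ξ S y) (hy : ξ y ∈ s.W) :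
    ContMDiffWithinAt I' 𝓘(ℝ, EP) ∞ (fun z => s.σ (ξ z)) S y :=
  s.smooth_σ.comp_within hξ hyS (hξ.continuousWithinAt.eventually_mem (s.isOpen.mem_nhds hy))

theorem contMDiffWithinAt_conj (hyS : y ∈ S) (hf : ContMDiffWithinAt I' 𝓘(ℝ, EH) ∞ f S y)
    (h0 : ℋ.tgt (f y) ∈ s.W) (h1 : ℋ.src (f y) ∈ s'.W) :
    ContMDiffWithinAt I' 𝓘(ℝ, EG) ∞ (fun z => conj s s' (f z)) S y := by
  have ht := (ℋ.isSubmersion_tgt.contMDiff (f y)).comp_contMDiffWithinAt y hf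
  have hs := (ℋ.isSubmersion_src.contMDiff (f y)).comp_contMDiffWithinAt y hf
  have et := ht.continuousWithinAt.eventually_mem (s.isOpen.mem_nhds h0)
  have es := hs.continuousWithinAt.eventually_mem (s'.isOpen.mem_nhds h1)
  have h2 := B.contMDiffOn_r.comp_within ((s.contMDiffWithinAt_σ hyS ht h0).prodMk hf) hyS (by
    filter_upwards [et] with z hz using s.β_σ _ hz)
  exact B.contMDiffOn_divL.comp_within (h2.prodMk (s'.contMDiffWithinAt_σ hyS hs h1)) hyS (by
    filter_upwards [et, es] with z hz hz' using β_eq hz hz')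

theorem smoothAlong_dconj (hyS : y ∈ S) (hf : ContMDiffWithinAt I' 𝓘(ℝ, EH) ∞ f S y)
    (h0 : ℋ.tgt (f y) ∈ s.W) (h1 : ℋ.src (f y) ∈ s'.W) {v : Y → EG}
    (hv : SmoothAlong I' (fun z => conj s s' (f z)) v S y) :
    SmoothAlong I' f (fun z => dconj s s' (f z) (v z)) S y := by
  have ht := (ℋ.isSubmersion_tgt.contMDiff (f y)).comp_contMDiffWithinAt y hf
  have hs := (ℋ.isSubmersion_src.contMDiff (f y)).comp_contMDiffWithinAt y hf
  have et := ht.continuousWithinAt.eventually_mem (s.isOpen.mem_nhds h0)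
  have es := hs.continuousWithinAt.eventually_mem (s'.isOpen.mem_nhds h1)
  have a1 := s.smoothAlong_lift hyS ht h0 (hv.mfderiv 𝒢.isSubmersion_tgt.contMDiff hyS) (by
    filter_upwards [et, es] with z hz hz' using tgt_conj hz hz')
  have a2 := s'.smoothAlong_lift hyS hs h1 (hv.mfderiv 𝒢.isSubmersion_src.contMDiff hyS) (by
    filter_upwards [et, es] with z hz hz' using src_conj hz hz')
  have a3 := hv.fderivPair 𝒢.isSubmersion_src B.isSubmersion_α.contMDiff B.contMDiffOn_l hyS a2 (by
    filter_upwards [et, es] with z hz hz' using src_conj hz hz') (by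
    filter_upwards [et, es] with z hz hz' using (s'.dα_lift _ hz' _).symm)
  have a4 := a1.fderivPair B.isSubmersion_α B.isSubmersion_α.contMDiff B.contMDiffOn_divR hyS a3 (by
    filter_upwards [et, es] with z hz hz'
    exact (tgt_conj hz hz').symm.trans (B.α_l _ _ (src_conj hz hz')).symm) (by
    filter_upwards [et, es] with z hz hz'
    exact (s.dα_lift _ hz _).trans (B.dα_dl (src_conj hz hz') (s'.dα_lift _ hz' _).symm).symm)
  refine a4.congr hyS ?_ (Filter.Eventually.of_forall fun _ => rfl)
  filter_upwards [et, es] with z hz hz' using (divR_l_conj hz hz').symm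

end Smooth

/-- The analogue of `dconj_ddiv` for right translation of a vertical vector. Its source does not
move, and lifts are linear, so constant curves can be taken at the sources. The identity
differentiated is p⁻¹ (γ conj(h)) σ'(s h) = (p⁻¹ γ σ(t h)) h. -/
theorem dconj_dmul {s s' : LSec B} {h : H} (h0 : ℋ.tgt h ∈ s.W) (h1 : ℋ.src h ∈ s'.W) {x : M}
    (hx : x = B.α (s.σ (ℋ.tgt h))) {a : EG} (ha : 𝒢.dsrc (𝒢.unit x) a = 0) :
    dconj s s' h (𝒢.dmul (𝒢.unit x) (conj s s' h) a 0) =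
      ℋ.dmul (ℋ.unit (ℋ.tgt h)) h (dconj s s (ℋ.unit (ℋ.tgt h)) a) 0 := by
  have ht := ℋ.tgt_unit (ℋ.tgt h)
  have hs := ℋ.src_unit (ℋ.tgt h)
  have e0 := conj_unit h0
  have etc := tgt_conj h0 h1
  have hx' : x = 𝒢.tgt (conj s s' h) := by rw [hx, etc]
  obtain ⟨γ, hγ0, hγ, hγs⟩ := 𝒢.exists_curve_vertical ha
  rw [𝒢.src_unit] at hγs
  have hγs' : ∀ᶠ t in 𝓝 0, 𝒢.src (γ t) = 𝒢.tgt (conj s s' h) := hγs.mono fun t ht => ht.trans hx'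
  have b1 := hγ.mul (hasVel_const (conj s s' h)) hγs'
  have b10 : 𝒢.mul (γ 0) (conj s s' h) = conj s s' h := by rw [hγ0, hx', 𝒢.unit_mul]
  have b2 := b1.tgt.eq_of_eventually hγ.tgt (hγs'.mono fun t ht => 𝒢.tgt_mul _ _ ht)
  rw [b10, hγ0] at b2
  rw [hγ0] at b1
  have hds : 𝒢.dsrc (conj s s' h) (𝒢.dmul (𝒢.unit x) (conj s s' h) a 0) = 0 :=
    𝒢.dsrc_dmul_zero hx' ha
  obtain ⟨p, hp0, hp, hpα⟩ := s.exists_curve h0 (η := fun t => 𝒢.tgt (γ t))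
    (by rw [hγ0, 𝒢.tgt_unit, hx]) hγ.tgt
  rw [hγ0] at hp
  have c1 := hasVel_dconj (s := s) (s' := s) (h := ℋ.unit (ℋ.tgt h)) (hγ0.trans (by rw [e0, hx])) hγ
    (p := p) (q := fun _ => s.σ (ℋ.tgt h)) (by rw [hp0, ht]) (by rw [hs])
    (by rwa [e0, ← hx, ht]) (by rw [e0, ← hx, ha, map_zero]; exact hasVel_const _) hpα
    (hγs.mono fun t ht => by rw [ht, hx])
  have c2 := hasVel_dconj (s := s) (s' := s') (h := h) b10 b1
    (p := p) (q := fun _ => s'.σ (ℋ.src h)) hp0 rfl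
    (by rwa [b2]) (by rw [hds, map_zero]; exact hasVel_const _)
    (by filter_upwards [hpα, hγs'] with t ht ht'; rw [ht, 𝒢.tgt_mul _ _ ht'])
    (hγs'.mono fun t ht => by rw [𝒢.src_mul _ _ ht, src_conj h0 h1])
  have key : ∀ᶠ t in 𝓝 0, B.α (p t) = B.α (B.l (γ t) (s.σ (ℋ.tgt h))) := by
    filter_upwards [hpα, hγs] with t h1 h2
    rw [h1, B.α_l _ _ (h2.trans hx)]
  have e4 : B.β (s.σ (ℋ.tgt h)) = ℋ.tgt h := s.β_σ _ h0
  have key2 : ∀ᶠ t in 𝓝 0, B.β (B.l (γ t) (s.σ (ℋ.tgt h))) = ℋ.tgt h := by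
    filter_upwards [hγs] with t h2
    rw [B.β_l _ _ (h2.trans hx), e4]
  have c3 := c1.mul (hasVel_const h) (by
    filter_upwards [key, key2] with t k1 k2
    rw [B.src_divR k1, k2])
  have e5 : B.divR (p 0) (B.l (γ 0) (s.σ (ℋ.tgt h))) = ℋ.unit (ℋ.tgt h) := by
    rw [hp0, hγ0, hx, B.unit_l]
    exact (B.eq_divR (by rw [ht, e4]) (by rw [← e4, e4]; simpa only [e4] using B.r_unit (s.σ (ℋ.tgt h)))).symm
  rw [e5] at c3
  refine c2.eq_of_eventually c3 ?_
  filter_upwards [key, key2, hγs, hγs'] with t k1 k2 k3 k4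
  rw [B.mul_l _ _ _ k4 (src_conj h0 h1), l_conj h0 h1, ← B.comm _ _ _ (k3.trans hx) e4,
    B.divR_r_mul k1 k2]

/-- The section through a chosen point of the fibre moves that point by the adjusting map of β. The
lifts are the derivatives of the adjusting map of α in its base variable, hence linear and smooth.
-/
theorem exists_mem (B : Bibundle 𝒢 ℋ EP P) (x : N) : ∃ s : LSec B, x ∈ s.W := by
  obtain ⟨p, hp⟩ := B.surjective_β x
  obtain ⟨e, O, hO, hpO, he, he1, he2⟩ := B.isSubmersion_β.exists_adjust p
  obtain ⟨e', O', hO', hpO', he', he1', he2'⟩ := B.isSubmersion_α.exists_adjust p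
  let σ : N → P := fun z => e (p, z)
  let U : Set N := {z | (p, z) ∈ O}
  have hU : IsOpen U := hO.preimage (by fun_prop)
  have hσ : ContMDiffOn 𝓘(ℝ, EN) 𝓘(ℝ, EP) ∞ σ U :=
    he.comp (contMDiff_const.prodMk contMDiff_id).contMDiffOn fun z hz => hz
  have hασ : ContMDiffOn 𝓘(ℝ, EN) (𝓘(ℝ, EP).prod 𝓘(ℝ, EM)) ∞ (fun z => (σ z, B.α (σ z))) U :=
    hσ.prodMk (B.isSubmersion_α.contMDiff.comp_contMDiffOn hσ)
  let W : Set N := U ∩ (fun z => (σ z, B.α (σ z))) ⁻¹' O'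
  have hW : IsOpen W := hασ.continuousOn.isOpen_inter_preimage hU hO'
  let L : N → EM →ₗ[ℝ] EP := fun z =>
    (show EP × EM →ₗ[ℝ] EP from
      (mfderiv (𝓘(ℝ, EP).prod 𝓘(ℝ, EM)) 𝓘(ℝ, EP) e' (σ z, B.α (σ z))).toLinearMap).comp
      (LinearMap.inr ℝ EP EM)
  refine ⟨⟨W, hW, σ, L, fun z hz => he1 _ hz.1, hσ.mono inter_subset_left, ?_, ?_⟩, ?_⟩
  · intro z hz w
    obtain ⟨η, h0, hη⟩ := exists_hasVel (B.α (σ z)) w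
    have h1 := ((hasVel_const (I := 𝓘(ℝ, EP)) (σ z)).prodMk hη).comp (x := (σ z, B.α (σ z)))
      (by rw [h0]) (((he' _ hz.2).contMDiffAt (hO'.mem_nhds hz.2)).mdifferentiableAt (by simp))
    have h2 : ∀ᶠ t in 𝓝 0, (σ z, η t) ∈ O' :=
      ((hasVel_const (I := 𝓘(ℝ, EP)) (σ z)).prodMk hη).continuousAt.eventually_mem
        (by rw [h0]; exact hO'.mem_nhds hz.2)
    have h3 := h1.alpha.eq_of_eventually hη (h2.mono fun t ht => he1' _ ht)
    rw [h0, he2' _ hz.2] at h3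
    exact h3
  · rintro ⟨z, ζ⟩ ⟨hz, hζ⟩
    have h1 : SmoothAlong (𝓘(ℝ, EN).prod 𝓘(ℝ, EM).tangent)
        (fun a : N × TangentBundle 𝓘(ℝ, EM) M => σ a.1) (fun _ => (0 : EP))
        {a | a.1 ∈ W ∧ a.2.proj = B.α (σ a.1)} (z, ζ) :=
      smoothAlong_zero (hσ.comp_within contMDiffWithinAt_fst ⟨hz, hζ⟩
        (Filter.eventually_of_mem self_mem_nhdsWithin fun a ha => ha.1.1))
    have h2 : SmoothAlong (𝓘(ℝ, EN).prod 𝓘(ℝ, EM).tangent)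
        (fun a : N × TangentBundle 𝓘(ℝ, EM) M => a.2.proj) (fun a => a.2.2)
        {a | a.1 ∈ W ∧ a.2.proj = B.α (σ a.1)} (z, ζ) := contMDiffWithinAt_snd
    have h3 := h1.mfderivOn₂ hO' he' h2 (by
      rw [show ζ.proj = B.α (σ z) from hζ]
      exact hz.2) ⟨hz, hζ⟩
    refine SmoothAlong.congr h3 ⟨hz, hζ⟩ ?_ ?_
    · filter_upwards [self_mem_nhdsWithin] with a ha
      rw [ha.2, he2' _ ha.1.2]
    · filter_upwards [self_mem_nhdsWithin] with a ha
      rw [ha.2]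
      rfl
  · have h1 : σ x = p := by
      change e (p, x) = p
      rw [← hp, he2 p hpO]
    refine ⟨?_, ?_⟩
    · change (p, x) ∈ O
      rwa [← hp]
    · change (σ x, B.α (σ x)) ∈ O'
      rwa [h1]

variable (𝒢) in
/-- The units, as a section of the unit bibundle. -/
def unit : LSec (unitBundle 𝒢) where
  W := univ
  isOpen := isOpen_univ
  σ := 𝒢.unit
  lift x := { toFun := 𝒢.dunit x, map_add' := 𝒢.dunit_add x, map_smul' := 𝒢.dunit_smul x }
  β_σ x _ := 𝒢.src_unit x
  smooth_σ := 𝒢.contMDiff_unit.contMDiffOn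
  dα_lift x _ z := by
    obtain ⟨η, rfl, hη⟩ := exists_hasVel x z
    exact (hη.unit (𝒢 := 𝒢)).tgt.eq_of_eventually hη
      (Filter.Eventually.of_forall fun t => 𝒢.tgt_unit _)
  smooth_lift := by
    have h : ContMDiff (𝓘(ℝ, EM).prod 𝓘(ℝ, EM).tangent) 𝓘(ℝ, EG).tangent ∞
        (fun a : M × TangentBundle 𝓘(ℝ, EM) M => tangentMap 𝓘(ℝ, EM) 𝓘(ℝ, EG) 𝒢.unit a.2) :=
      (𝒢.contMDiff_unit.contMDiff_tangentMap (by simp)).comp contMDiff_snd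
    refine h.contMDiffOn.congr ?_
    rintro ⟨x, ζ⟩ ⟨-, hζ⟩
    have h2 : ζ.proj = x := hζ.trans (𝒢.tgt_unit x)
    subst h2
    rfl

theorem conj_unit_unit (g : G) : conj (unit 𝒢) (unit 𝒢) g = g := by
  change 𝒢.div (𝒢.mul (𝒢.unit (𝒢.tgt g)) g) (𝒢.unit (𝒢.src g)) = g
  rw [𝒢.unit_mul, 𝒢.div_unit]

/-- Here p = 1_{t(γ)} and q = 1_{s(γ)} have the lifted velocities, and p⁻¹ γ q = γ. -/
theorem dconj_unit_unit (g : G) (v : EG) : dconj (unit 𝒢) (unit 𝒢) g v = v := by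
  obtain ⟨γ, h0, hγ⟩ := exists_hasVel g v
  have h1 := hasVel_dconj (s := unit 𝒢) (s' := unit 𝒢) (h := g) (h0.trans (conj_unit_unit g).symm) hγ
    (p := fun t => 𝒢.unit (𝒢.tgt (γ t))) (q := fun t => 𝒢.unit (𝒢.src (γ t)))
    (by rw [h0]; rfl) (by rw [h0]; rfl) ?_ ?_ (Filter.Eventually.of_forall fun t => 𝒢.tgt_unit _)
    (Filter.Eventually.of_forall fun t => 𝒢.tgt_unit _)
  · refine h1.eq_of_eventually hγ (Filter.Eventually.of_forall fun t => ?_)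
    change 𝒢.mul (𝒢.inv (𝒢.unit (𝒢.tgt (γ t)))) (𝒢.mul (γ t) (𝒢.unit (𝒢.src (γ t)))) = γ t
    rw [𝒢.mul_unit, 𝒢.inv_unit, 𝒢.unit_mul]
  · have := (hγ.tgt (𝒢 := 𝒢)).unit (𝒢 := 𝒢)
    rw [h0] at this
    rw [conj_unit_unit]
    exact this
  · have := (hγ.src (𝒢 := 𝒢)).unit (𝒢 := 𝒢)
    rw [h0] at this
    rw [conj_unit_unit]
    exact this

/-- The composite of a local section of a bibundle and one of its opposite. -/
def comp (s : LSec B) (s' : LSec B.op) : LSec (unitBundle 𝒢) where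
  W := s'.W ∩ (fun x => B.β (s'.σ x)) ⁻¹' s.W
  isOpen := ((B.isSubmersion_β.contMDiff.comp_contMDiffOn s'.smooth_σ).continuousOn).isOpen_inter_preimage
    s'.isOpen s.isOpen
  σ x := B.divL (s.σ (B.β (s'.σ x))) (s'.σ x)
  lift x :=
    { toFun := fun z => B.ddivL (s.σ (B.β (s'.σ x))) (s'.σ x) (s.lift (B.β (s'.σ x)) z)
        (s'.lift x (B.dβ (s.σ (B.β (s'.σ x))) (s.lift (B.β (s'.σ x)) z)))
      map_add' := fun z w => by
        rw [map_add, dβ_add, map_add]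
        exact fderivPair_add _ _ _ _ _ _ _ _
      map_smul' := fun a z => by
        rw [map_smul, dβ_smul, map_smul]
        exact fderivPair_smul _ _ _ _ _ _ _ }
  β_σ x hx := by
    have h1 : B.α (s'.σ x) = x := s'.β_σ x hx.1
    exact (B.src_divL _ _ (s.β_σ _ hx.2)).trans h1
  smooth_σ x hx := by
    have h1 := s'.contMDiffWithinAt_σ hx contMDiffWithinAt_id hx.1
    have h2 := B.isSubmersion_β.contMDiff.contMDiffAt.comp_contMDiffWithinAt x h1
    refine B.contMDiffOn_divL.comp_within ((s.contMDiffWithinAt_σ hx h2 hx.2).prodMk h1) hx ?_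
    filter_upwards [self_mem_nhdsWithin] with z hz using s.β_σ _ hz.2
  dα_lift x hx z := by
    obtain ⟨η, h0, hη⟩ := exists_hasVel (B.α (s.σ (B.β (s'.σ x)))) z
    obtain ⟨p, hp0, hp, hpα⟩ := s.exists_curve hx.2 h0 hη
    obtain ⟨p', hp'0, hp', hpβ⟩ := s'.exists_curve hx.1 (η := fun t => B.β (p t))
      (by rw [hp0]; exact s.β_σ _ hx.2) hp.beta
    rw [hp0] at hp'
    have h1 := hp.divL hp' (hpβ.mono fun t ht => Eq.symm ht)
    have h2 := h1.tgt.eq_of_eventually hη (by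
      filter_upwards [hpα, hpβ] with t ht ht'
      rw [B.tgt_divL (Eq.symm ht'), ht])
    rw [hp0, hp'0] at h2
    exact h2
  smooth_lift := by
    rintro ⟨x, ζ⟩ hmem
    have hx := hmem.1
    have e1 := s'.contMDiffWithinAt_σ (I' := 𝓘(ℝ, EM).prod 𝓘(ℝ, EM).tangent)
      (S := {a : M × TangentBundle 𝓘(ℝ, EM) M | a.1 ∈ s'.W ∩ (fun x => B.β (s'.σ x)) ⁻¹' s.W ∧
        a.2.proj = 𝒢.tgt (B.divL (s.σ (B.β (s'.σ a.1))) (s'.σ a.1))})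
      (y := (x, ζ)) hmem contMDiffWithinAt_fst hx.1
    have e2 := B.isSubmersion_β.contMDiff.contMDiffAt.comp_contMDiffWithinAt (x, ζ) e1
    have e3 : SmoothAlong (𝓘(ℝ, EM).prod 𝓘(ℝ, EM).tangent)
        (fun a : M × TangentBundle 𝓘(ℝ, EM) M => a.2.proj) (fun a => a.2.2)
        {a : M × TangentBundle 𝓘(ℝ, EM) M | a.1 ∈ s'.W ∩ (fun x => B.β (s'.σ x)) ⁻¹' s.W ∧
        a.2.proj = 𝒢.tgt (B.divL (s.σ (B.β (s'.σ a.1))) (s'.σ a.1))} (x, ζ) :=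
      contMDiffWithinAt_snd
    have e4 := s.smoothAlong_lift hmem e2 hx.2 e3 (by
      filter_upwards [self_mem_nhdsWithin] with a ha
      exact ha.2.trans (B.tgt_divL (s.β_σ _ ha.1.2)))
    have e5 := s'.smoothAlong_lift hmem contMDiffWithinAt_fst hx.1
      (e4.mfderiv B.isSubmersion_β.contMDiff hmem) (by
      filter_upwards [self_mem_nhdsWithin] with a ha
      exact s.β_σ _ ha.1.2)
    refine e4.fderivPair B.isSubmersion_β B.isSubmersion_β.contMDiff B.contMDiffOn_divL hmem e5
      ?_ ?_
    · filter_upwards [self_mem_nhdsWithin] with a ha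
      exact s.β_σ _ ha.1.2
    · filter_upwards [self_mem_nhdsWithin] with a ha
      exact (s'.dα_lift _ ha.1.1 _).symm

section Comp

variable {s₀ s₁ : LSec B} {s₀' s₁' : LSec B.op} {g : G}

theorem tgt_conj_op (h0 : 𝒢.tgt g ∈ s₀'.W) (h1 : 𝒢.src g ∈ s₁'.W) :
    ℋ.tgt (conj s₀' s₁' g) = B.β (s₀'.σ (𝒢.tgt g)) := tgt_conj h0 h1

theorem src_conj_op (h0 : 𝒢.tgt g ∈ s₀'.W) (h1 : 𝒢.src g ∈ s₁'.W) :
    ℋ.src (conj s₀' s₁' g) = B.β (s₁'.σ (𝒢.src g)) := src_conj h0 h1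

theorem mem_W_tgt_conj_op (h0 : 𝒢.tgt g ∈ (comp s₀ s₀').W) (h1 : 𝒢.src g ∈ (comp s₁ s₁').W) :
    ℋ.tgt (conj s₀' s₁' g) ∈ s₀.W := by
  rw [tgt_conj_op h0.1 h1.1]
  exact h0.2

theorem mem_W_src_conj_op (h0 : 𝒢.tgt g ∈ (comp s₀ s₀').W) (h1 : 𝒢.src g ∈ (comp s₁ s₁').W) :
    ℋ.src (conj s₀' s₁' g) ∈ s₁.W := by
  rw [src_conj_op h0.1 h1.1]
  exact h1.2

/-- Write h for the conjugate of g by the opposite sections, so that p₀' h = g p₁'. If τ is the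
arrow with τ p₀' = σ₀(β p₀'), then τ g p₁' = σ₀(β p₀') h. Dividing by the corresponding arrow at the
source gives both sides. -/
theorem conj_comp (h0 : 𝒢.tgt g ∈ (comp s₀ s₀').W) (h1 : 𝒢.src g ∈ (comp s₁ s₁').W) :
    conj s₀ s₁ (conj s₀' s₁' g) = conj (comp s₀ s₀') (comp s₁ s₁') g := by
  have m0 := mem_W_tgt_conj_op h0 h1
  have m1 := mem_W_src_conj_op h0 h1
  have a0 : B.α (s₀'.σ (𝒢.tgt g)) = 𝒢.tgt g := s₀'.β_σ _ h0.1
  have a1 : B.α (s₁'.σ (𝒢.src g)) = 𝒢.src g := s₁'.β_σ _ h1.1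
  have b0 := s₀.β_σ _ h0.2
  have b1 := s₁.β_σ _ h1.2
  set p₀' := s₀'.σ (𝒢.tgt g)
  set p₁' := s₁'.σ (𝒢.src g)
  have eg : 𝒢.src (𝒢.inv g) = B.α p₀' := by rw [𝒢.src_inv, a0]
  have eα : B.α (B.l (𝒢.inv g) p₀') = B.α p₁' := by rw [B.α_l _ _ eg, 𝒢.tgt_inv, a1]
  have eh : conj s₀' s₁' g = B.divR (B.l (𝒢.inv g) p₀') p₁' := rfl
  have et := tgt_conj_op h0.1 h1.1
  have es := src_conj_op h0.1 h1.1
  change B.divL (B.r (s₀.σ (ℋ.tgt (conj s₀' s₁' g))) (conj s₀' s₁' g))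
    (s₁.σ (ℋ.src (conj s₀' s₁' g))) = _
  rw [et, es]
  change _ = 𝒢.div (𝒢.mul (B.divL (s₀.σ (B.β p₀')) p₀') g) (B.divL (s₁.σ (B.β p₁')) p₁')
  set h := conj s₀' s₁' g
  have c1 : B.r p₀' h = B.l g p₁' := by
    have c2 : B.r (B.l (𝒢.inv g) p₀') h = p₁' := by rw [eh, B.r_divR _ _ eα]
    have c3 : B.l g (B.l (𝒢.inv g) p₀') = p₀' := by
      rw [← B.mul_l _ _ _ (𝒢.tgt_inv g).symm eg, 𝒢.mul_inv, ← a0, B.unit_l]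
    rw [← c2, ← B.comm _ _ _ (by rw [B.α_l _ _ eg, 𝒢.tgt_inv]) (by rw [B.β_l _ _ eg, et]), c3]
  have c4 : 𝒢.mul (B.divL (s₀.σ (B.β p₀')) p₀') g = B.divL (B.r (s₀.σ (B.β p₀')) h) p₁' := by
    have d1 : 𝒢.src g = B.α p₁' := a1.symm
    have d2 := B.src_divL _ _ b0
    refine B.eq_divL ?_ ?_
    · rw [𝒢.src_mul _ _ (d2.trans a0), d1]
    · rw [B.mul_l _ _ _ (d2.trans a0) d1, ← c1, ← B.comm _ _ _ d2 et.symm, B.l_divL _ _ b0]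
  rw [c4, B.div_divL]
  · rw [B.β_r _ _ (b0.trans et.symm), es]
  · rw [b1]

/-- The same computation along curves. If `p`, `q` serve the first conjugation and `p'`, `q'` the
second, then their left quotients serve the composite, and their velocities are the composite lifts
by construction. -/
theorem dconj_comp (h0 : 𝒢.tgt g ∈ (comp s₀ s₀').W) (h1 : 𝒢.src g ∈ (comp s₁ s₁').W) (v : EG) :
    dconj s₀' s₁' g (dconj s₀ s₁ (conj s₀' s₁' g) v) = dconj (comp s₀ s₀') (comp s₁ s₁') g v := by
  have m0 := mem_W_tgt_conj_op h0 h1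
  have m1 := mem_W_src_conj_op h0 h1
  have et := tgt_conj_op h0.1 h1.1
  have es := src_conj_op h0.1 h1.1
  have ec := conj_comp h0 h1
  obtain ⟨γ, hγ0, hγ⟩ := exists_hasVel (conj s₀ s₁ (conj s₀' s₁' g)) v
  obtain ⟨p, q, hp0, hq0, hp, hq, hpα, hqα⟩ := exists_curves m0 m1 hγ0 hγ
  have e1 := hasVel_dconj hγ0 hγ hp0 hq0 hp hq hpα hqα
  have ke : ∀ᶠ t in 𝓝 0, B.α (p t) = B.α (B.l (γ t) (q t)) := by
    filter_upwards [hpα, hqα] with t ht ht'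
    rw [ht, B.α_l _ _ ht'.symm]
  obtain ⟨p', q', hp'0, hq'0, hp', hq', hp'α, hq'α⟩ := exists_curves (B := B.op) h0.1 h1.1
    (by rw [hp0, hγ0, hq0, divR_l_conj m0 m1]) e1
  have f1 := hasVel_dconj (B := B.op) (by rw [hp0, hγ0, hq0, divR_l_conj m0 m1]) e1 hp'0 hq'0 hp' hq'
    hp'α hq'α
  have kp : ∀ᶠ t in 𝓝 0, B.β (p t) = B.β (p' t) := by
    filter_upwards [hp'α, ke] with t ht ht'
    exact (ht.trans (B.tgt_divR _ _ ht')).symm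
  have kq : ∀ᶠ t in 𝓝 0, B.β (q t) = B.β (q' t) := by
    filter_upwards [hq'α, ke, hqα] with t ht ht' ht''
    rw [← B.β_l _ _ ht''.symm]
    exact (ht.trans (B.src_divR ht')).symm
  have g1 := hp.divL hp' kp
  have g2 := hq.divL hq' kq
  rw [hp0, hp'0] at g1
  rw [hq0, hq'0] at g2
  simp only [dtgt_dconj m0 m1, dsrc_dconj m0 m1, et, es, ec] at g1 g2
  have f2 := hasVel_dconj (s := comp s₀ s₀') (s' := comp s₁ s₁') (h := g) (v := v)
    (p := fun t => B.divL (p t) (p' t)) (q := fun t => B.divL (q t) (q' t)) (hγ0.trans ec) hγ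
    (by rw [hp0, hp'0, et]; rfl) (by rw [hq0, hq'0, es]; rfl) ?_ ?_ ?_ ?_
  · refine f1.eq_of_eventually f2 ?_
    filter_upwards [kp, kq, ke, hpα, hqα] with t k1 k2 k3 k4 k5
    change B.divL (p' t) (B.r (q' t) (ℋ.inv (B.divR (p t) (B.l (γ t) (q t))))) =
      𝒢.mul (𝒢.inv (B.divL (p t) (p' t))) (𝒢.mul (γ t) (B.divL (q t) (q' t)))
    have w1 := B.src_divR k3
    have w2 := B.tgt_divR _ _ k3
    rw [B.β_l _ _ k5.symm] at w1
    set h := B.divR (p t) (B.l (γ t) (q t)) with hh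
    have w3 : B.β (q' t) = ℋ.tgt (ℋ.inv h) := by rw [ℋ.tgt_inv, w1, k2]
    have w3' : B.β (q t) = ℋ.tgt (ℋ.inv h) := by rw [ℋ.tgt_inv, w1]
    have w4 := B.src_divL _ _ k1
    have w5 := B.tgt_divL k1
    have w6 := B.src_divL _ _ k2
    have w7 := B.tgt_divL k2
    have w8 : 𝒢.src (γ t) = 𝒢.tgt (B.divL (q t) (q' t)) := by rw [← k5, w7]
    have w9 : 𝒢.src (𝒢.inv (B.divL (p t) (p' t))) =
        𝒢.tgt (𝒢.mul (γ t) (B.divL (q t) (q' t))) := by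
      rw [𝒢.src_inv, w5, 𝒢.tgt_mul _ _ w8, k4]
    have w10 := B.α_r _ _ w3
    have w11 : B.r (B.l (γ t) (q t)) (ℋ.inv h) = p t := by
      have := B.r_mul (p t) h (ℋ.inv h) w2.symm (ℋ.tgt_inv h).symm
      rw [ℋ.mul_inv, w2, B.r_unit, hh, B.r_divR _ _ k3] at this
      exact this.symm
    refine (B.eq_divL ?_ ?_).symm
    · rw [𝒢.src_mul _ _ w9, 𝒢.src_mul _ _ w8, w6, w10]
    · rw [B.mul_l _ _ _ w9 (by rw [𝒢.src_mul _ _ w8, w6, w10]),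
        B.mul_l _ _ _ w8 (by rw [w6, w10]), ← B.comm _ _ _ w6 w3, B.l_divL _ _ k2,
        ← B.comm _ _ _ k5.symm w3', w11]
      have := B.mul_l (𝒢.inv (B.divL (p t) (p' t))) (B.divL (p t) (p' t)) (p' t) (𝒢.src_inv _) w4
      rw [𝒢.inv_mul, B.l_divL _ _ k1, w4, B.unit_l] at this
      exact this.symm
  · exact g1
  · exact g2
  · filter_upwards [kp, hpα] with t k1 k2
    exact (B.tgt_divL k1).trans k2
  · filter_upwards [kq, hqα] with t k1 k2
    exact (B.tgt_divL k1).trans k2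

end Comp

end LSec

end Bibundle

end LieGroupoid

/-! ### Partitions of unity and averages over labellings -/

namespace LieGroupoid

universe u u'

variable {EM : Type*} [NormedAddCommGroup EM] [NormedSpace ℝ EM]
  {M : Type u} [TopologicalSpace M] [ChartedSpace EM M] [IsManifold 𝓘(ℝ, EM) ∞ M]
  {EG : Type*} [NormedAddCommGroup EG] [NormedSpace ℝ EG]
  {G : Type u} [TopologicalSpace G] [ChartedSpace EG G] [IsManifold 𝓘(ℝ, EG) ∞ G]
  {EN : Type*} [NormedAddCommGroup EN] [NormedSpace ℝ EN]
  {N : Type u'} [TopologicalSpace N] [ChartedSpace EN N] [IsManifold 𝓘(ℝ, EN) ∞ N]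
  {EH : Type*} [NormedAddCommGroup EH] [NormedSpace ℝ EH]
  {H : Type u'} [TopologicalSpace H] [ChartedSpace EH H] [IsManifold 𝓘(ℝ, EH) ∞ H]

namespace Bibundle

variable {𝒢 : LieGroupoid EM M EG G} {ℋ : LieGroupoid EN N EH H}
  {EP : Type*} [NormedAddCommGroup EP] [NormedSpace ℝ EP]
  {P : Type*} [TopologicalSpace P] [ChartedSpace EP P] [IsManifold 𝓘(ℝ, EP) ∞ P]
  {B : Bibundle 𝒢 ℋ EP P}

variable (B) in
/-- A family of local sections together with weights: locally finite families of smooth functions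
with sum one, each of which is locally supported in the domain of the corresponding section. -/
structure Dist (ι : Type*) where
  sec : ι → LSec B
  w : ι → N → ℝ
  locallyFinite : ∀ x, ∃ F : Finset ι, ∀ᶠ y in 𝓝 x, ∀ i ∉ F, w i y = 0
  sum_eq_one : ∀ x (F : Finset ι), (∀ i ∉ F, w i x = 0) → ∑ i ∈ F, w i x = 1
  smooth : ∀ i x, (x ∈ (sec i).W ∧ ContMDiffAt 𝓘(ℝ, EN) 𝓘(ℝ, ℝ) ∞ (w i) x) ∨
    ∀ᶠ y in 𝓝 x, w i y = 0

namespace Dist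

variable {ι : Type*} (D : Dist B ι) {V : Type*} [AddCommGroup V] [Module ℝ V]

theorem mem_W {i : ι} {x : N} (h : D.w i x ≠ 0) : x ∈ (D.sec i).W :=
  (D.smooth i x).elim (fun h => h.1) fun h' => absurd h'.self_of_nhds h

theorem exists_finset {n : ℕ} (x : Fin n → N) :
    ∃ F : Finset ι, ∀ j, ∀ᶠ y in 𝓝 (x j), ∀ i ∉ F, D.w i y = 0 := by
  classical
  choose F hF using fun j => D.locallyFinite (x j)
  refine ⟨Finset.univ.biUnion F, fun j => (hF j).mono fun y hy i hi => hy i fun h => hi ?_⟩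
  exact Finset.mem_biUnion.2 ⟨j, Finset.mem_univ _, h⟩

theorem exists_finset' {n : ℕ} (x : Fin n → N) :
    ∃ F : Finset ι, ∀ j, ∀ i ∉ F, D.w i (x j) = 0 :=
  (D.exists_finset x).imp fun _ hF j => (hF j).self_of_nhds

theorem exists_w_ne_zero (x : N) : ∃ i, D.w i x ≠ 0 := by
  by_contra! h
  have := D.sum_eq_one x ∅ fun i _ => h i
  simp at this

/-- The weighted average of `T` over all labellings of the points `x 0, …, x (n - 1)`. -/
def avg {n : ℕ} (x : Fin n → N) (T : (Fin n → ι) → V) : V :=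
  ∑ᶠ I : Fin n → ι, (∏ j, D.w (I j) (x j)) • T I

open scoped Classical in
theorem avg_eq_sum {n : ℕ} {x : Fin n → N} (T : (Fin n → ι) → V) {F : Finset ι}
    (hF : ∀ j, ∀ i ∉ F, D.w i (x j) = 0) :
    D.avg x T = ∑ I ∈ Fintype.piFinset (fun _ : Fin n => F), (∏ j, D.w (I j) (x j)) • T I := by
  refine finsum_eq_sum_of_support_subset _ fun I hI => ?_
  by_contra h
  simp only [Finset.mem_coe, Fintype.mem_piFinset, not_forall] at h
  obtain ⟨j, hj⟩ := h
  apply hI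
  change (∏ j, D.w (I j) (x j)) • T I = 0
  rw [Finset.prod_eq_zero (Finset.mem_univ j) (hF j _ hj), zero_smul]

/-- Labellings with nonzero weight have every point in the domain of its section. The values
elsewhere, where conjugation has no meaning, do not contribute. -/
theorem avg_congr {n : ℕ} {x : Fin n → N} {T T' : (Fin n → ι) → V}
    (h : ∀ I, (∀ j, x j ∈ (D.sec (I j)).W) → T I = T' I) : D.avg x T = D.avg x T' := by
  refine finsum_congr fun I => ?_
  by_cases hI : ∀ j, D.w (I j) (x j) ≠ 0
  · rw [h I fun j => D.mem_W (hI j)]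
  · push Not at hI
    obtain ⟨j, hj⟩ := hI
    rw [Finset.prod_eq_zero (Finset.mem_univ j) hj, zero_smul, zero_smul]

theorem map_avg {n : ℕ} {V' : Type*} [AddCommGroup V'] [Module ℝ V'] (x : Fin n → N)
    (T : (Fin n → ι) → V) (L : V →ₗ[ℝ] V') : L (D.avg x T) = D.avg x (fun I => L (T I)) := by
  classical
  obtain ⟨F, hF⟩ := D.exists_finset' x
  simp only [D.avg_eq_sum _ hF, map_sum, map_smul]

theorem avg_add {n : ℕ} (x : Fin n → N) (T T' : (Fin n → ι) → V) :
    D.avg x (fun I => T I + T' I) = D.avg x T + D.avg x T' := by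
  classical
  obtain ⟨F, hF⟩ := D.exists_finset' x
  simp only [D.avg_eq_sum _ hF, smul_add, Finset.sum_add_distrib]

theorem avg_smul {n : ℕ} (x : Fin n → N) (a : ℝ) (T : (Fin n → ι) → V) :
    D.avg x (fun I => a • T I) = a • D.avg x T :=
  (D.map_avg x T (LinearMap.lsmul ℝ V a)).symm

theorem avg_neg {n : ℕ} (x : Fin n → N) (T : (Fin n → ι) → V) :
    D.avg x (fun I => -T I) = -D.avg x T := by
  simpa only [neg_smul, one_smul] using D.avg_smul x (-1) T

theorem avg_sub {n : ℕ} (x : Fin n → N) (T T' : (Fin n → ι) → V) :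
    D.avg x (fun I => T I - T' I) = D.avg x T - D.avg x T' := by
  simp only [sub_eq_add_neg, D.avg_add, D.avg_neg]

theorem avg_const {n : ℕ} (x : Fin n → N) (v : V) : D.avg x (fun _ => v) = v := by
  classical
  obtain ⟨F, hF⟩ := D.exists_finset' x
  have h := Finset.prod_univ_sum (fun _ : Fin n => F) (fun j i => D.w i (x j))
  rw [D.avg_eq_sum _ hF, ← Finset.sum_smul, ← h]
  rw [Finset.prod_congr rfl fun j _ => D.sum_eq_one (x j) F (hF j), Finset.prod_const_one, one_smul]

/-- The average of a function that does not depend on the label of the point `x m`. -/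
theorem avg_face {n : ℕ} (m : Fin (n + 1)) (x : Fin (n + 1) → N) (T : (Fin n → ι) → V) :
    D.avg x (fun I => T fun j => I (m.succAbove j)) = D.avg (fun j => x (m.succAbove j)) T := by
  classical
  obtain ⟨F, hF⟩ := D.exists_finset' x
  rw [D.avg_eq_sum _ hF, D.avg_eq_sum _ (F := F) fun j => hF _]
  -- A labelling of all points is a label of the point `m` together with a labelling of the others;
  -- summing over the former gives the factor one.
  calc _ = ∑ p ∈ F ×ˢ Fintype.piFinset (fun _ : Fin n => F),
        (D.w p.1 (x m) * ∏ j, D.w (p.2 j) (x (m.succAbove j))) • T p.2 := by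
        symm
        refine Finset.sum_equiv (Fin.insertNthEquiv (fun _ => ι) m) ?_ ?_
        · rintro ⟨i, I⟩
          simp only [Finset.mem_product, Fintype.mem_piFinset, Fin.insertNthEquiv_apply]
          rw [Fin.forall_iff_succAbove m]
          simp
        · rintro ⟨i, I⟩ -
          simp only [Fin.insertNthEquiv_apply]
          rw [Fin.prod_univ_succAbove _ m]
          simp
    _ = _ := by
        rw [Finset.sum_product_right]
        refine Finset.sum_congr rfl fun I _ => ?_
        dsimp only
        rw [← Finset.sum_smul, ← Finset.sum_mul, D.sum_eq_one (x m) F (hF m), one_mul]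

/-- If neither the first point nor its label matters, both averages reduce by `avg_face` to one over
the remaining points. This transfers projectability to averages. -/
theorem avg_eq_avg_of_tail {n : ℕ} {x x' : Fin (n + 1) → N} {T T' : (Fin (n + 1) → ι) → V}
    (hx : ∀ j : Fin n, x j.succ = x' j.succ)
    (h : ∀ I I', (∀ j, x j ∈ (D.sec (I j)).W) → (∀ j, x' j ∈ (D.sec (I' j)).W) →
      (∀ j : Fin n, I j.succ = I' j.succ) → T I = T' I') : D.avg x T = D.avg x' T' := by
  -- Placeholders for the first label. They must be admissible, since `h` speaks only about labels
  -- whose domains contain the points.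
  obtain ⟨i, hi⟩ := D.exists_w_ne_zero (x 0)
  obtain ⟨i', hi'⟩ := D.exists_w_ne_zero (x' 0)
  have h1 : D.avg x T = D.avg x (fun I => (fun I' : Fin n → ι =>
      T' (Fin.cons i' I')) fun j => I ((0 : Fin (n + 1)).succAbove j)) := by
    refine D.avg_congr fun I hI => h I _ hI (fun j => ?_) fun j => by simp
    refine Fin.cases ?_ (fun j => ?_) j
    · simpa using D.mem_W hi'
    · simpa [← hx] using hI j.succ
  have h2 : D.avg x' T' = D.avg x' (fun I => (fun I' : Fin n → ι =>
      T' (Fin.cons i' I')) fun j => I ((0 : Fin (n + 1)).succAbove j)) := by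
    refine D.avg_congr fun I hI => ?_
    have hv : ∀ j, x j ∈ (D.sec ((Fin.cons i (Fin.tail I) : Fin (n + 1) → ι) j)).W := by
      intro j
      refine Fin.cases ?_ (fun j => ?_) j
      · simpa using D.mem_W hi
      · simpa [hx, Fin.tail] using hI j.succ
    rw [← h _ I hv hI fun j => by simp [Fin.tail]]
    refine h _ _ hv (fun j => ?_) fun j => by simp [Fin.tail]
    refine Fin.cases ?_ (fun j => ?_) j
    · simpa using D.mem_W hi'
    · simpa using hI j.succ
  refine h1.trans (Eq.trans (D.avg_face 0 x fun I' => T' (Fin.cons i' I')) (Eq.trans ?_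
    ((D.avg_face 0 x' fun I' => T' (Fin.cons i' I')).symm.trans h2.symm)))
  congr 1
  funext j
  simpa using hx j

section Smooth

variable {E' : Type*} [NormedAddCommGroup E'] [NormedSpace ℝ E'] {H' : Type*} [TopologicalSpace H']
  {I' : ModelWithCorners ℝ E' H'} {Y : Type*} [TopologicalSpace Y] [ChartedSpace H' Y]
  {E : Type*} [NormedAddCommGroup E] [NormedSpace ℝ E]
  {X : Type*} [TopologicalSpace X] [ChartedSpace E X] [IsManifold 𝓘(ℝ, E) ∞ X]

/-- Near `y` the average is a finite sum. A summand is smooth if all its sections are defined, with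
smooth weights, at the points of `y`; otherwise one of its weights vanishes near the corresponding
point, and the summand is zero nearby. -/
theorem smoothAlong_avg {n : ℕ} {x : Y → Fin n → N} {f : Y → X} {T : (Fin n → ι) → Y → E}
    {S : Set Y} {y : Y} (hyS : y ∈ S)
    (hx : ∀ j, ContMDiffWithinAt I' 𝓘(ℝ, EN) ∞ (fun z => x z j) S y)
    (hf : ContMDiffWithinAt I' 𝓘(ℝ, E) ∞ f S y)
    (hT : ∀ I, (∀ j, x y j ∈ (D.sec (I j)).W) → SmoothAlong I' f (T I) S y) :
    SmoothAlong I' f (fun z => D.avg (x z) (fun I => T I z)) S y := by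
  classical
  obtain ⟨F, hF⟩ := D.exists_finset (x y)
  have h1 : ∀ᶠ z in 𝓝[S] y, ∀ j, ∀ i ∉ F, D.w i (x z j) = 0 :=
    Filter.eventually_all.2 fun j => (hx j).continuousWithinAt.eventually (hF j)
  have h2 : SmoothAlong I' f (fun z => ∑ I ∈ Fintype.piFinset (fun _ : Fin n => F),
      (∏ j, D.w (I j) (x z j)) • T I z) S y := by
    refine SmoothAlong.sum hf fun I _ => ?_
    by_cases hI : ∀ j, x y j ∈ (D.sec (I j)).W ∧
        ContMDiffAt 𝓘(ℝ, EN) 𝓘(ℝ, ℝ) ∞ (D.w (I j)) (x y j)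
    · refine (hT I fun j => (hI j).1).smul ?_
      exact contMDiffWithinAt_finsetProd fun j _ =>
        (hI j).2.comp_contMDiffWithinAt y (hx j)
    · push Not at hI
      obtain ⟨j, hj⟩ := hI
      have h3 : ∀ᶠ z in 𝓝 (x y j), D.w (I j) z = 0 :=
        (D.smooth (I j) (x y j)).resolve_left fun h => hj h.1 h.2
      refine (smoothAlong_zero hf).congr hyS (Filter.Eventually.of_forall fun _ => rfl) ?_
      filter_upwards [(hx j).continuousWithinAt.eventually h3] with z hz
      rw [Finset.prod_eq_zero (Finset.mem_univ j) hz, zero_smul]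
  refine h2.congr hyS (Filter.Eventually.of_forall fun _ => rfl) ?_
  filter_upwards [h1] with z hz using D.avg_eq_sum _ hz

end Smooth

/-- The composite family. -/
def comp {ι' : Type*} (D : Dist B ι) (D' : Dist B.op ι') : Dist (unitBundle 𝒢) (ι' × ι) where
  sec k := (D.sec k.2).comp (D'.sec k.1)
  w k x := D'.w k.1 x * D.w k.2 (B.β ((D'.sec k.1).σ x))
  locallyFinite x := by
    classical
    obtain ⟨F', hF'⟩ := D'.locallyFinite x
    have h : ∀ j : ι', ∃ F : Finset ι, ∀ᶠ y in 𝓝 x, ∀ i ∉ F,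
        D'.w j y * D.w i (B.β ((D'.sec j).σ y)) = 0 := by
      intro j
      rcases D'.smooth j x with h | h
      · obtain ⟨F, hF⟩ := D.locallyFinite (B.β ((D'.sec j).σ x))
        have hc : ContinuousAt (fun y => B.β ((D'.sec j).σ y)) x :=
          (B.isSubmersion_β.contMDiff.comp_contMDiffOn (D'.sec j).smooth_σ).continuousOn.continuousAt
            ((D'.sec j).isOpen.mem_nhds h.1)
        refine ⟨F, (hc.eventually hF).mono fun y hy i hi => ?_⟩
        rw [hy i hi, mul_zero]
      · exact ⟨∅, h.mono fun y hy i _ => by rw [hy, zero_mul]⟩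
    choose F hF using h
    refine ⟨F'.biUnion fun j => (F j).image fun i => (j, i), ?_⟩
    filter_upwards [hF', (Filter.eventually_all_finset F').2 fun j _ => hF j] with y h1 h2
    rintro ⟨j, i⟩ hk
    by_cases hj : j ∈ F'
    · refine h2 j hj i fun hi => hk ?_
      exact Finset.mem_biUnion.2 ⟨j, hj, Finset.mem_image.2 ⟨i, hi, rfl⟩⟩
    · change D'.w j y * _ = 0
      rw [h1 j hj, zero_mul]
  sum_eq_one x S hS := by
    classical
    obtain ⟨F', hF'⟩ := D'.locallyFinite x
    choose F hF using fun j => D.locallyFinite (B.β ((D'.sec j).σ x))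
    have hF' := hF'.self_of_nhds
    have hF := fun j => (hF j).self_of_nhds
    -- `S` is enlarged to a product, so that the two labels can be summed separately: first over the
    -- second label, which leaves the weight of the first.
    let U := F' ∪ S.image Prod.fst
    let U' := (U.biUnion F) ∪ S.image Prod.snd
    have h1 : S ⊆ U ×ˢ U' := by
      rintro ⟨j, i⟩ hk
      refine Finset.mem_product.2 ⟨Finset.mem_union_right _ ?_, Finset.mem_union_right _ ?_⟩
      · exact Finset.mem_image.2 ⟨_, hk, rfl⟩
      · exact Finset.mem_image.2 ⟨_, hk, rfl⟩
    rw [Finset.sum_subset h1 fun k _ hk => hS k hk, Finset.sum_product]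
    have h2 : ∀ j ∈ U, ∑ i ∈ U', D'.w j x * D.w i (B.β ((D'.sec j).σ x)) = D'.w j x := by
      intro j hj
      rw [← Finset.mul_sum, D.sum_eq_one, mul_one]
      intro i hi
      refine hF j i fun h => hi (Finset.mem_union_left _ ?_)
      exact Finset.mem_biUnion.2 ⟨j, hj, h⟩
    rw [Finset.sum_congr rfl h2]
    exact D'.sum_eq_one x U fun j hj => hF' j fun h => hj (Finset.mem_union_left _ h)
  smooth := by
    rintro ⟨j, i⟩ x
    rcases D'.smooth j x with ⟨h1, h2⟩ | h
    · have hs : ContMDiffAt 𝓘(ℝ, EM) 𝓘(ℝ, EN) ∞ (fun y => B.β ((D'.sec j).σ y)) x :=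
        (B.isSubmersion_β.contMDiff.comp_contMDiffOn (D'.sec j).smooth_σ).contMDiffAt
          ((D'.sec j).isOpen.mem_nhds h1)
      rcases D.smooth i (B.β ((D'.sec j).σ x)) with ⟨h3, h4⟩ | h3
      · exact Or.inl ⟨⟨h1, h3⟩, h2.mul (h4.comp x hs)⟩
      · refine Or.inr ((hs.continuousAt.eventually h3).mono fun y hy => ?_)
        change _ * D.w i _ = 0
        rw [hy, mul_zero]
    · refine Or.inr (h.mono fun y hy => ?_)
      change D'.w j y * _ = 0
      rw [hy, zero_mul]

/-- Fubini for finite sums: a labelling by pairs is a pair of labellings, and the composite weights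
are products. -/
theorem avg_comp {ι' : Type*} (D : Dist B ι) (D' : Dist B.op ι') {n : ℕ} (x : Fin n → M)
    (T : (Fin n → ι' × ι) → V) :
    (D.comp D').avg x T = D'.avg x (fun J => D.avg (fun j => B.β ((D'.sec (J j)).σ (x j)))
      fun I => T fun j => (J j, I j)) := by
  classical
  obtain ⟨F', hF'⟩ := D'.exists_finset' x
  choose F₀ hF₀ using fun j => D.exists_finset' fun l => B.β ((D'.sec j).σ (x l))
  let F := F'.biUnion F₀
  have hF : ∀ j ∈ F', ∀ l, ∀ i ∉ F, D.w i (B.β ((D'.sec j).σ (x l))) = 0 := fun j hj l i hi =>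
    hF₀ j l i fun h => hi (Finset.mem_biUnion.2 ⟨j, hj, h⟩)
  have hFF : ∀ l, ∀ k ∉ F' ×ˢ F, (D.comp D').w k (x l) = 0 := by
    rintro l ⟨j, i⟩ hk
    change D'.w j (x l) * D.w i _ = 0
    by_cases hj : j ∈ F'
    · rw [hF j hj l i fun hi => hk (Finset.mem_product.2 ⟨hj, hi⟩), mul_zero]
    · rw [hF' l j hj, zero_mul]
  rw [avg_eq_sum _ _ hFF, avg_eq_sum _ _ hF']
  have h1 : ∀ J ∈ Fintype.piFinset (fun _ : Fin n => F'), (∏ j, D'.w (J j) (x j)) •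
      D.avg (fun j => B.β ((D'.sec (J j)).σ (x j))) (fun I => T fun j => (J j, I j)) =
      ∑ I ∈ Fintype.piFinset (fun _ : Fin n => F), (∏ j, (D.comp D').w (J j, I j) (x j)) •
        T fun j => (J j, I j) := by
    intro J hJ
    rw [Fintype.mem_piFinset] at hJ
    rw [avg_eq_sum _ _ (F := F) fun j => hF _ (hJ j) j, Finset.smul_sum]
    refine Finset.sum_congr rfl fun I _ => ?_
    rw [smul_smul, ← Finset.prod_mul_distrib]
    rfl
  rw [Finset.sum_congr rfl h1, ← Finset.sum_product']
  refine Finset.sum_equiv (Equiv.arrowProdEquivProdArrow _ _ _) ?_ fun _ _ => rfl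
  intro K
  simp [Fintype.mem_piFinset, forall_and]

/-- A smooth partition of unity subordinate to the domains of local sections, one chosen through
each point of N. This is where the topological conditions on the base enter. -/
theorem exists_dist [FiniteDimensional ℝ EN] [T2Space N] [SecondCountableTopology N]
    (B : Bibundle 𝒢 ℋ EP P) : Nonempty (Dist B N) := by
  choose s hs using LSec.exists_mem B
  have : LocallyCompactSpace N := ChartedSpace.locallyCompactSpace EN N
  obtain ⟨ρ, hρ⟩ := SmoothPartitionOfUnity.exists_isSubordinate 𝓘(ℝ, EN) (isClosed_univ (X := N))
    (fun x => (s x).W) (fun x => (s x).isOpen) fun x _ => mem_iUnion.2 ⟨x, hs x⟩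
  refine ⟨⟨s, fun i => ρ i, fun x => ?_, fun x F hF => ?_, fun i x => ?_⟩⟩
  · obtain ⟨U, hU, hf⟩ := ρ.locallyFinite x
    refine ⟨hf.toFinset, ?_⟩
    filter_upwards [hU] with y hy i hi
    by_contra h
    exact hi (hf.mem_toFinset.2 ⟨y, h, hy⟩)
  · have h1 := ρ.sum_eq_one (mem_univ x)
    rwa [finsum_eq_sum_of_support_subset (s := F)] at h1
    intro i hi
    by_contra h
    exact hi (hF i h)
  · by_cases hx : x ∈ tsupport (ρ i)
    · exact Or.inl ⟨hρ i hx, (ρ i).contMDiff x⟩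
    · right
      have := (isClosed_tsupport (ρ i)).isOpen_compl.mem_nhds hx
      filter_upwards [this] with y hy
      exact image_eq_zero_of_notMem_tsupport hy

end Dist

end Bibundle

end LieGroupoid

/-! ### Strings of arrows as quotients of sequences, and the differential on them -/

namespace LieGroupoid

universe u u'

variable {EM : Type*} [NormedAddCommGroup EM] [NormedSpace ℝ EM]
  {M : Type u} [TopologicalSpace M] [ChartedSpace EM M] [IsManifold 𝓘(ℝ, EM) ∞ M]
  {EG : Type*} [NormedAddCommGroup EG] [NormedSpace ℝ EG]
  {G : Type u} [TopologicalSpace G] [ChartedSpace EG G] [IsManifold 𝓘(ℝ, EG) ∞ G]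

/-- The increasing sequence of natural numbers that skips `m`. -/
def skip (m i : ℕ) : ℕ := if i < m then i else i + 1

theorem skip_of_lt {m i : ℕ} (h : i < m) : skip m i = i := if_pos h

theorem skip_of_le {m i : ℕ} (h : m ≤ i) : skip m i = i + 1 := if_neg (not_lt.2 h)

theorem skip_zero (i : ℕ) : skip 0 i = i + 1 := rfl

theorem val_succAbove {n : ℕ} (m : Fin (n + 1)) (j : Fin n) : (m.succAbove j : ℕ) = skip m j := by
  rw [Fin.succAbove, skip]
  split_ifs with h1 h2 h2 <;> simp_all [Fin.lt_def]

variable (𝒢 : LieGroupoid EM M EG G)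

/-- The string of arrows `a 0 (a 1)⁻¹, …, a (n - 1) (a n)⁻¹`. -/
def str (n : ℕ) (a : ℕ → G) : Fin n → G := fun i => 𝒢.div (a i) (a (i + 1))

/-- The value of a cochain, without reference to the tangent spaces. -/
def ev {k : ℕ} (c : 𝒢.RawCochain (k + 1)) (g : Fin (k + 1) → G) : EG := c g

/-- The value of a cochain of degree zero, without reference to the tangent spaces. -/
def evUnit (c : 𝒢.RawCochain 0) (x : M) : EG := c x

/-- The base points of a string of arrows. -/
def vert {k : ℕ} (g : Fin (k + 1) → G) : Fin (k + 2) → M :=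
  Fin.cons (𝒢.tgt (g 0)) fun i => 𝒢.src (g i)

variable {𝒢}

theorem ext_ev {k : ℕ} {c c' : 𝒢.RawCochain (k + 1)} (h : ∀ g, 𝒢.ev c g = 𝒢.ev c' g) : c = c' :=
  funext h

theorem ext_evUnit {c c' : 𝒢.RawCochain 0} (h : ∀ x, 𝒢.evUnit c x = 𝒢.evUnit c' x) : c = c' :=
  funext h

theorem str_congr {n : ℕ} {a a' : ℕ → G} (h : ∀ i ≤ n, a i = a' i) : 𝒢.str n a = 𝒢.str n a' := by
  funext i
  rw [str, str, h i i.is_lt.le, h (i + 1) i.is_lt]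

theorem str_mem {k : ℕ} {a : ℕ → G} (ha : ∀ i j, 𝒢.src (a i) = 𝒢.src (a j)) :
    𝒢.str (k + 1) a ∈ 𝒢.composable k := by
  intro i
  change 𝒢.src (𝒢.div (a i) (a (i + 1))) = 𝒢.tgt (𝒢.div (a (i + 1)) (a (i + 1 + 1)))
  rw [𝒢.src_div (ha _ _), 𝒢.tgt_div (ha _ _)]

theorem vert_str {k : ℕ} {a : ℕ → G} (ha : ∀ i j, 𝒢.src (a i) = 𝒢.src (a j)) (j : Fin (k + 2)) :
    𝒢.vert (𝒢.str (k + 1) a) j = 𝒢.tgt (a j) := by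
  refine Fin.cases ?_ (fun j => ?_) j
  · exact 𝒢.tgt_div (ha _ _)
  · exact 𝒢.src_div (ha _ _)

theorem vert_of_mem {k : ℕ} {g : Fin (k + 1) → G} (hg : g ∈ 𝒢.composable k) (i : Fin (k + 1)) :
    𝒢.vert g i.castSucc = 𝒢.tgt (g i) := by
  refine Fin.cases rfl (fun i => ?_) i
  rw [← Fin.succ_castSucc]
  exact hg i

/-- Take for `a i` the product of the arrows from position `i` to the end, and a unit at position k
+ 1. Keeping the sequence constant from there on matches labels extended beyond the last one by
`clip`. -/
theorem exists_str {k : ℕ} {g : Fin (k + 1) → G} (hg : g ∈ 𝒢.composable k) :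
    ∃ a : ℕ → G, (∀ i j, 𝒢.src (a i) = 𝒢.src (a j)) ∧ (∀ j, k + 1 ≤ j → a j = a (k + 1)) ∧
      𝒢.str (k + 1) a = g := by
  induction k with
  | zero =>
    refine ⟨fun j => if j = 0 then g 0 else 𝒢.unit (𝒢.src (g 0)), ?_, ?_, ?_⟩
    · have h : ∀ i : ℕ, 𝒢.src (if i = 0 then g 0 else 𝒢.unit (𝒢.src (g 0))) = 𝒢.src (g 0) := by
        intro i
        split_ifs
        · rfl
        · rw [𝒢.src_unit]
      exact fun i j => (h i).trans (h j).symm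
    · intro j hj
      simp [show j ≠ 0 by omega]
    · funext i
      obtain rfl : i = 0 := Fin.ext (by omega)
      exact 𝒢.div_unit (g 0)
  | succ k ih =>
    obtain ⟨a, ha, hc, he⟩ := ih (g := Fin.tail g) fun i => hg i.succ
    have h0 : 𝒢.src (g 0) = 𝒢.tgt (a 0) := by
      have h1 : 𝒢.src (g 0) = 𝒢.tgt (g 1) := hg 0
      have h2 : 𝒢.div (a 0) (a 1) = g 1 := congrFun he 0
      rw [h1, ← h2, 𝒢.tgt_div (ha _ _)]
    have h : ∀ i : ℕ, 𝒢.src (i.casesOn (𝒢.mul (g 0) (a 0)) a : G) = 𝒢.src (a 0)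
      | 0 => 𝒢.src_mul _ _ h0
      | i + 1 => ha _ _
    refine ⟨fun i => i.casesOn (𝒢.mul (g 0) (a 0)) a, fun i j => (h i).trans (h j).symm, ?_, ?_⟩
    · rintro (_ | j) hj
      · omega
      · exact hc j (by omega)
    · funext i
      refine Fin.cases ?_ (fun i => ?_) i
      · exact 𝒢.mul_div h0
      · exact congrFun he i

theorem tail_str (n : ℕ) (a : ℕ → G) : Fin.tail (𝒢.str (n + 1) a) = 𝒢.str n (a ∘ skip 0) := rfl

/-- Composing two neighbours, (a_j a_{j+1}⁻¹)(a_{j+1} a_{j+2}⁻¹), means deleting a_{j+1}. With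
`tail_str` and `init_str`, all faces of a string become deletions of one term, as for simplices. -/
theorem contractNth_str {n : ℕ} {a : ℕ → G} (ha : ∀ i j, 𝒢.src (a i) = 𝒢.src (a j))
    (j : Fin (n + 1)) :
    Fin.contractNth j 𝒢.mul (𝒢.str (n + 1) a) = 𝒢.str n (a ∘ skip (j + 1)) := by
  funext i
  rcases lt_trichotomy (i : ℕ) j with h | h | h
  · rw [Fin.contractNth_apply_of_lt _ _ _ _ h]
    simp [str, skip, show (i : ℕ) < j + 1 by omega, h]
  · rw [Fin.contractNth_apply_of_eq _ _ _ _ h]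
    simpa [str, skip, h] using 𝒢.mul_div_div (ha _ _) (ha _ _)
  · rw [Fin.contractNth_apply_of_gt _ _ _ _ h]
    simp [str, skip, show ¬ (i : ℕ) < j + 1 by omega, show ¬ (i : ℕ) < j by omega]

theorem init_str (n : ℕ) (a : ℕ → G) : Fin.init (𝒢.str (n + 1) a) = 𝒢.str n (a ∘ skip (n + 1)) := by
  funext i
  simp [Fin.init, str, skip, show (i : ℕ) < n + 1 by omega]

variable (𝒢) in
/-- The differential of the source map, as a linear map. -/
def dsrcₗ (g : G) : EG →ₗ[ℝ] EM where
  toFun := 𝒢.dsrc g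
  map_add' := 𝒢.dsrc_add g
  map_smul' := 𝒢.dsrc_smul g

variable (𝒢) in
theorem ddiv_add (g h : G) (v v' w w' : EG) :
    𝒢.ddiv g h (v + v') (w + w') = 𝒢.ddiv g h v w + 𝒢.ddiv g h v' w' :=
  fderivPair_add _ _ _ _ _ _ _ _

variable (𝒢) in
theorem ddiv_smul (g h : G) (a : ℝ) (v w : EG) :
    𝒢.ddiv g h (a • v) (a • w) = a • 𝒢.ddiv g h v w :=
  fderivPair_smul _ _ _ _ _ _ _

variable (𝒢) in
/-- The alternating sum in the differential of a cochain on the string given by `a`, in terms of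
its values `φ m` on the faces. -/
def altSum (k : ℕ) (a : ℕ → G) : (ℕ → EG) →ₗ[ℝ] EG where
  toFun φ := -𝒢.ddiv (𝒢.div (a 0) (a 2)) (𝒢.div (a 1) (a 2)) (φ 1) (φ 0) +
    ∑ j ∈ Finset.range (k + 1), (-1 : ℝ) ^ j • φ (j + 2)
  map_add' φ ψ := by
    simp only [Pi.add_apply, ddiv_add, smul_add, Finset.sum_add_distrib]
    abel
  map_smul' r φ := by
    simp only [Pi.smul_apply, ddiv_smul, Finset.smul_sum, smul_add, smul_neg, RingHom.id_apply,
      smul_comm r]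

theorem altSum_apply (k : ℕ) (a : ℕ → G) (φ : ℕ → EG) : 𝒢.altSum k a φ =
    -𝒢.ddiv (𝒢.div (a 0) (a 2)) (𝒢.div (a 1) (a 2)) (φ 1) (φ 0) +
      ∑ j ∈ Finset.range (k + 1), (-1 : ℝ) ^ j • φ (j + 2) := rfl

theorem altSum_congr {k : ℕ} {a : ℕ → G} {φ ψ : ℕ → EG} (h : ∀ m ≤ k + 2, φ m = ψ m) :
    𝒢.altSum k a φ = 𝒢.altSum k a ψ := by
  rw [altSum_apply, altSum_apply, h 1 (by omega), h 0 (by omega),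
    Finset.sum_congr rfl fun j hj => by rw [h (j + 2) (by have := Finset.mem_range.1 hj; omega)]]

/-- In terms of sequences, δc depends linearly on the values on the faces that delete the term `m`.
Faces 1 and 0 enter together through division, the face m ≥ 2 with the sign (-1)^m. -/
theorem ev_d_str {k : ℕ} (c : 𝒢.RawCochain (k + 1)) {a : ℕ → G}
    (ha : ∀ i j, 𝒢.src (a i) = 𝒢.src (a j)) :
    𝒢.ev (𝒢.d (k + 1) c) (𝒢.str (k + 2) a) =
      𝒢.altSum k a fun m => 𝒢.ev c (𝒢.str (k + 1) (a ∘ skip m)) := by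
  have h0 := contractNth_str (n := k + 1) ha 0
  have hj : ∀ j : Fin k, Fin.contractNth j.succ.castSucc 𝒢.mul (𝒢.str (k + 2) a) =
      𝒢.str (k + 1) (a ∘ skip (j + 2)) := fun j => contractNth_str (n := k + 1) ha j.succ.castSucc
  have hl := init_str (𝒢 := 𝒢) (k + 1) a
  have e := 𝒢.dSucc_of_mem k c (str_mem (k := k + 1) ha)
  refine e.trans ?_
  rw [altSum_apply, Finset.sum_range_succ, ← add_assoc, Finset.sum_range
    fun j => (-1 : ℝ) ^ j • 𝒢.ev c (𝒢.str (k + 1) (a ∘ skip (j + 2)))]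
  refine congrArg₂ (fun x y : EG => x + y) (congrArg₂ (fun x y : EG => x + y)
    (congrArg (fun x : EG => -x) ?_) (Finset.sum_congr rfl fun j _ => ?_)) ?_
  · change 𝒢.ddiv (Fin.contractNth 0 𝒢.mul (𝒢.str (k + 2) a) 0) (𝒢.div (a 1) (a 2))
      (𝒢.ev c (Fin.contractNth 0 𝒢.mul (𝒢.str (k + 2) a)))
      (𝒢.ev c (𝒢.str (k + 1) (a ∘ skip 0))) = _
    rw [h0]
    rfl
  · change (-1 : ℝ) ^ ((j : ℕ) + 2) • 𝒢.ev c (Fin.contractNth j.succ.castSucc 𝒢.mul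
      (𝒢.str (k + 2) a)) = _
    rw [hj, pow_add, neg_one_sq, mul_one]
  · change (-1 : ℝ) ^ (k + 2) • 𝒢.ev c (Fin.init (𝒢.str (k + 2) a)) = _
    rw [hl, pow_add, neg_one_sq, mul_one]

theorem d_eq_zero_of_notMem {k : ℕ} (c : 𝒢.RawCochain (k + 1)) {g : Fin (k + 2) → G}
    (hg : g ∉ 𝒢.composable (k + 1)) : 𝒢.ev (𝒢.d (k + 1) c) g = 0 :=
  𝒢.dSucc_of_notMem k c hg

theorem tangentMap_src_eq_iff {g g' : G} (e : 𝒢.src g = 𝒢.src g') {v w : EG} :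
    tangentMap 𝓘(ℝ, EG) 𝓘(ℝ, EM) 𝒢.src (⟨g, v⟩ : TangentBundle 𝓘(ℝ, EG) G) =
      tangentMap 𝓘(ℝ, EG) 𝓘(ℝ, EM) 𝒢.src (⟨g', w⟩ : TangentBundle 𝓘(ℝ, EG) G) ↔
    𝒢.dsrc g v = 𝒢.dsrc g' w := by
  simp only [tangentMap, Bundle.TotalSpace.mk.injEq]
  exact ⟨fun h => eq_of_heq h.2, fun h => ⟨e, heq_of_eq h⟩⟩

theorem isCochain_iff {k : ℕ} {c : 𝒢.RawCochain (k + 1)} : 𝒢.IsCochain c ↔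
    (∀ g ∉ 𝒢.composable k, 𝒢.ev c g = 0) ∧
    (∀ g ∈ 𝒢.composable k, SmoothAlong (ModelWithCorners.pi fun _ : Fin (k + 1) => 𝓘(ℝ, EG))
      (fun g : Fin (k + 1) → G => g 0) (𝒢.ev c) (𝒢.composable k) g) ∧
    (∀ g ∈ 𝒢.composable k, ∀ g' ∈ 𝒢.composable k, 𝒢.src (g 0) = 𝒢.src (g' 0) →
      Fin.tail g = Fin.tail g' → 𝒢.dsrc (g 0) (𝒢.ev c g) = 𝒢.dsrc (g' 0) (𝒢.ev c g')) := by
  refine ⟨fun h => ⟨h.support, h.smooth, fun g hg g' hg' e e' => ?_⟩, fun h => ⟨h.1, h.2.1,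
    fun g hg g' hg' e e' => ?_⟩⟩
  · exact (tangentMap_src_eq_iff e).1 (h.projectable g hg g' hg' e e')
  · exact (tangentMap_src_eq_iff e).2 (h.2.2 g hg g' hg' e e')

/-- Projectability, in terms of the sequences that define strings. -/
theorem IsCochain.dsrc_eq {k : ℕ} {c : 𝒢.RawCochain (k + 1)} (hc : 𝒢.IsCochain c) {a a' : ℕ → G}
    (ha : ∀ i j, 𝒢.src (a i) = 𝒢.src (a j)) (ha' : ∀ i j, 𝒢.src (a' i) = 𝒢.src (a' j))
    (h : ∀ i, 1 ≤ i → i ≤ k + 1 → a i = a' i) :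
    𝒢.dsrc (𝒢.div (a 0) (a 1)) (𝒢.ev c (𝒢.str (k + 1) a)) =
      𝒢.dsrc (𝒢.div (a' 0) (a' 1)) (𝒢.ev c (𝒢.str (k + 1) a')) := by
  refine (isCochain_iff.1 hc).2.2 _ (str_mem ha) _ (str_mem ha') ?_ ?_
  · change 𝒢.src (𝒢.div (a 0) (a 1)) = 𝒢.src (𝒢.div (a' 0) (a' 1))
    rw [𝒢.src_div (ha _ _), 𝒢.src_div (ha' _ _), h 1 le_rfl (by omega)]
  · rw [tail_str, tail_str]
    exact str_congr fun i hi => h _ (by simp [skip_zero]) (by simpa [skip_zero] using hi)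

end LieGroupoid

/-! ### Pulling back cochains and compatibility with the differential -/

namespace LieGroupoid

universe u u'

variable {EM : Type*} [NormedAddCommGroup EM] [NormedSpace ℝ EM]
  {M : Type u} [TopologicalSpace M] [ChartedSpace EM M] [IsManifold 𝓘(ℝ, EM) ∞ M]
  {EG : Type*} [NormedAddCommGroup EG] [NormedSpace ℝ EG]
  {G : Type u} [TopologicalSpace G] [ChartedSpace EG G] [IsManifold 𝓘(ℝ, EG) ∞ G]
  {EN : Type*} [NormedAddCommGroup EN] [NormedSpace ℝ EN]
  {N : Type u'} [TopologicalSpace N] [ChartedSpace EN N] [IsManifold 𝓘(ℝ, EN) ∞ N]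
  {EH : Type*} [NormedAddCommGroup EH] [NormedSpace ℝ EH]
  {H : Type u'} [TopologicalSpace H] [ChartedSpace EH H] [IsManifold 𝓘(ℝ, EH) ∞ H]

namespace Bibundle

variable {𝒢 : LieGroupoid EM M EG G} {ℋ : LieGroupoid EN N EH H}
  {EP : Type*} [NormedAddCommGroup EP] [NormedSpace ℝ EP]
  {P : Type*} [TopologicalSpace P] [ChartedSpace EP P] [IsManifold 𝓘(ℝ, EP) ∞ P]
  {B : Bibundle 𝒢 ℋ EP P}

namespace LSec

/-- The value at the string `h` of the cochain obtained from `c` by conjugation with the local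
sections `J`. -/
def pull {k : ℕ} (J : ℕ → LSec B) (c : 𝒢.RawCochain (k + 1)) (h : Fin (k + 1) → H) : EH :=
  dconj (J 0) (J 1) (h 0) (𝒢.ev c fun i => conj (J i) (J (i + 1)) (h i))

theorem pull_congr {k : ℕ} {J J' : ℕ → LSec B} (e : ∀ i ≤ k + 1, J i = J' i)
    (c : 𝒢.RawCochain (k + 1)) (h : Fin (k + 1) → H) : pull J c h = pull J' c h := by
  rw [pull, pull, e 0 (by omega), e 1 (by omega)]
  congr 2
  funext i
  rw [e i (by omega), e (i + 1) (by omega)]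

theorem mem_of_vert {k : ℕ} {J : ℕ → LSec B} {h : Fin (k + 1) → H} (hh : h ∈ ℋ.composable k)
    (hJ : ∀ j : Fin (k + 2), ℋ.vert h j ∈ (J j).W) (i : Fin (k + 1)) :
    ℋ.tgt (h i) ∈ (J i).W ∧ ℋ.src (h i) ∈ (J (i + 1)).W :=
  ⟨by rw [← vert_of_mem hh i]; exact hJ i.castSucc, hJ i.succ⟩

theorem conj_mem {k : ℕ} {J : ℕ → LSec B} {h : Fin (k + 1) → H} (hh : h ∈ ℋ.composable k)
    (hJ : ∀ j : Fin (k + 2), ℋ.vert h j ∈ (J j).W) :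
    (fun i : Fin (k + 1) => conj (J i) (J (i + 1)) (h i)) ∈ 𝒢.composable k := by
  intro i
  have h1 := mem_of_vert hh hJ i.castSucc
  have h2 := mem_of_vert hh hJ i.succ
  rw [src_conj h1.1 h1.2, tgt_conj h2.1 h2.2, hh i]
  rfl

/-- Conjugating the sequence itself needs a section at the common source. An auxiliary one is chosen
there, and it cancels in the quotients. -/
theorem exists_conj_str {J : ℕ → LSec B} {a : ℕ → H} (ha : ∀ i j, ℋ.src (a i) = ℋ.src (a j))
    (hJ : ∀ j, ℋ.tgt (a j) ∈ (J j).W) :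
    ∃ a' : ℕ → G, (∀ i j, 𝒢.src (a' i) = 𝒢.src (a' j)) ∧
      ∀ i j, conj (J i) (J j) (ℋ.div (a i) (a j)) = 𝒢.div (a' i) (a' j) := by
  obtain ⟨b, hb⟩ := exists_mem B (ℋ.src (a 0))
  have hb' : ∀ i, ℋ.src (a i) ∈ b.W := fun i => ha i 0 ▸ hb
  refine ⟨fun i => conj (J i) b (a i), fun i j => ?_, fun i j =>
    conj_div (ha i j) (hJ i) (hJ j) (hb' j)⟩
  rw [src_conj (hJ i) (hb' i), src_conj (hJ j) (hb' j), ha i j]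

/-- Apply the linear map `dconj` at the first arrow to δc. The faces m ≥ 2 keep the first arrow and
its labels, so they transform by that same map; the pair of faces 1 and 0 transforms by
`dconj_ddiv`, whose hypothesis on ds is the projectability of `c`. -/
theorem pull_d {k : ℕ} {J : ℕ → LSec B} {a : ℕ → H} (ha : ∀ i j, ℋ.src (a i) = ℋ.src (a j))
    (hJ : ∀ j, ℋ.tgt (a j) ∈ (J j).W) {c : 𝒢.RawCochain (k + 1)} (hc : 𝒢.IsCochain c) :
    pull J (𝒢.d (k + 1) c) (ℋ.str (k + 2) a) =
      ℋ.altSum k a fun m => pull (J ∘ skip m) c (ℋ.str (k + 1) (a ∘ skip m)) := by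
  obtain ⟨a', ha', hc'⟩ := exists_conj_str ha hJ
  have h1 : ∀ m, pull (J ∘ skip m) c (ℋ.str (k + 1) (a ∘ skip m)) =
      dconj (J (skip m 0)) (J (skip m 1)) (ℋ.div (a (skip m 0)) (a (skip m 1)))
        (𝒢.ev c (𝒢.str (k + 1) (a' ∘ skip m))) := by
    intro m
    rw [pull]
    congr 2
    funext i
    exact hc' _ _
  have h2 : pull J (𝒢.d (k + 1) c) (ℋ.str (k + 2) a) =
      dconjₗ (J 0) (J 1) (ℋ.div (a 0) (a 1)) (𝒢.altSum k a' fun m =>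
        𝒢.ev c (𝒢.str (k + 1) (a' ∘ skip m))) := by
    rw [← ev_d_str c ha', pull]
    congr 2
    funext i
    exact hc' _ _
  rw [h2, altSum_apply, altSum_apply, map_add, map_neg, map_sum]
  congr 2
  · rw [h1, h1]
    have h3 := dconj_ddiv (v := 𝒢.ev c (𝒢.str (k + 1) (a' ∘ skip 1)))
      (w := 𝒢.ev c (𝒢.str (k + 1) (a' ∘ skip 0))) (h := ℋ.div (a 0) (a 2)) (h' := ℋ.div (a 1) (a 2))
      (s := J 0) (s' := J 1) (s'' := J 2)
      (by rw [ℋ.src_div (ha _ _), ℋ.src_div (ha _ _)])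
      (by rw [ℋ.tgt_div (ha _ _)]; exact hJ 0) (by rw [ℋ.tgt_div (ha _ _)]; exact hJ 1)
      (by rw [ℋ.src_div (ha _ _)]; exact hJ 2) (by
        rw [hc', hc']
        refine hc.dsrc_eq (a := a' ∘ skip 1) (a' := a' ∘ skip 0) (fun i j => ha' _ _)
          (fun i j => ha' _ _) fun i hi _ => ?_
        rw [Function.comp_apply, Function.comp_apply, skip_of_le hi, skip_zero])
    rw [ℋ.div_div_div (ha _ _) (ha _ _), hc', hc'] at h3
    exact h3
  · funext j
    rw [map_smul, h1]
    rfl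

/-- The value at `x` of the section of the algebroid obtained from `c` by conjugation. -/
def pullUnit (s : LSec B) (c : 𝒢.RawCochain 0) (x : N) : EH :=
  dconj s s (ℋ.unit x) (𝒢.evUnit c (B.α (s.σ x)))

end LSec

end Bibundle

section Zero

variable (𝒢 : LieGroupoid EM M EG G)

/-- The differential in degree zero at an arrow, in terms of the values at its ends. -/
def dz (g : G) : EG × EG →ₗ[ℝ] EG where
  toFun p := 𝒢.ddiv g (𝒢.unit (𝒢.src g)) (𝒢.dmul (𝒢.unit (𝒢.tgt g)) g p.1 0) p.2
  map_add' p q := by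
    have h := fderivPair_add (F := EG) (fun p : G × G => 𝒢.mul p.1 p.2)
      {p | 𝒢.src p.1 = 𝒢.tgt p.2} (𝒢.unit (𝒢.tgt g)) g p.1 q.1 (0 : EG) (0 : EG)
    rw [add_zero (0 : EG)] at h
    rw [← ddiv_add]
    exact congrArg (fun v => 𝒢.ddiv g (𝒢.unit (𝒢.src g)) v (p.2 + q.2)) h
  map_smul' r p := by
    have h := fderivPair_smul (F := EG) (fun p : G × G => 𝒢.mul p.1 p.2)
      {p | 𝒢.src p.1 = 𝒢.tgt p.2} (𝒢.unit (𝒢.tgt g)) g r p.1 (0 : EG)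
    rw [smul_zero (A := EG)] at h
    rw [RingHom.id_apply, ← ddiv_smul]
    exact congrArg (fun v => 𝒢.ddiv g (𝒢.unit (𝒢.src g)) v (r • p.2)) h

theorem dz_apply (g : G) (a b : EG) :
    𝒢.dz g (a, b) = 𝒢.ddiv g (𝒢.unit (𝒢.src g)) (𝒢.dmul (𝒢.unit (𝒢.tgt g)) g a 0) b := rfl

variable {𝒢}

theorem IsAlgebroidSection.dsrc_eq_zero {c : 𝒢.RawCochain 0} (hc : 𝒢.IsAlgebroidSection c) (x : M) :
    𝒢.dsrc (𝒢.unit x) (𝒢.evUnit c x) = 0 := hc.vertical x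

theorem ev_d_zero {c : 𝒢.RawCochain 0} (hc : ∀ x, 𝒢.dsrc (𝒢.unit x) (𝒢.evUnit c x) = 0)
    (g : Fin 1 → G) : 𝒢.ev (𝒢.d 0 c) g = 𝒢.dz (g 0) (𝒢.evUnit c (𝒢.tgt (g 0)), 𝒢.evUnit c (𝒢.src (g 0))) :=
  (𝒢.ddiv_eq_dRight_add_dLeft (g 0) (hc _) (hc _)).symm

end Zero

namespace Bibundle

variable {𝒢 : LieGroupoid EM M EG G} {ℋ : LieGroupoid EN N EH H}
  {EP : Type*} [NormedAddCommGroup EP] [NormedSpace ℝ EP]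
  {P : Type*} [TopologicalSpace P] [ChartedSpace EP P] [IsManifold 𝓘(ℝ, EP) ∞ P]
  {B : Bibundle 𝒢 ℋ EP P}

namespace LSec

theorem dsrc_pullUnit {s : LSec B} {c : 𝒢.RawCochain 0} (hc : ∀ x, 𝒢.dsrc (𝒢.unit x) (𝒢.evUnit c x) = 0)
    {x : N} (hx : x ∈ s.W) : ℋ.dsrc (ℋ.unit x) (pullUnit s c x) = 0 := by
  rw [pullUnit, dsrc_dconj (by rwa [ℋ.tgt_unit]) (by rwa [ℋ.src_unit]), conj_unit hx, hc, map_zero]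
  exact map_zero (mfderiv 𝓘(ℝ, EP) 𝓘(ℝ, EN) B.β _)

/-- The differential has been written as a division of a right translate by a value at a unit. So
`dconj_ddiv`, with a unit as second arrow, and `dconj_dmul` suffice. -/
theorem pull_d_zero {J : ℕ → LSec B} {h : Fin 1 → H} (h0 : ℋ.tgt (h 0) ∈ (J 0).W)
    (h1 : ℋ.src (h 0) ∈ (J 1).W) {c : 𝒢.RawCochain 0} (hc : ∀ x, 𝒢.dsrc (𝒢.unit x) (𝒢.evUnit c x) = 0) :
    pull J (𝒢.d 0 c) h = ℋ.dz (h 0) (pullUnit (J 0) c (ℋ.tgt (h 0)),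
      pullUnit (J 1) c (ℋ.src (h 0))) := by
  have ht := ℋ.tgt_unit (ℋ.src (h 0))
  have hs := ℋ.src_unit (ℋ.src (h 0))
  have e1 := tgt_conj h0 h1
  have e2 := src_conj h0 h1
  rw [pull, ev_d_zero hc, dz_apply]
  change dconj (J 0) (J 1) (h 0) (𝒢.ddiv (conj (J 0) (J 1) (h 0))
    (𝒢.unit (𝒢.src (conj (J 0) (J 1) (h 0)))) (𝒢.dmul (𝒢.unit (𝒢.tgt (conj (J 0) (J 1) (h 0))))
      (conj (J 0) (J 1) (h 0)) (𝒢.evUnit c (𝒢.tgt (conj (J 0) (J 1) (h 0)))) 0)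
      (𝒢.evUnit c (𝒢.src (conj (J 0) (J 1) (h 0))))) = _
  rw [e1, e2, dz_apply]
  have h3 := dconj_ddiv (h := h 0) (h' := ℋ.unit (ℋ.src (h 0))) (s := J 0) (s' := J 1) (s'' := J 1)
    (v := 𝒢.dmul (𝒢.unit (B.α ((J 0).σ (ℋ.tgt (h 0))))) (conj (J 0) (J 1) (h 0))
      (𝒢.evUnit c (B.α ((J 0).σ (ℋ.tgt (h 0))))) 0) (w := 𝒢.evUnit c (B.α ((J 1).σ (ℋ.src (h 0)))))
    hs.symm h0 (by rwa [ht]) (by rwa [hs]) (by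
      rw [conj_unit h1, hc, 𝒢.dsrc_dmul_zero e1.symm (hc _)])
  rw [conj_unit h1, ℋ.div_unit, dconj_dmul h0 h1 rfl (hc _)] at h3
  exact h3

end LSec

/-- Extension of a finite family of labels to a sequence. -/
def clip (n i : ℕ) : Fin (n + 1) := ⟨min i n, by omega⟩

theorem clip_coe {n : ℕ} (j : Fin (n + 1)) : clip n j = j := Fin.ext (min_eq_left (by omega))

namespace Dist

open LSec

variable {ι : Type*} (D : Dist B ι) {V : Type*} [AddCommGroup V] [Module ℝ V]

/-- The sequence of local sections given by a family of labels. -/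
def lab {n : ℕ} (I : Fin (n + 1) → ι) (i : ℕ) : LSec B := D.sec (I (clip n i))

theorem avg_apply {n : ℕ} {κ : Type*} (x : Fin n → N) (T : (Fin n → ι) → κ → V) (k : κ) :
    D.avg x T k = D.avg x (fun I => T I k) :=
  D.map_avg x T (LinearMap.proj (R := ℝ) (φ := fun _ : κ => V) k)

theorem lab_coe {n : ℕ} (I : Fin (n + 1) → ι) (j : Fin (n + 1)) : D.lab I j = D.sec (I j) := by
  rw [lab, clip_coe]

theorem lab_face {n : ℕ} (I : Fin (n + 2) → ι) (m : Fin (n + 2)) {j : ℕ} (hj : j ≤ n) :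
    D.lab (fun j => I (m.succAbove j)) j = D.lab I (skip m j) := by
  have h := val_succAbove m ⟨j, by omega⟩
  have h1 : clip n j = ⟨j, by omega⟩ := clip_coe (n := n) ⟨j, by omega⟩
  rw [lab, h1, show skip m j = (m.succAbove ⟨j, by omega⟩ : ℕ) from h.symm, lab_coe]

/-- Averages belonging to different faces become averages over the labellings of one and the same
string, so that the alternating sum can be taken under the average. -/
theorem avg_vert_face {k : ℕ} {a : ℕ → H} (ha : ∀ i j, ℋ.src (a i) = ℋ.src (a j)) {m : ℕ}
    (hm : m ≤ k + 2) (T : (ℕ → LSec B) → V)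
    (hT : ∀ J J' : ℕ → LSec B, (∀ j ≤ k + 1, J j = J' j) → T J = T J') :
    D.avg (ℋ.vert (ℋ.str (k + 1) (a ∘ skip m))) (fun I => T (D.lab I)) =
      D.avg (ℋ.vert (ℋ.str (k + 2) a)) (fun I => T (D.lab I ∘ skip m)) := by
  let m' : Fin (k + 3) := ⟨m, by omega⟩
  have h1 := D.avg_face m' (ℋ.vert (ℋ.str (k + 2) a)) fun I => T (D.lab I)
  have h2 : (fun j => ℋ.vert (ℋ.str (k + 2) a) (m'.succAbove j)) =
      ℋ.vert (ℋ.str (k + 1) (a ∘ skip m)) := by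
    funext j
    rw [vert_str (a := a ∘ skip m) fun i j => ha _ _]
    refine (vert_str (k := k + 1) ha _).trans ?_
    rw [val_succAbove]
    rfl
  rw [h2] at h1
  rw [← h1]
  exact D.avg_congr fun I _ => hT _ _ fun j hj => D.lab_face I m' hj

theorem mem_lab {k : ℕ} {a : ℕ → H} (ha : ∀ i j, ℋ.src (a i) = ℋ.src (a j))
    (ha' : ∀ j, k + 1 ≤ j → a j = a (k + 1)) {I : Fin (k + 2) → ι}
    (hI : ∀ j, ℋ.vert (ℋ.str (k + 1) a) j ∈ (D.sec (I j)).W) (j : ℕ) :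
    ℋ.tgt (a j) ∈ (D.lab I j).W := by
  have h := hI (clip (k + 1) j)
  rw [vert_str ha] at h
  have h1 : a (clip (k + 1) j) = a j := by
    rcases le_total j (k + 1) with hj | hj
    · simp [clip, hj]
    · simp [clip, hj, ha' j hj]
  rwa [h1] at h

open scoped Classical in
/-- Transport of cochains along a bibundle, in positive degrees. -/
def mapSucc (k : ℕ) (c : 𝒢.RawCochain (k + 1)) : ℋ.RawCochain (k + 1) :=
  fun h : Fin (k + 1) → H =>
    if h ∈ ℋ.composable k then D.avg (V := EH) (ℋ.vert h) (fun I => pull (D.lab I) c h)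
    else (0 : EH)

/-- Transport of cochains along a bibundle, in degree zero. -/
def mapZero (c : 𝒢.RawCochain 0) : ℋ.RawCochain 0 :=
  fun x : N => D.avg (V := EH) (fun _ : Fin 1 => x) (fun I => pullUnit (D.sec (I 0)) c x)

theorem ev_mapSucc {k : ℕ} (c : 𝒢.RawCochain (k + 1)) {h : Fin (k + 1) → H}
    (hh : h ∈ ℋ.composable k) :
    ℋ.ev (D.mapSucc k c) h = D.avg (ℋ.vert h) (fun I => pull (D.lab I) c h) := if_pos hh

theorem ev_mapSucc_of_notMem {k : ℕ} (c : 𝒢.RawCochain (k + 1)) {h : Fin (k + 1) → H}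
    (hh : h ∉ ℋ.composable k) : ℋ.ev (D.mapSucc k c) h = 0 := if_neg hh

theorem d_mapSucc {k : ℕ} {c : 𝒢.RawCochain (k + 1)} (hc : 𝒢.IsCochain c) :
    ℋ.d (k + 1) (D.mapSucc k c) = D.mapSucc (k + 1) (𝒢.d (k + 1) c) := by
  refine ext_ev fun h => ?_
  by_cases hh : h ∈ ℋ.composable (k + 1)
  · rw [ev_mapSucc _ _ hh]
    obtain ⟨a, ha, ha', rfl⟩ := exists_str hh
    rw [ev_d_str _ ha]
    -- All faces form one function of the labelling with values in sequences. `altSum`, being linear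
    -- on sequences, then commutes with the average.
    let T : (Fin (k + 3) → ι) → ℕ → EH := fun I m =>
      pull (D.lab I ∘ skip m) c (ℋ.str (k + 1) (a ∘ skip m))
    have h1 : ∀ m ≤ k + 2, ℋ.ev (D.mapSucc k c) (ℋ.str (k + 1) (a ∘ skip m)) =
        D.avg (ℋ.vert (ℋ.str (k + 2) a)) T m := by
      intro m hm
      rw [ev_mapSucc _ _ (str_mem (a := a ∘ skip m) fun i j => ha _ _)]
      refine (D.avg_vert_face ha hm (fun J => pull J c (ℋ.str (k + 1) (a ∘ skip m)))
        fun J J' e => pull_congr e _ _).trans ?_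
      exact (D.avg_apply _ T m).symm
    rw [altSum_congr h1]
    refine (D.map_avg _ _ _).trans ?_
    exact D.avg_congr fun I hI => (pull_d ha (D.mem_lab ha ha' hI) hc).symm
  · rw [ev_mapSucc_of_notMem _ _ hh, d_eq_zero_of_notMem _ hh]

theorem avg_pair (h : Fin 1 → H) (T T' : LSec B → EH) :
    ((D.avg (fun _ : Fin 1 => ℋ.tgt (h 0)) (fun I => T (D.sec (I 0))),
      D.avg (fun _ : Fin 1 => ℋ.src (h 0)) (fun I => T' (D.sec (I 0)))) : EH × EH) =
      D.avg (ℋ.vert h) fun I => (T (D.sec (I 0)), T' (D.sec (I 1))) := by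
  have h0 := D.avg_face 1 (ℋ.vert h) fun I => T (D.sec (I 0))
  have h1 := D.avg_face 0 (ℋ.vert h) fun I => T' (D.sec (I 0))
  have e0 : (fun j : Fin 1 => ℋ.vert h (Fin.succAbove 1 j)) = fun _ => ℋ.tgt (h 0) := by
    funext j
    obtain rfl : j = 0 := Subsingleton.elim _ _
    rfl
  have e1 : (fun j : Fin 1 => ℋ.vert h (Fin.succAbove 0 j)) = fun _ => ℋ.src (h 0) := by
    funext j
    obtain rfl : j = 0 := Subsingleton.elim _ _
    rfl
  rw [e0] at h0
  rw [e1] at h1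
  refine Prod.ext ?_ ?_
  · exact h0.symm.trans (D.map_avg (ℋ.vert h) (fun I => (T (D.sec (I 0)), T' (D.sec (I 1))))
      (LinearMap.fst ℝ EH EH)).symm
  · exact h1.symm.trans (D.map_avg (ℋ.vert h) (fun I => (T (D.sec (I 0)), T' (D.sec (I 1))))
      (LinearMap.snd ℝ EH EH)).symm

theorem dsrc_mapZero {c : 𝒢.RawCochain 0} (hc : ∀ x, 𝒢.dsrc (𝒢.unit x) (𝒢.evUnit c x) = 0) (x : N) :
    ℋ.dsrc (ℋ.unit x) (ℋ.evUnit (D.mapZero c) x) = 0 := by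
  refine (D.map_avg _ _ (ℋ.dsrcₗ (ℋ.unit x))).trans ?_
  refine (D.avg_congr fun I hI => ?_).trans (D.avg_const _ 0)
  exact dsrc_pullUnit hc (hI 0)

theorem d_mapZero {c : 𝒢.RawCochain 0} (hc : ∀ x, 𝒢.dsrc (𝒢.unit x) (𝒢.evUnit c x) = 0) :
    ℋ.d 0 (D.mapZero c) = D.mapSucc 0 (𝒢.d 0 c) := by
  refine ext_ev fun h => ?_
  have hh : h ∈ ℋ.composable 0 := fun i => i.elim0
  rw [ev_mapSucc _ _ hh, ev_d_zero (D.dsrc_mapZero hc)]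
  let T : (Fin 2 → ι) → EH × EH := fun I => (pullUnit (D.sec (I 0)) c (ℋ.tgt (h 0)),
    pullUnit (D.sec (I 1)) c (ℋ.src (h 0)))
  have h2 : ((ℋ.evUnit (D.mapZero c) (ℋ.tgt (h 0)), ℋ.evUnit (D.mapZero c) (ℋ.src (h 0))) : EH × EH) =
      D.avg (ℋ.vert h) T :=
    D.avg_pair h (fun s => pullUnit s c (ℋ.tgt (h 0))) fun s => pullUnit s c (ℋ.src (h 0))
  rw [h2, D.map_avg]
  refine D.avg_congr fun I hI => ?_
  have m0 := hI 0
  have m1 := hI 1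
  rw [← D.lab_coe] at m0 m1
  exact (pull_d_zero (J := D.lab I) m0 m1 hc).symm

end Dist

end Bibundle

end LieGroupoid

/-! ### Transport along bibundles: smoothness, projectability, functoriality -/

namespace LieGroupoid

universe u u'

variable {EM : Type*} [NormedAddCommGroup EM] [NormedSpace ℝ EM]
  {M : Type u} [TopologicalSpace M] [ChartedSpace EM M] [IsManifold 𝓘(ℝ, EM) ∞ M]
  {EG : Type*} [NormedAddCommGroup EG] [NormedSpace ℝ EG]
  {G : Type u} [TopologicalSpace G] [ChartedSpace EG G] [IsManifold 𝓘(ℝ, EG) ∞ G]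
  {EN : Type*} [NormedAddCommGroup EN] [NormedSpace ℝ EN]
  {N : Type u'} [TopologicalSpace N] [ChartedSpace EN N] [IsManifold 𝓘(ℝ, EN) ∞ N]
  {EH : Type*} [NormedAddCommGroup EH] [NormedSpace ℝ EH]
  {H : Type u'} [TopologicalSpace H] [ChartedSpace EH H] [IsManifold 𝓘(ℝ, EH) ∞ H]

namespace Bibundle

variable {𝒢 : LieGroupoid EM M EG G} {ℋ : LieGroupoid EN N EH H}
  {EP : Type*} [NormedAddCommGroup EP] [NormedSpace ℝ EP]
  {P : Type*} [TopologicalSpace P] [ChartedSpace EP P] [IsManifold 𝓘(ℝ, EP) ∞ P]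
  {B : Bibundle 𝒢 ℋ EP P}

theorem _root_.LieGroupoid.IsCochain.comp_smooth {k : ℕ} {c : 𝒢.RawCochain (k + 1)}
    (hc : 𝒢.IsCochain c) {E' : Type*} [NormedAddCommGroup E'] [NormedSpace ℝ E'] {H' : Type*}
    [TopologicalSpace H'] {I' : ModelWithCorners ℝ E' H'} {Y : Type*} [TopologicalSpace Y]
    [ChartedSpace H' Y] {f : Y → Fin (k + 1) → G} {S : Set Y} {y : Y} (hyS : y ∈ S)
    (hf : ∀ i, ContMDiffWithinAt I' 𝓘(ℝ, EG) ∞ (fun z => f z i) S y)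
    (h : ∀ᶠ z in 𝓝[S] y, f z ∈ 𝒢.composable k) :
    SmoothAlong I' (fun z => f z 0) (fun z => 𝒢.ev c (f z)) S y :=
  hc.smooth.comp_within (contMDiffWithinAt_pi_of_forall hf) hyS h

theorem _root_.LieGroupoid.contMDiff_vert {k : ℕ} (j : Fin (k + 2)) :
    ContMDiff (ModelWithCorners.pi fun _ : Fin (k + 1) => 𝓘(ℝ, EG)) 𝓘(ℝ, EM) ∞
      (fun g : Fin (k + 1) → G => 𝒢.vert g j) := by
  refine Fin.cases ?_ (fun j => ?_) j
  · exact 𝒢.isSubmersion_tgt.contMDiff.comp (contMDiff_eval_pi 0)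
  · exact 𝒢.isSubmersion_src.contMDiff.comp (contMDiff_eval_pi j)

theorem _root_.LieGroupoid.vert_succ_eq {k : ℕ} {g g' : Fin (k + 1) → G}
    (e : 𝒢.src (g 0) = 𝒢.src (g' 0)) (e' : Fin.tail g = Fin.tail g') (j : Fin (k + 1)) :
    𝒢.vert g j.succ = 𝒢.vert g' j.succ := by
  refine Fin.cases e (fun j => ?_) j
  exact congrArg 𝒢.src (congrFun e' j)

namespace LSec

theorem smoothAlong_pull {k : ℕ} {c : 𝒢.RawCochain (k + 1)} (hc : 𝒢.IsCochain c)
    {J : ℕ → LSec B} {h : Fin (k + 1) → H} (hh : h ∈ ℋ.composable k)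
    (hJ : ∀ j : Fin (k + 2), ℋ.vert h j ∈ (J j).W) :
    SmoothAlong (ModelWithCorners.pi fun _ : Fin (k + 1) => 𝓘(ℝ, EH))
      (fun h : Fin (k + 1) → H => h 0) (pull J c) (ℋ.composable k) h := by
  have m := mem_of_vert hh hJ
  refine smoothAlong_dconj hh (contMDiff_eval_pi 0).contMDiffAt.contMDiffWithinAt (m 0).1 (m 0).2 ?_
  refine hc.comp_smooth (f := fun h i => conj (J i) (J (i + 1)) (h i)) hh (fun i =>
    contMDiffWithinAt_conj hh (contMDiff_eval_pi i).contMDiffAt.contMDiffWithinAt (m i).1 (m i).2) ?_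
  have h1 : ∀ᶠ z in 𝓝[ℋ.composable k] h, ∀ j : Fin (k + 2), ℋ.vert z j ∈ (J j).W :=
    Filter.eventually_all.2 fun j => (contMDiff_vert j).continuous.continuousWithinAt.eventually_mem
      ((J j).isOpen.mem_nhds (hJ j))
  filter_upwards [h1, self_mem_nhdsWithin] with z hz hz' using conj_mem hz' hz

theorem dsrc_pull {k : ℕ} {J : ℕ → LSec B} {h : Fin (k + 1) → H} (hh : h ∈ ℋ.composable k)
    (hJ : ∀ j : Fin (k + 2), ℋ.vert h j ∈ (J j).W) (c : 𝒢.RawCochain (k + 1)) :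
    ℋ.dsrc (h 0) (pull J c h) = B.dβ ((J 1).σ (ℋ.src (h 0))) ((J 1).lift (ℋ.src (h 0))
      (𝒢.dsrc (conj (J 0) (J 1) (h 0)) (𝒢.ev c fun i => conj (J i) (J (i + 1)) (h i)))) :=
  dsrc_dconj (mem_of_vert hh hJ 0).1 (mem_of_vert hh hJ 0).2 _

/-- By `dsrc_dconj` only the section at the source of the first arrow and ds of the value of `c`
matter. The latter depends, by projectability of `c`, on the conjugated tail and its starting
vertex, where the first label plays no part. -/
theorem dsrc_pull_eq {k : ℕ} {c : 𝒢.RawCochain (k + 1)} (hc : 𝒢.IsCochain c) {J J' : ℕ → LSec B}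
    {h h' : Fin (k + 1) → H} (hh : h ∈ ℋ.composable k) (hh' : h' ∈ ℋ.composable k)
    (e : ℋ.src (h 0) = ℋ.src (h' 0)) (e' : Fin.tail h = Fin.tail h')
    (hJ : ∀ j : Fin (k + 2), ℋ.vert h j ∈ (J j).W) (hJ' : ∀ j : Fin (k + 2), ℋ.vert h' j ∈ (J' j).W)
    (hl : ∀ j : Fin (k + 1), J (j + 1) = J' (j + 1)) :
    ℋ.dsrc (h 0) (pull J c h) = ℋ.dsrc (h' 0) (pull J' c h') := by
  have m := mem_of_vert hh hJ 0
  have m' := mem_of_vert hh' hJ' 0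
  have hl0 : J 1 = J' 1 := hl 0
  rw [dsrc_pull hh hJ, dsrc_pull hh' hJ', ← e]
  refine congrArg₂ (fun (s : LSec B) z => B.dβ (s.σ (ℋ.src (h 0))) (s.lift (ℋ.src (h 0)) z)) hl0 ?_
  refine (isCochain_iff.1 hc).2.2 _ (conj_mem hh hJ) _ (conj_mem hh' hJ') ?_ ?_
  · rw [src_conj m.1 m.2, src_conj m'.1 m'.2, hl, e]
  · funext j
    have h1 := hl j.castSucc
    have h2 := hl j.succ
    have h3 : h j.succ = h' j.succ := congrFun e' j
    change conj (J (j + 1)) (J (j + 1 + 1)) (h j.succ) =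
      conj (J' (j + 1)) (J' (j + 1 + 1)) (h' j.succ)
    rw [h3]
    exact congrArg₂ (fun s s' => conj s s' (h' j.succ)) h1 h2

theorem dsrc_pull_str {k : ℕ} {c : 𝒢.RawCochain (k + 1)} (hc : 𝒢.IsCochain c) {J J' : ℕ → LSec B}
    {a a' : ℕ → H} (ha : ∀ i j, ℋ.src (a i) = ℋ.src (a j)) (ha' : ∀ i j, ℋ.src (a' i) = ℋ.src (a' j))
    (hJ : ∀ j, ℋ.tgt (a j) ∈ (J j).W) (hJ' : ∀ j, ℋ.tgt (a' j) ∈ (J' j).W)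
    (h : ∀ i, 1 ≤ i → a i = a' i) (hl : ∀ i, 1 ≤ i → J i = J' i) :
    ℋ.dsrc (ℋ.div (a 0) (a 1)) (pull J c (ℋ.str (k + 1) a)) =
      ℋ.dsrc (ℋ.div (a' 0) (a' 1)) (pull J' c (ℋ.str (k + 1) a')) := by
  refine dsrc_pull_eq hc (str_mem ha) (str_mem ha') ?_ ?_ (fun j => ?_) (fun j => ?_)
    fun j => hl _ (by omega)
  · change ℋ.src (ℋ.div (a 0) (a 1)) = ℋ.src (ℋ.div (a' 0) (a' 1))
    rw [ℋ.src_div (ha _ _), ℋ.src_div (ha' _ _), h 1 le_rfl]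
  · rw [tail_str, tail_str]
    exact str_congr fun i _ => h _ (by simp [skip_zero])
  · rw [vert_str ha]
    exact hJ j
  · rw [vert_str ha']
    exact hJ' j

theorem smooth_pullUnit {c : 𝒢.RawCochain 0} (hc : 𝒢.IsAlgebroidSection c) {s : LSec B} {x : N}
    (hx : x ∈ s.W) : SmoothAlong 𝓘(ℝ, EN) ℋ.unit (pullUnit s c) univ x := by
  refine smoothAlong_dconj (mem_univ x) ℋ.contMDiff_unit.contMDiffAt.contMDiffWithinAt
    (by rwa [ℋ.tgt_unit]) (by rwa [ℋ.src_unit]) ?_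
  have h1 := s.contMDiffWithinAt_σ (mem_univ x) contMDiffWithinAt_id hx
  have h2 := B.isSubmersion_α.contMDiff.contMDiffAt.comp_contMDiffWithinAt x h1
  have h3 : SmoothAlong 𝓘(ℝ, EN) (fun z => 𝒢.unit (B.α (s.σ z)))
      (fun z => 𝒢.evUnit c (B.α (s.σ z))) univ x :=
    ContMDiffAt.comp_contMDiffWithinAt
      (g := fun x : M => (⟨𝒢.unit x, c x⟩ : TangentBundle 𝓘(ℝ, EG) G)) x (hc.smooth _) h2
  refine h3.congr (mem_univ x) ?_ (Filter.Eventually.of_forall fun _ => rfl)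
  filter_upwards [mem_nhdsWithin_of_mem_nhds (s.isOpen.mem_nhds hx)] with z hz using conj_unit hz

end LSec

namespace Dist

open LSec

variable {ι : Type*} (D : Dist B ι)

theorem mem_lab_coe {k : ℕ} {x : Fin (k + 1) → N} {I : Fin (k + 1) → ι}
    (hI : ∀ j, x j ∈ (D.sec (I j)).W) (j : Fin (k + 1)) : x j ∈ (D.lab I j).W := by
  rw [lab_coe]
  exact hI j

theorem isCochain_mapSucc {k : ℕ} {c : 𝒢.RawCochain (k + 1)} (hc : 𝒢.IsCochain c) :
    ℋ.IsCochain (D.mapSucc k c) := by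
  refine isCochain_iff.2 ⟨fun h hh => D.ev_mapSucc_of_notMem c hh, fun h hh => ?_,
    fun h hh h' hh' e e' => ?_⟩
  · refine SmoothAlong.congr (D.smoothAlong_avg (x := ℋ.vert) (T := fun I => pull (D.lab I) c)
      hh (fun j => (contMDiff_vert j).contMDiffAt.contMDiffWithinAt)
      (contMDiff_eval_pi 0).contMDiffAt.contMDiffWithinAt
      fun I hI => smoothAlong_pull hc hh (D.mem_lab_coe hI)) hh
      (Filter.Eventually.of_forall fun _ => rfl) ?_
    filter_upwards [self_mem_nhdsWithin] with z hz using D.ev_mapSucc c hz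
  · rw [D.ev_mapSucc c hh, D.ev_mapSucc c hh']
    refine (D.map_avg _ _ (ℋ.dsrcₗ _)).trans (Eq.trans ?_ (D.map_avg _ _ (ℋ.dsrcₗ _)).symm)
    refine D.avg_eq_avg_of_tail (vert_succ_eq e e') fun I I' hI hI' hII => ?_
    change ℋ.dsrc _ _ = ℋ.dsrc _ _
    refine dsrc_pull_eq hc hh hh' e e' (D.mem_lab_coe hI) (D.mem_lab_coe hI') fun j => ?_
    have h1 := D.lab_coe I j.succ
    rw [hII, ← D.lab_coe I' j.succ] at h1
    exact h1

theorem isAlgebroidSection_mapZero {c : 𝒢.RawCochain 0} (hc : 𝒢.IsAlgebroidSection c) :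
    ℋ.IsAlgebroidSection (D.mapZero c) := by
  refine ⟨fun x => ?_, D.dsrc_mapZero hc.dsrc_eq_zero⟩
  exact contMDiffWithinAt_univ.1 (D.smoothAlong_avg (x := fun x _ => x)
    (T := fun I => pullUnit (D.sec (I 0)) c) (mem_univ x) (fun _ => contMDiffWithinAt_id)
    ℋ.contMDiff_unit.contMDiffAt.contMDiffWithinAt fun I hI => smooth_pullUnit hc (hI 0))

/-- Transport of cochains along a bibundle. -/
def map : (k : ℕ) → 𝒢.RawCochain k →ₗ[ℝ] ℋ.RawCochain k
  | 0 =>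
    { toFun := D.mapZero
      map_add' := fun c c' => ext_evUnit fun x =>
        (congrArg (D.avg fun _ : Fin 1 => x) (funext fun _ => dconj_add _ _ _ _ _)).trans
          (D.avg_add (V := EH) _ _ _)
      map_smul' := fun a c => ext_evUnit fun x =>
        (congrArg (D.avg fun _ : Fin 1 => x) (funext fun _ => dconj_smul _ _ _ _ _)).trans
          (D.avg_smul (V := EH) _ _ _) }
  | k + 1 =>
    { toFun := D.mapSucc k
      map_add' := fun c c' => ext_ev fun h => by
        by_cases hh : h ∈ ℋ.composable k
        · change _ = ℋ.ev (D.mapSucc k c) h + ℋ.ev (D.mapSucc k c') h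
          rw [D.ev_mapSucc _ hh, D.ev_mapSucc _ hh, D.ev_mapSucc _ hh, ← D.avg_add]
          exact congrArg _ (funext fun _ => dconj_add _ _ _ _ _)
        · change _ = ℋ.ev (D.mapSucc k c) h + ℋ.ev (D.mapSucc k c') h
          rw [D.ev_mapSucc_of_notMem _ hh, D.ev_mapSucc_of_notMem _ hh, D.ev_mapSucc_of_notMem _ hh,
            add_zero]
      map_smul' := fun a c => ext_ev fun h => by
        by_cases hh : h ∈ ℋ.composable k
        · change _ = a • ℋ.ev (D.mapSucc k c) h
          rw [D.ev_mapSucc _ hh, D.ev_mapSucc _ hh, ← D.avg_smul]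
          exact congrArg _ (funext fun _ => dconj_smul _ _ _ _ _)
        · change _ = a • ℋ.ev (D.mapSucc k c) h
          rw [D.ev_mapSucc_of_notMem _ hh, D.ev_mapSucc_of_notMem _ hh, smul_zero] }

theorem map_mem_cochains {k : ℕ} {c : 𝒢.RawCochain k} (hc : c ∈ 𝒢.cochains k) :
    D.map k c ∈ ℋ.cochains k := by
  cases k with
  | zero => exact D.isAlgebroidSection_mapZero hc
  | succ k => exact D.isCochain_mapSucc hc

theorem d_map {k : ℕ} {c : 𝒢.RawCochain k} (hc : c ∈ 𝒢.cochains k) :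
    ℋ.d k (D.map k c) = D.map (k + 1) (𝒢.d k c) := by
  cases k with
  | zero => exact D.d_mapZero (IsAlgebroidSection.dsrc_eq_zero hc)
  | succ k => exact D.d_mapSucc hc

/-- `avg_comp` merges the two averages; `conj_comp` and `dconj_comp` identify the integrands. -/
theorem map_comp {ι' : Type*} (D' : Dist B.op ι') (k : ℕ) (c : 𝒢.RawCochain k) :
    D'.map k (D.map k c) = (D.comp D').map k c := by
  cases k with
  | zero =>
    refine ext_evUnit fun x => ?_
    refine Eq.trans ?_ (D.avg_comp (V := EG) D' (fun _ : Fin 1 => x)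
      fun I => pullUnit ((D.comp D').sec (I 0)) c x).symm
    refine D'.avg_congr fun J hJ => ?_
    have hJ := hJ 0
    refine (D.map_avg _ _ (dconjₗ (D'.sec (J 0)) (D'.sec (J 0)) (𝒢.unit x))).trans ?_
    have h1 : (fun _ : Fin 1 => B.op.α ((D'.sec (J 0)).σ x)) =
        fun j => B.β ((D'.sec (J j)).σ x) := by
      funext j
      obtain rfl : j = 0 := Subsingleton.elim _ _
      rfl
    rw [h1]
    refine D.avg_congr fun I hI => ?_
    have hm : x ∈ (LSec.comp (D.sec (I 0)) (D'.sec (J 0))).W := ⟨hJ, hI 0⟩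
    have h0 : 𝒢.tgt (𝒢.unit x) ∈ (LSec.comp (D.sec (I 0)) (D'.sec (J 0))).W := by rwa [𝒢.tgt_unit]
    have h0' : 𝒢.src (𝒢.unit x) ∈ (LSec.comp (D.sec (I 0)) (D'.sec (J 0))).W := by rwa [𝒢.src_unit]
    have h2 := dconj_comp h0 h0' (𝒢.evUnit c (B.α ((D.sec (I 0)).σ (B.β ((D'.sec (J 0)).σ x)))))
    rw [conj_unit hJ] at h2
    refine h2.trans ?_
    have h3 : B.α ((D.sec (I 0)).σ (B.β ((D'.sec (J 0)).σ x))) =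
        (unitBundle 𝒢).α ((LSec.comp (D.sec (I 0)) (D'.sec (J 0))).σ x) :=
      (B.tgt_divL ((D.sec (I 0)).β_σ _ (hI 0))).symm
    rw [h3]
    rfl
  | succ k =>
    refine ext_ev fun g => ?_
    by_cases hg : g ∈ 𝒢.composable k
    · refine (D'.ev_mapSucc _ hg).trans (Eq.trans ?_ ((D.comp D').ev_mapSucc c hg).symm)
      rw [avg_comp]
      refine D'.avg_congr fun J hJ => ?_
      have hJ := D'.mem_lab_coe hJ
      have hm := mem_of_vert hg hJ
      have hc := conj_mem hg hJ
      have h1 : ℋ.vert (fun i : Fin (k + 1) => conj (D'.lab J i) (D'.lab J (i + 1)) (g i)) =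
          fun j => B.β ((D'.sec (J j)).σ (𝒢.vert g j)) := by
        funext j
        rw [← D'.lab_coe]
        refine Fin.cases ?_ (fun j => ?_) j
        · exact tgt_conj (hm 0).1 (hm 0).2
        · exact src_conj (hm j).1 (hm j).2
      rw [pull, show ℋ.ev (D.map (k + 1) c) _ = _ from D.ev_mapSucc c hc, h1]
      refine (D.map_avg _ _ (dconjₗ _ _ _)).trans ?_
      refine D.avg_congr fun I hI => ?_
      have hI' : ∀ j : Fin (k + 2), 𝒢.vert g j ∈ ((D.comp D').lab (fun j => (J j, I j)) j).W := by
        intro j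
        rw [lab_coe]
        refine ⟨?_, hI j⟩
        rw [← D'.lab_coe]
        exact hJ j
      have hn := mem_of_vert hg hI'
      refine (dconj_comp (hn 0).1 (hn 0).2 _).trans ?_
      rw [pull]
      congr 2
      funext i
      exact conj_comp (hn i).1 (hn i).2
    · exact (D'.ev_mapSucc_of_notMem _ hg).trans ((D.comp D').ev_mapSucc_of_notMem c hg).symm

end Dist

end Bibundle

end LieGroupoid

/-! ### Vertical parts and right translation -/

namespace LieGroupoid

universe u u'

variable {EM : Type*} [NormedAddCommGroup EM] [NormedSpace ℝ EM]
  {M : Type u} [TopologicalSpace M] [ChartedSpace EM M] [IsManifold 𝓘(ℝ, EM) ∞ M]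
  {EG : Type*} [NormedAddCommGroup EG] [NormedSpace ℝ EG]
  {G : Type u} [TopologicalSpace G] [ChartedSpace EG G] [IsManifold 𝓘(ℝ, EG) ∞ G]
  (𝒢 : LieGroupoid EM M EG G)

theorem dmul_add (g h : G) (v v' w w' : EG) :
    𝒢.dmul g h (v + v') (w + w') = 𝒢.dmul g h v w + 𝒢.dmul g h v' w' :=
  fderivPair_add _ _ _ _ _ _ _ _

theorem dmul_smul (g h : G) (a : ℝ) (v w : EG) :
    𝒢.dmul g h (a • v) (a • w) = a • 𝒢.dmul g h v w :=
  fderivPair_smul _ _ _ _ _ _ _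

theorem dmul_sub (g h : G) (v v' w w' : EG) :
    𝒢.dmul g h (v - v') (w - w') = 𝒢.dmul g h v w - 𝒢.dmul g h v' w' := by
  rw [eq_sub_iff_add_eq, ← dmul_add, sub_add_cancel, sub_add_cancel]

theorem ddiv_sub (g h : G) (v v' w w' : EG) :
    𝒢.ddiv g h (v - v') (w - w') = 𝒢.ddiv g h v w - 𝒢.ddiv g h v' w' := by
  rw [eq_sub_iff_add_eq, ← ddiv_add, sub_add_cancel, sub_add_cancel]

/-- The projection of a tangent vector at a unit to the tangent space of the source fibre. -/
def vproj (x : M) : EG →ₗ[ℝ] EG where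
  toFun v := v - 𝒢.dunit x (𝒢.dsrc (𝒢.unit x) v)
  map_add' v w := by
    rw [dsrc_add, dunit_add]
    abel
  map_smul' a v := by
    rw [dsrc_smul, dunit_smul, smul_sub, RingHom.id_apply]

/-- The right translate by `g` of the vertical part of a tangent vector at a unit. -/
def rproj (g : G) : EG →ₗ[ℝ] EG where
  toFun v := 𝒢.dmul (𝒢.unit (𝒢.tgt g)) g (𝒢.vproj (𝒢.tgt g) v) 0
  map_add' v w := by
    rw [map_add, ← dmul_add, add_zero]
  map_smul' a v := by
    rw [map_smul, RingHom.id_apply, ← dmul_smul, smul_zero]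

theorem vproj_apply (x : M) (v : EG) :
    𝒢.vproj x v = v - 𝒢.dunit x (𝒢.dsrc (𝒢.unit x) v) := rfl

theorem rproj_apply (g : G) (v : EG) :
    𝒢.rproj g v = 𝒢.dmul (𝒢.unit (𝒢.tgt g)) g (𝒢.vproj (𝒢.tgt g) v) 0 := rfl

theorem dsrc_dunit (x : M) (z : EM) : 𝒢.dsrc (𝒢.unit x) (𝒢.dunit x z) = z := by
  obtain ⟨η, rfl, hη⟩ := exists_hasVel x z
  exact (hη.unit (𝒢 := 𝒢)).src.eq_of_eventually hη (Filter.Eventually.of_forall fun t => 𝒢.src_unit _)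

theorem dsrc_sub (g : G) (v w : EG) : 𝒢.dsrc g (v - w) = 𝒢.dsrc g v - 𝒢.dsrc g w :=
  (𝒢.dsrcₗ g).map_sub v w

theorem dsrc_vproj (x : M) (v : EG) : 𝒢.dsrc (𝒢.unit x) (𝒢.vproj x v) = 0 := by
  rw [vproj_apply, dsrc_sub, dsrc_dunit, sub_self]

theorem dsrc_rproj (g : G) (v : EG) : 𝒢.dsrc g (𝒢.rproj g v) = 0 :=
  𝒢.dsrc_dmul_zero rfl (𝒢.dsrc_vproj _ _)

theorem dmul_dunit (g : G) (w : EG) :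
    𝒢.dmul (𝒢.unit (𝒢.tgt g)) g (𝒢.dunit (𝒢.tgt g) (𝒢.dtgt g w)) w = w := by
  obtain ⟨η, rfl, hη⟩ := exists_hasVel g w
  exact ((hη.tgt (𝒢 := 𝒢)).unit.mul hη (Filter.Eventually.of_forall fun t => 𝒢.src_unit _)).eq_of_eventually
    hη (Filter.Eventually.of_forall fun t => 𝒢.unit_mul _)

theorem ddiv_dunit (g : G) (v : EG) :
    𝒢.ddiv g (𝒢.unit (𝒢.src g)) v (𝒢.dunit (𝒢.src g) (𝒢.dsrc g v)) = v := by
  obtain ⟨η, rfl, hη⟩ := exists_hasVel g v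
  exact (hη.div (hη.src (𝒢 := 𝒢)).unit
    (Filter.Eventually.of_forall fun t => (𝒢.src_unit _).symm)).eq_of_eventually
    hη (Filter.Eventually.of_forall fun t => 𝒢.div_unit _)

/-- The subtracted unit vector 1(ds v), multiplied by any `w` over it, gives back `w`. So the right
translate of the vertical part can be computed with any such companion vector. -/
theorem rproj_eq {g : G} {v w : EG} (e : 𝒢.dtgt g w = 𝒢.dsrc (𝒢.unit (𝒢.tgt g)) v) :
    𝒢.rproj g v = 𝒢.dmul (𝒢.unit (𝒢.tgt g)) g v w - w := by
  rw [rproj_apply, vproj_apply, ← e]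
  have h := 𝒢.dmul_sub (𝒢.unit (𝒢.tgt g)) g v (𝒢.dunit (𝒢.tgt g) (𝒢.dtgt g w)) w w
  rwa [sub_self, dmul_dunit] at h

theorem dmul_ddiv {g h : G} (H : 𝒢.src g = 𝒢.src h) {v w : EG} (e : 𝒢.dsrc g v = 𝒢.dsrc h w) :
    𝒢.dmul (𝒢.div g h) h (𝒢.ddiv g h v w) w = v := by
  obtain ⟨γ, η, rfl, rfl, hγ, hη, h2⟩ := 𝒢.exists_curve_pair H e
  exact ((hγ.div hη h2).mul hη (h2.mono fun t ht => 𝒢.src_div ht)).eq_of_eventually hγ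
    (h2.mono fun t ht => 𝒢.div_mul ht)

/-- Dividing at equal arrows gives a vector at a unit, and multiplying it by `w` recovers `v`; use
`w` as the companion vector in `rproj_eq`. -/
theorem rproj_ddiv (g : G) {v w : EG} (e : 𝒢.dsrc g v = 𝒢.dsrc g w) :
    𝒢.rproj g (𝒢.ddiv g g v w) = v - w := by
  have h1 := 𝒢.dsrc_ddiv rfl e
  have h2 := 𝒢.dmul_ddiv rfl e
  rw [𝒢.div_self] at h1 h2
  rw [𝒢.rproj_eq h1.symm, h2]

theorem exists_dtgt (g : G) (z : EM) : ∃ w : EG, 𝒢.dtgt g w = z := by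
  obtain ⟨η, h0, hη⟩ := exists_hasVel (𝒢.tgt g) z
  obtain ⟨e, O, hO, hg, he, he1, he2⟩ := 𝒢.isSubmersion_tgt.exists_adjust g
  have h3 := ((hasVel_const (I := 𝓘(ℝ, EG)) g).prodMk hη).comp (x := (g, 𝒢.tgt g)) (by rw [h0])
    (((he _ hg).contMDiffAt (hO.mem_nhds hg)).mdifferentiableAt (by simp))
  have h4 : ∀ᶠ t in 𝓝 0, (g, η t) ∈ O :=
    ((hasVel_const (I := 𝓘(ℝ, EG)) g).prodMk hη).continuousAt.eventually_mem
      (by rw [h0]; exact hO.mem_nhds hg)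
  have h5 := (h3.tgt (𝒢 := 𝒢)).eq_of_eventually hη (h4.mono fun t ht => he1 _ ht)
  rw [h0, he2 _ hg] at h5
  exact ⟨_, h5⟩

theorem ddiv_rproj_zero {g h : G} (H : 𝒢.src g = 𝒢.src h) (v : EG) :
    𝒢.ddiv g h (𝒢.rproj g v) 0 = 𝒢.rproj (𝒢.div g h) v := by
  have e := 𝒢.tgt_div H
  rw [rproj_apply, rproj_apply, e]
  obtain ⟨γ, h0, hγ, hs⟩ := 𝒢.exists_curve_vertical (𝒢.dsrc_vproj (𝒢.tgt g) v)
  rw [𝒢.src_unit] at hs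
  have h1 := hγ.mul (hasVel_const g) hs
  have h2 := h1.div (hasVel_const h) (hs.mono fun t ht => (𝒢.src_mul _ _ ht).trans H)
  have h3 := hγ.mul (hasVel_const (𝒢.div g h)) (hs.mono fun t ht => ht.trans e.symm)
  rw [h0] at h1 h2 h3
  rw [𝒢.unit_mul] at h2
  refine h2.eq_of_eventually h3 (hs.mono fun t ht => ?_)
  exact 𝒢.mul_assoc _ _ _ ht (by rw [𝒢.tgt_inv, H])

/-- The division of right translates. -/
theorem ddiv_rproj {g h : G} (H : 𝒢.src g = 𝒢.src h) (v' : EG) {v b : EG}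
    (e : 𝒢.dsrc (𝒢.div g h) b = 𝒢.dsrc (𝒢.unit (𝒢.tgt h)) v) :
    𝒢.ddiv g h (𝒢.rproj g v') (𝒢.rproj h v) =
      𝒢.rproj (𝒢.div g h) v' + 𝒢.ddiv (𝒢.div g h) (𝒢.unit (𝒢.tgt h)) b v - b := by
  -- With `w` over ds(v), the vector (0, `rproj h v`) equals (b·w, v·w) − (b·w, w). Division sends
  -- the first pair to the quotient of `b` by `v` and the second to `b`.
  obtain ⟨w, hw⟩ := 𝒢.exists_dtgt h (𝒢.dsrc (𝒢.unit (𝒢.tgt h)) v)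
  have hsd := 𝒢.src_div H
  obtain ⟨κ, h0, hκ⟩ := exists_hasVel h w
  obtain ⟨β, hβ0, hβ, hβs⟩ := 𝒢.exists_curve_src (η := fun t => 𝒢.tgt (κ t)) (g := 𝒢.div g h)
    (v := b) (by rw [h0, hsd]) (by rw [e, ← hw, ← h0]; exact hκ.tgt)
  obtain ⟨ν, hν0, hν, hνs⟩ := 𝒢.exists_curve_src (η := fun t => 𝒢.tgt (κ t))
    (g := 𝒢.unit (𝒢.tgt h)) (v := v) (by rw [h0, 𝒢.src_unit]) (by rw [← hw, ← h0]; exact hκ.tgt)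
  have h1 := hβ.mul hκ hβs
  have h2 := hν.mul hκ hνs
  have h10 : 𝒢.mul (β 0) (κ 0) = g := by rw [hβ0, h0, 𝒢.div_mul H]
  have h20 : 𝒢.mul (ν 0) (κ 0) = h := by rw [hν0, h0, 𝒢.unit_mul]
  have hs : ∀ᶠ t in 𝓝 0, 𝒢.src (𝒢.mul (β t) (κ t)) = 𝒢.src (κ t) :=
    hβs.mono fun t ht => 𝒢.src_mul _ _ ht
  have h3 := h1.div hκ hs
  have h4 := h1.div h2 (by
    filter_upwards [hs, hνs] with t k1 k2
    rw [k1, 𝒢.src_mul _ _ k2])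
  have h5 := hβ.div hν (by filter_upwards [hβs, hνs] with t k1 k2 using k1.trans k2.symm)
  have h6 := h3.eq_of_eventually hβ (hβs.mono fun t ht => 𝒢.mul_div ht)
  have h7 := h4.eq_of_eventually h5 (by
    filter_upwards [hβs, hνs] with t k1 k2 using 𝒢.div_mul_mul (k1.trans k2.symm) k2)
  simp only [h10, h20] at h6 h7
  rw [hβ0, h0] at h6 h7
  rw [hν0] at h7
  have h8 := 𝒢.ddiv_sub g h (𝒢.dmul (𝒢.div g h) h b w) (𝒢.dmul (𝒢.div g h) h b w)
    (𝒢.dmul (𝒢.unit (𝒢.tgt h)) h v w) w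
  rw [sub_self, h6, h7, ← 𝒢.rproj_eq hw] at h8
  have h9 := 𝒢.ddiv_add g h (𝒢.rproj g v') 0 0 (𝒢.rproj h v)
  rw [add_zero, zero_add, 𝒢.ddiv_rproj_zero H, h8] at h9
  rw [h9, add_sub_assoc]

theorem ddiv_vertical_zero {g : G} {v : EG} (hv : 𝒢.dsrc g v = 0) :
    𝒢.ddiv g (𝒢.unit (𝒢.src g)) v 0 = v := by
  have h := 𝒢.ddiv_dunit g v
  rw [hv] at h
  have h0 := 𝒢.dunit_smul (𝒢.src g) 0 0
  rw [zero_smul, zero_smul] at h0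
  rwa [h0] at h

theorem ddiv_vproj (g : G) {v' v b : EG} (hv' : 𝒢.dsrc g v' = 0)
    (e : 𝒢.dsrc g b = 𝒢.dsrc (𝒢.unit (𝒢.src g)) v) :
    𝒢.ddiv g (𝒢.unit (𝒢.src g)) v' (𝒢.vproj (𝒢.src g) v) =
      v' + 𝒢.ddiv g (𝒢.unit (𝒢.src g)) b v - b := by
  have h1 := 𝒢.ddiv_add g (𝒢.unit (𝒢.src g)) v' 0 0 (𝒢.vproj (𝒢.src g) v)
  have h2 := 𝒢.ddiv_sub g (𝒢.unit (𝒢.src g)) b b v (𝒢.dunit (𝒢.src g) (𝒢.dsrc g b))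
  rw [𝒢.ddiv_dunit, sub_self, e, ← vproj_apply] at h2
  rw [add_zero, zero_add, 𝒢.ddiv_vertical_zero hv', h2] at h1
  rw [h1, add_sub_assoc]

theorem dz_unit_vertical {x : M} {v : EG} (hv : 𝒢.dsrc (𝒢.unit x) v = 0) :
    𝒢.dz (𝒢.unit x) (v, 0) = v := by
  obtain ⟨γ, h0, hγ, hs⟩ := 𝒢.exists_curve_vertical hv
  rw [𝒢.src_unit] at hs
  have h1 := hγ.mul (hasVel_const (𝒢.unit x)) (hs.mono fun t ht => ht.trans (𝒢.tgt_unit x).symm)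
  have h2 := h1.eq_of_eventually hγ (hs.mono fun t ht => by
    have := 𝒢.mul_unit (γ t)
    rwa [ht] at this)
  rw [h0] at h2
  rw [dz_apply, 𝒢.tgt_unit, h2]
  exact 𝒢.ddiv_vertical_zero hv

end LieGroupoid

/-! ### Combinatorics of the prism -/

namespace LieGroupoid

universe u u'

/-- The sequence of natural numbers that repeats `j`. -/
def pd (j i : ℕ) : ℕ := if i ≤ j then i else i - 1

/-- This and the two lemmas below are the simplicial identities between deletion and repetition of a
term; here both sides are the identity. -/
theorem pd_skip_succ (j : ℕ) : pd (j + 1) ∘ skip (j + 1) = pd j ∘ skip (j + 1) := by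
  funext i
  simp only [pd, skip, Function.comp_apply]
  split_ifs <;> omega

theorem skip_pd_of_le {m j : ℕ} (h : m ≤ j) : skip m ∘ pd j = pd (j + 1) ∘ skip m := by
  funext i
  simp only [pd, skip, Function.comp_apply]
  split_ifs <;> omega

theorem skip_pd_of_lt {m j : ℕ} (h : j < m) : skip m ∘ pd j = pd j ∘ skip (m + 1) := by
  funext i
  simp only [pd, skip, Function.comp_apply]
  split_ifs <;> omega

/-- Away from the diagonals m = i and m = i − 1, the terms of the first double sum cancel in pairs
against the second. By `hg` the two diagonals telescope, and only the end of the main one survives.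
-/
theorem sum_prism {V : Type*} [AddCommGroup V] [Module ℝ V] (g : ℕ → ℕ → V)
    (hg : ∀ i, g (i + 1) i = g i i) (k : ℕ) :
    ∑ i ∈ Finset.range (k + 1), (-1 : ℝ) ^ (i + 1) • ∑ m ∈ Finset.range (k + 1),
      (-1 : ℝ) ^ m • g i m + ∑ m ∈ Finset.range k, (-1 : ℝ) ^ m • ∑ j ∈ Finset.range k,
        (-1 : ℝ) ^ (j + 1) • (if m < j then g (j + 1) m else g j (m + 1)) = -g k k := by
  induction k with
  | zero => simp
  | succ k ih =>
    have e : ∀ v : V, (-1 : ℝ) ^ k • (-1 : ℝ) ^ k • v = v := fun v => by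
      rw [smul_smul, ← mul_pow]
      simp
    have h1 : ∑ i ∈ Finset.range (k + 1 + 1), (-1 : ℝ) ^ (i + 1) • ∑ m ∈ Finset.range (k + 1 + 1),
        (-1 : ℝ) ^ m • g i m = ∑ i ∈ Finset.range (k + 1), (-1 : ℝ) ^ (i + 1) •
          ∑ m ∈ Finset.range (k + 1), (-1 : ℝ) ^ m • g i m +
        ((-1 : ℝ) ^ (k + 1) • ∑ i ∈ Finset.range k, (-1 : ℝ) ^ (i + 1) • g i (k + 1) + g k (k + 1)) +
        ((-1 : ℝ) ^ k • ∑ m ∈ Finset.range k, (-1 : ℝ) ^ m • g (k + 1) m + g (k + 1) k -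
          g (k + 1) (k + 1)) := by
      rw [Finset.sum_range_succ _ (k + 1)]
      simp only [Finset.sum_range_succ _ (k + 1), smul_add, Finset.sum_add_distrib]
      rw [Finset.sum_range_succ (fun i => (-1 : ℝ) ^ (i + 1) • (-1 : ℝ) ^ (k + 1) • g i (k + 1)),
        Finset.sum_range_succ (fun m => (-1 : ℝ) ^ m • g (k + 1) m)]
      simp only [smul_comm _ ((-1 : ℝ) ^ (k + 1)), ← Finset.smul_sum]
      simp only [smul_add, pow_succ, mul_neg, mul_one, neg_neg, neg_smul, smul_neg, e]
      abel
    have h2 : ∑ m ∈ Finset.range (k + 1), (-1 : ℝ) ^ m • ∑ j ∈ Finset.range (k + 1),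
        (-1 : ℝ) ^ (j + 1) • (if m < j then g (j + 1) m else g j (m + 1)) =
        ∑ m ∈ Finset.range k, (-1 : ℝ) ^ m • ∑ j ∈ Finset.range k,
          (-1 : ℝ) ^ (j + 1) • (if m < j then g (j + 1) m else g j (m + 1)) +
        (-1 : ℝ) ^ (k + 1) • ∑ m ∈ Finset.range k, (-1 : ℝ) ^ m • g (k + 1) m +
        (-1 : ℝ) ^ k • ∑ i ∈ Finset.range k, (-1 : ℝ) ^ (i + 1) • g i (k + 1) - g k (k + 1) := by
      have h3 : ∀ m ∈ Finset.range k, (-1 : ℝ) ^ m • (-1 : ℝ) ^ (k + 1) •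
          (if m < k then g (k + 1) m else g k (m + 1)) =
          (-1 : ℝ) ^ (k + 1) • (-1 : ℝ) ^ m • g (k + 1) m := fun m hm => by
        rw [if_pos (Finset.mem_range.1 hm), smul_comm]
      have h4 : ∀ j ∈ Finset.range k, (-1 : ℝ) ^ (j + 1) •
          (if k < j then g (j + 1) k else g j (k + 1)) = (-1 : ℝ) ^ (j + 1) • g j (k + 1) :=
        fun j hj => by rw [if_neg (not_lt.2 (Finset.mem_range.1 hj).le)]
      rw [Finset.sum_range_succ _ k]
      simp only [Finset.sum_range_succ _ k, smul_add, Finset.sum_add_distrib]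
      rw [Finset.sum_congr rfl h3, Finset.sum_congr rfl h4, if_neg (lt_irrefl k), ← Finset.smul_sum]
      simp only [pow_succ, mul_neg, mul_one, neg_smul, smul_neg, e]
      abel
    rw [h1, h2, hg]
    have h5 := ih
    rw [← eq_sub_iff_add_eq] at h5
    rw [h5]
    simp only [pow_succ, mul_neg, mul_one, neg_smul]
    abel

variable {EM : Type*} [NormedAddCommGroup EM] [NormedSpace ℝ EM]
  {M : Type u} [TopologicalSpace M] [ChartedSpace EM M] [IsManifold 𝓘(ℝ, EM) ∞ M]
  {EG : Type*} [NormedAddCommGroup EG] [NormedSpace ℝ EG]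
  {G : Type u} [TopologicalSpace G] [ChartedSpace EG G] [IsManifold 𝓘(ℝ, EG) ∞ G]
  {𝒢 : LieGroupoid EM M EG G}

namespace Bibundle

namespace LSec

/-- The local sections `J 0, …, J j`, followed by the units. -/
def pl (j : ℕ) (J : ℕ → LSec (unitBundle 𝒢)) (i : ℕ) : LSec (unitBundle 𝒢) :=
  if i ≤ j then J i else unit 𝒢

theorem pl_skip_succ (j : ℕ) (J : ℕ → LSec (unitBundle 𝒢)) :
    pl (j + 1) J ∘ skip (j + 1) = pl j J ∘ skip (j + 1) := by
  funext i
  simp only [pl, skip, Function.comp_apply]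
  split_ifs <;> first | rfl | omega

theorem pl_comp_skip_of_le {m j : ℕ} (h : m ≤ j) (J : ℕ → LSec (unitBundle 𝒢)) :
    pl j (J ∘ skip m) = pl (j + 1) J ∘ skip m := by
  funext i
  simp only [pl, skip, Function.comp_apply]
  split_ifs <;> first | rfl | omega

theorem pl_comp_skip_of_lt {m j : ℕ} (h : j < m) (J : ℕ → LSec (unitBundle 𝒢)) :
    pl j (J ∘ skip m) = pl j J ∘ skip (m + 1) := by
  funext i
  simp only [pl, skip, Function.comp_apply]
  split_ifs <;> first | rfl | omega

theorem mem_pl {a : ℕ → G} {J : ℕ → LSec (unitBundle 𝒢)} (hJ : ∀ j, 𝒢.tgt (a j) ∈ (J j).W)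
    (j i : ℕ) : 𝒢.tgt (a (pd j i)) ∈ (pl j J i).W := by
  rw [pl, pd]
  split_ifs with h
  · exact hJ i
  · exact mem_univ _

/-- The value of `c` on the string given by `a` with the `j`-th term repeated. -/
def prism {k : ℕ} (c : 𝒢.RawCochain (k + 1)) (a : ℕ → G) (J : ℕ → LSec (unitBundle 𝒢)) (j : ℕ) : EG :=
  pull (pl j J) c (𝒢.str (k + 1) (a ∘ pd j))

/-- The values of `c` on the faces of the string given by `a` with the `j`-th term repeated. -/
def face {k : ℕ} (c : 𝒢.RawCochain (k + 1)) (a : ℕ → G) (J : ℕ → LSec (unitBundle 𝒢)) (j m : ℕ) : EG :=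
  pull (pl j J ∘ skip m) c (𝒢.str (k + 1) ((a ∘ pd j) ∘ skip m))

section

variable {k : ℕ} {c : 𝒢.RawCochain (k + 1)} {a : ℕ → G} {J : ℕ → LSec (unitBundle 𝒢)}

/-- Neighbouring prisms share a face: deleting the term at j + 1 leaves in both cases the sequence
`a` with labels J₀, …, J_j followed by units. -/
theorem face_succ (j : ℕ) : face c a J (j + 1) (j + 1) = face c a J j (j + 1) := by
  rw [face, face, pl_skip_succ, Function.comp_assoc, Function.comp_assoc, pd_skip_succ]

theorem prism_skip_of_le {m j : ℕ} (h : m ≤ j) :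
    prism c (a ∘ skip m) (J ∘ skip m) j = face c a J (j + 1) m := by
  rw [prism, face, pl_comp_skip_of_le h, Function.comp_assoc, Function.comp_assoc, skip_pd_of_le h]

theorem prism_skip_of_lt {m j : ℕ} (h : j < m) :
    prism c (a ∘ skip m) (J ∘ skip m) j = face c a J j (m + 1) := by
  rw [prism, face, pl_comp_skip_of_lt h, Function.comp_assoc, Function.comp_assoc, skip_pd_of_lt h]

theorem pull_unit (c : 𝒢.RawCochain (k + 1)) (g : Fin (k + 1) → G) :
    pull (fun _ => unit 𝒢) c g = 𝒢.ev c g := by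
  simp only [pull, conj_unit_unit, dconj_unit_unit]

theorem face_zero_zero : face c a J 0 0 = 𝒢.ev c (𝒢.str (k + 1) a) := by
  rw [← pull_unit]
  rfl

theorem face_last : face c a J (k + 1) (k + 2) = pull J c (𝒢.str (k + 1) a) := by
  have h : ∀ i ≤ k + 1, pd (k + 1) (skip (k + 2) i) = i := fun i hi => by
    rw [skip_of_lt (by omega), pd, if_pos hi]
  rw [face, str_congr (a := (a ∘ pd (k + 1)) ∘ skip (k + 2)) (a' := a) fun i hi =>
    congrArg a (h i hi)]
  refine pull_congr (fun i hi => ?_) _ _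
  rw [Function.comp_apply, skip_of_lt (by omega), pl, if_pos hi]

theorem dsrc_face (ha : ∀ i j, 𝒢.src (a i) = 𝒢.src (a j)) (hJ : ∀ j, 𝒢.tgt (a j) ∈ (J j).W)
    (hc : 𝒢.IsCochain c) (j : ℕ) :
    𝒢.dsrc (𝒢.div (a (pd j 0)) (a (pd j 2))) (face c a J j 1) =
      𝒢.dsrc (𝒢.div (a (pd j 1)) (a (pd j 2))) (face c a J j 0) := by
  refine dsrc_pull_str (a := (a ∘ pd j) ∘ skip 1) (a' := (a ∘ pd j) ∘ skip 0) hc (fun _ _ => ha _ _)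
    (fun _ _ => ha _ _) (fun i => mem_pl hJ _ _) (fun i => mem_pl hJ _ _) (fun i hi => ?_)
    fun i hi => ?_
  · simp only [Function.comp_apply, skip_of_le hi, skip_zero]
  · simp only [Function.comp_apply, skip_of_le hi, skip_zero]

/-- The cocycle equation on the degenerate string, solved for the term that contains the division.
The homotopy identity uses it to eliminate every division of prism faces. -/
theorem ddiv_face (ha : ∀ i j, 𝒢.src (a i) = 𝒢.src (a j)) (hJ : ∀ j, 𝒢.tgt (a j) ∈ (J j).W)
    (hc : 𝒢.IsCochain c) (hd : 𝒢.d (k + 1) c = 0) (j : ℕ) :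
    𝒢.ddiv (𝒢.div (a (pd j 0)) (a (pd j 2))) (𝒢.div (a (pd j 1)) (a (pd j 2)))
      (face c a J j 1) (face c a J j 0) =
      ∑ m ∈ Finset.range (k + 1), (-1 : ℝ) ^ m • face c a J j (m + 2) := by
  have h := pull_d (J := pl j J) (a := a ∘ pd j) (fun _ _ => ha _ _) (fun i => mem_pl hJ _ _) hc
  rw [hd] at h
  have h0 : pull (pl j J) (0 : 𝒢.RawCochain (k + 1 + 1)) (𝒢.str (k + 2) (a ∘ pd j)) = 0 :=
    (dconjₗ _ _ _).map_zero
  rw [h0, altSum_apply] at h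
  exact (neg_add_eq_zero.1 h.symm)

end

end LSec

end Bibundle

end LieGroupoid

/-! ### The prism identity for cocycles -/

namespace LieGroupoid

universe u u'

variable {EM : Type*} [NormedAddCommGroup EM] [NormedSpace ℝ EM]
  {M : Type u} [TopologicalSpace M] [ChartedSpace EM M] [IsManifold 𝓘(ℝ, EM) ∞ M]
  {EG : Type*} [NormedAddCommGroup EG] [NormedSpace ℝ EG]
  {G : Type u} [TopologicalSpace G] [ChartedSpace EG G] [IsManifold 𝓘(ℝ, EG) ∞ G]

theorem ddiv_sum (𝒢 : LieGroupoid EM M EG G) (g h : G) (r : ℕ → ℝ) (v w : ℕ → EG) (n : ℕ) :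
    𝒢.ddiv g h (∑ j ∈ Finset.range n, r j • v j) (∑ j ∈ Finset.range n, r j • w j) =
      ∑ j ∈ Finset.range n, r j • 𝒢.ddiv g h (v j) (w j) := by
  induction n with
  | zero =>
    have h0 := 𝒢.ddiv_smul g h 0 0 0
    rw [zero_smul, zero_smul] at h0
    simpa using h0
  | succ n ih => rw [Finset.sum_range_succ, Finset.sum_range_succ, Finset.sum_range_succ, ddiv_add,
      ddiv_smul, ih]

variable {𝒢 : LieGroupoid EM M EG G}

namespace Bibundle

namespace LSec

/-- The integrand of the homotopy between the identity and the transport along the unit bibundle. -/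
def prismSum {k : ℕ} (c : 𝒢.RawCochain (k + 2)) (a : ℕ → G) (J : ℕ → LSec (unitBundle 𝒢)) : EG :=
  𝒢.rproj (𝒢.div (a 0) (a 1)) (prism c a J 0) +
    ∑ j ∈ Finset.range (k + 1), (-1 : ℝ) ^ (j + 1) • prism c a J (j + 1)

/-- The cocycle equation is used for each prism, with its index 0 treated specially because the
first arrow there is a unit. Right translation turns its equation into a difference of the faces 1
and 0 (`r0`). For index 1 the division involves a right translate and is evaluated by `ddiv_rproj`.
The remaining faces cancel by `sum_prism`, which leaves the face without unit labels and the face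
with units only. -/
theorem altSum_prismSum {k : ℕ} {c : 𝒢.RawCochain (k + 2)} {a : ℕ → G}
    {J : ℕ → LSec (unitBundle 𝒢)} (ha : ∀ i j, 𝒢.src (a i) = 𝒢.src (a j))
    (hJ : ∀ j, 𝒢.tgt (a j) ∈ (J j).W) (hc : 𝒢.IsCochain c) (hd : 𝒢.d (k + 2) c = 0) :
    𝒢.altSum k a (fun m => prismSum c (a ∘ skip m) (J ∘ skip m)) =
      𝒢.ev c (𝒢.str (k + 2) a) - pull J c (𝒢.str (k + 2) a) := by
  let f : ℕ → ℕ → EG := face c a J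
  let A : ℕ → EG := fun j => ∑ m ∈ Finset.range (k + 2), (-1 : ℝ) ^ m • f j (m + 2)
  have e1 : 𝒢.div (a 1) (a 1) = 𝒢.unit (𝒢.tgt (a 1)) := 𝒢.div_self _
  have e2 : 𝒢.div (𝒢.div (a 0) (a 2)) (𝒢.div (a 1) (a 2)) = 𝒢.div (a 0) (a 1) :=
    𝒢.div_div_div (ha _ _) (ha _ _)
  have e3 : 𝒢.tgt (𝒢.div (a 1) (a 2)) = 𝒢.tgt (a 1) := 𝒢.tgt_div (ha _ _)
  have q1 : prismSum c (a ∘ skip 1) (J ∘ skip 1) = 𝒢.rproj (𝒢.div (a 0) (a 2)) (f 0 2) +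
      ∑ j ∈ Finset.range (k + 1), (-1 : ℝ) ^ (j + 1) • f (j + 2) 1 := by
    rw [prismSum, prism_skip_of_lt Nat.zero_lt_one]
    refine congrArg₂ _ rfl (Finset.sum_congr rfl fun j _ => ?_)
    rw [prism_skip_of_le (by omega)]
  have q0 : prismSum c (a ∘ skip 0) (J ∘ skip 0) = 𝒢.rproj (𝒢.div (a 1) (a 2)) (f 1 0) +
      ∑ j ∈ Finset.range (k + 1), (-1 : ℝ) ^ (j + 1) • f (j + 2) 0 := by
    rw [prismSum, prism_skip_of_le le_rfl]
    refine congrArg₂ _ rfl (Finset.sum_congr rfl fun j _ => ?_)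
    rw [prism_skip_of_le (by omega)]
  have q : ∀ m, prismSum c (a ∘ skip (m + 2)) (J ∘ skip (m + 2)) =
      𝒢.rproj (𝒢.div (a 0) (a 1)) (f 0 (m + 3)) + ∑ j ∈ Finset.range (k + 1), (-1 : ℝ) ^ (j + 1) •
        (if m < j then f (j + 2) (m + 2) else f (j + 1) (m + 3)) := by
    intro m
    rw [prismSum, prism_skip_of_lt (Nat.succ_pos _)]
    refine congrArg₂ _ ?_ (Finset.sum_congr rfl fun j _ => ?_)
    · simp [skip]
      rfl
    · split_ifs with h
      · rw [prism_skip_of_le (by omega)]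
      · rw [prism_skip_of_lt (by omega)]
  have c2 : ∀ j, 𝒢.ddiv (𝒢.div (a 0) (a 2)) (𝒢.div (a 1) (a 2)) (f (j + 2) 1) (f (j + 2) 0) =
      A (j + 2) := by
    intro j
    have h := ddiv_face ha hJ hc hd (j + 2)
    simpa [pd] using h
  have c1 : 𝒢.ddiv (𝒢.div (a 0) (a 1)) (𝒢.unit (𝒢.tgt (a 1))) (f 1 1) (f 1 0) = A 1 := by
    rw [← e1]
    exact ddiv_face ha hJ hc hd 1
  have d1 : 𝒢.dsrc (𝒢.div (a 0) (a 1)) (f 1 1) = 𝒢.dsrc (𝒢.unit (𝒢.tgt (a 1))) (f 1 0) := by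
    rw [← e1]
    exact dsrc_face ha hJ hc 1
  have r0 : 𝒢.rproj (𝒢.div (a 0) (a 1)) (A 0) = f 0 1 - f 0 0 := by
    have c0 : 𝒢.ddiv (𝒢.div (a 0) (a 1)) (𝒢.div (a 0) (a 1)) (f 0 1) (f 0 0) = A 0 :=
      ddiv_face ha hJ hc hd 0
    rw [← c0]
    exact 𝒢.rproj_ddiv _ (dsrc_face ha hJ hc 0)
  have r1 : A 0 = f 0 2 - ∑ m ∈ Finset.range (k + 1), (-1 : ℝ) ^ m • f 0 (m + 3) := by
    change ∑ m ∈ Finset.range (k + 2), (-1 : ℝ) ^ m • f 0 (m + 2) = _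
    rw [Finset.sum_range_succ']
    simp only [pow_succ, mul_neg, mul_one, neg_smul, Finset.sum_neg_distrib, pow_zero, one_smul]
    abel
  rw [r1, map_sub, map_sum] at r0
  simp only [map_smul] at r0
  -- The faces 0 and 1 of the prism of index 1 serve as `v` and `b`, and their quotient is known
  -- from the cocycle equation `c1`. The correction −`b` is cancelled through the shared face `l2`.
  have D := 𝒢.ddiv_rproj (g := 𝒢.div (a 0) (a 2)) (h := 𝒢.div (a 1) (a 2))
    (by rw [𝒢.src_div (ha _ _), 𝒢.src_div (ha _ _)]) (f 0 2) (v := f 1 0) (b := f 1 1)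
    (by rw [e2, e3]; exact d1)
  rw [e2, e3, c1] at D
  -- Index 0 and the faces 0 and 1 have been dealt with, hence the shifts by 1 and 2.
  have s1 := sum_prism (fun i m => f (i + 1) (m + 2)) (fun i => face_succ (i + 1)) (k + 1)
  have s2 : ∑ i ∈ Finset.range (k + 1 + 1), (-1 : ℝ) ^ (i + 1) • A (i + 1) =
      -(∑ j ∈ Finset.range (k + 1), (-1 : ℝ) ^ (j + 1) • A (j + 2)) - A 1 := by
    rw [Finset.sum_range_succ']
    simp only [pow_succ, mul_neg, mul_one, neg_smul, Finset.sum_neg_distrib, pow_zero, one_smul,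
      neg_neg]
    abel
  have l0 : f 0 0 = 𝒢.ev c (𝒢.str (k + 2) a) := face_zero_zero
  have l1 : f (k + 2) (k + 3) = pull J c (𝒢.str (k + 2) a) := face_last
  have l2 : f 1 1 = f 0 1 := face_succ 0
  rw [altSum_apply, q1, q0, ddiv_add, D, ddiv_sum]
  simp only [q, c2, smul_add, Finset.sum_add_distrib]
  rw [← l0, ← l1]
  have s3 := (congrArg (· + _) s2).symm.trans s1
  rw [← eq_sub_iff_add_eq'] at s3
  have r2 := (sub_sub_cancel (f 0 1) (f 0 0)).symm
  rw [← r0] at r2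
  rw [s3, l2, r2]
  abel

/-- The integrand of the homotopy in degree one. -/
def prismUnit (c : 𝒢.RawCochain 1) (s : LSec (unitBundle 𝒢)) (x : M) : EG :=
  𝒢.vproj x (pull (pl 0 fun _ => s) c fun _ : Fin 1 => 𝒢.unit x)

/-- The lowest case of the prism identity, with a₀ = g and a₁ a unit. It combines the cocycle
equations on the strings from (a₀, a₀, a₁) and (a₀, a₁, a₁), which share a face. The homotopy lives
over units, so its vertical part is taken; right translation is already in the differential. The
sign is opposite to that in `altSum_prismSum`. -/
theorem dz_prismUnit {c : 𝒢.RawCochain 1} {g : G} {J : ℕ → LSec (unitBundle 𝒢)}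
    (h0 : 𝒢.tgt g ∈ (J 0).W) (h1 : ∀ j, 1 ≤ j → 𝒢.src g ∈ (J j).W)
    (hc : 𝒢.IsCochain c) (hd : 𝒢.d 1 c = 0) :
    𝒢.dz g (prismUnit c (J 0) (𝒢.tgt g), prismUnit c (J 1) (𝒢.src g)) =
      pull J c (fun _ : Fin 1 => g) - 𝒢.ev c (fun _ : Fin 1 => g) := by
  let a : ℕ → G := fun i => if i = 0 then g else 𝒢.unit (𝒢.src g)
  have ha0 : ∀ i, 𝒢.src (a i) = 𝒢.src g := by
    intro i
    simp only [a]
    split_ifs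
    · rfl
    · rw [𝒢.src_unit]
  have ha : ∀ i j, 𝒢.src (a i) = 𝒢.src (a j) := fun i j => (ha0 i).trans (ha0 j).symm
  have hJ : ∀ j, 𝒢.tgt (a j) ∈ (J j).W := by
    intro j
    simp only [a]
    split_ifs with h
    · rwa [h]
    · rw [𝒢.tgt_unit]
      exact h1 j (by omega)
  let f : ℕ → ℕ → EG := face c a J
  have eg : 𝒢.div (a 0) (a 1) = g := 𝒢.div_unit g
  have e0 : 𝒢.div (a 0) (a 0) = 𝒢.unit (𝒢.tgt g) := 𝒢.div_self g
  have e1 : 𝒢.div (a 1) (a 1) = 𝒢.unit (𝒢.src g) := by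
    rw [𝒢.div_self]
    change 𝒢.unit (𝒢.tgt (𝒢.unit (𝒢.src g))) = _
    rw [𝒢.tgt_unit]
  have es : 𝒢.str 1 a = fun _ => g := by
    funext i
    obtain rfl : i = 0 := Subsingleton.elim _ _
    exact eg
  have c0 : 𝒢.ddiv g g (f 0 1) (f 0 0) = f 0 2 := by
    have h := ddiv_face ha hJ hc hd 0
    rw [Finset.sum_range_one, pow_zero, one_smul] at h
    rw [← eg]
    exact h
  have c1 : 𝒢.ddiv g (𝒢.unit (𝒢.src g)) (f 1 1) (f 1 0) = f 1 2 := by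
    have h := ddiv_face ha hJ hc hd 1
    rw [Finset.sum_range_one, pow_zero, one_smul] at h
    rw [← e1]
    nth_rw 1 [← eg]
    exact h
  have d0 : 𝒢.dsrc g (f 0 1) = 𝒢.dsrc g (f 0 0) := by
    rw [← eg]
    exact dsrc_face ha hJ hc 0
  have d1 : 𝒢.dsrc g (f 1 1) = 𝒢.dsrc (𝒢.unit (𝒢.src g)) (f 1 0) := by
    rw [← e1]
    nth_rw 1 [← eg]
    exact dsrc_face ha hJ hc 1
  have p0 : prismUnit c (J 0) (𝒢.tgt g) = 𝒢.vproj (𝒢.tgt g) (f 0 2) := by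
    have h : 𝒢.str 1 ((a ∘ pd 0) ∘ skip 2) = fun _ => 𝒢.unit (𝒢.tgt g) := by
      funext i
      obtain rfl : i = 0 := Subsingleton.elim _ _
      exact e0
    change _ = 𝒢.vproj _ (pull _ _ _)
    rw [h, prismUnit, pull_congr (J' := pl 0 J ∘ skip 2)]
    intro i hi
    interval_cases i <;> rfl
  have p1 : prismUnit c (J 1) (𝒢.src g) = 𝒢.vproj (𝒢.src g) (f 1 0) := by
    have h : 𝒢.str 1 ((a ∘ pd 1) ∘ skip 0) = fun _ => 𝒢.unit (𝒢.src g) := by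
      funext i
      obtain rfl : i = 0 := Subsingleton.elim _ _
      exact e1
    change _ = 𝒢.vproj _ (pull _ _ _)
    rw [h, prismUnit, pull_congr (J' := pl 1 J ∘ skip 0)]
    intro i hi
    interval_cases i <;> rfl
  have l0 : f 0 0 = 𝒢.ev c (𝒢.str 1 a) := face_zero_zero
  have l1 : f 1 2 = pull J c (𝒢.str 1 a) := face_last
  have l2 : f 1 1 = f 0 1 := face_succ 0
  have r0 : 𝒢.rproj g (f 0 2) = f 0 1 - f 0 0 := by
    rw [← c0]
    exact 𝒢.rproj_ddiv g d0
  have D := 𝒢.ddiv_vproj g (v' := 𝒢.rproj g (f 0 2)) (𝒢.dsrc_rproj g _) d1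
  rw [dz_apply, p0, p1, ← rproj_apply, D, r0, c1, ← es, ← l0, ← l1, l2]
  abel

/-- A cocycle of degree zero is not changed by conjugation. -/
theorem pullUnit_eq {c : 𝒢.RawCochain 0} (hc : 𝒢.IsAlgebroidSection c) (hd : 𝒢.d 0 c = 0)
    {s : LSec (unitBundle 𝒢)} {x : M} (hx : x ∈ s.W) : pullUnit s c x = 𝒢.evUnit c x := by
  have ht := 𝒢.tgt_unit x
  have hs := 𝒢.src_unit x
  have hv := hc.dsrc_eq_zero
  have e1 : 𝒢.dz (𝒢.unit x) (pullUnit s c x, 𝒢.evUnit c x) = 0 := by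
    -- At the unit arrow, the target is labelled by `s` and the source by the unit section. Compared
    -- with the equation where both ends carry the original value, only the vertical difference at
    -- the target remains.
    have h := pull_d_zero (J := pl 0 fun _ => s) (h := fun _ => 𝒢.unit x) (c := c)
      (by rw [ht]; exact hx) (mem_univ _) hv
    rw [hd] at h
    have h2 : pullUnit (unit 𝒢) c x = 𝒢.evUnit c x := by
      refine (dconj_unit_unit _ _).trans ?_
      change 𝒢.evUnit c (𝒢.tgt (𝒢.unit x)) = _
      rw [ht]
    rw [ht, hs] at h
    rw [← h2]
    exact h.symm.trans (dconjₗ _ _ _).map_zero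
  have e2 : 𝒢.dz (𝒢.unit x) (𝒢.evUnit c x, 𝒢.evUnit c x) = 0 := by
    have h := ev_d_zero hv fun _ => 𝒢.unit x
    rw [hd, ht, hs] at h
    exact h.symm
  have e3 := (𝒢.dz (𝒢.unit x)).map_sub (pullUnit s c x, 𝒢.evUnit c x) (𝒢.evUnit c x, 𝒢.evUnit c x)
  rw [e1, e2, Prod.mk_sub_mk, sub_self, sub_self, dz_unit_vertical] at e3
  · exact sub_eq_zero.1 e3
  · rw [dsrc_sub, dsrc_pullUnit hv hx, hv, sub_self]

end LSec

end Bibundle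

end LieGroupoid

/-! ### The homotopy between transport along the unit bibundle and the identity -/

namespace LieGroupoid

universe u u'

variable {EM : Type*} [NormedAddCommGroup EM] [NormedSpace ℝ EM]
  {M : Type u} [TopologicalSpace M] [ChartedSpace EM M] [IsManifold 𝓘(ℝ, EM) ∞ M]
  {EG : Type*} [NormedAddCommGroup EG] [NormedSpace ℝ EG]
  {G : Type u} [TopologicalSpace G] [ChartedSpace EG G] [IsManifold 𝓘(ℝ, EG) ∞ G]
  {𝒢 : LieGroupoid EM M EG G}

section Smooth

variable {E' : Type*} [NormedAddCommGroup E'] [NormedSpace ℝ E'] {H' : Type*} [TopologicalSpace H']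
  {I' : ModelWithCorners ℝ E' H'} {Y : Type*} [TopologicalSpace Y] [ChartedSpace H' Y]
  {S : Set Y} {y : Y}

theorem smoothAlong_vproj {f : Y → M} {v : Y → EG} (hyS : y ∈ S)
    (hv : SmoothAlong I' (fun z => 𝒢.unit (f z)) v S y) :
    SmoothAlong I' (fun z => 𝒢.unit (f z)) (fun z => 𝒢.vproj (f z) (v z)) S y := by
  refine hv.sub ?_
  refine SmoothAlong.congr ((hv.mfderiv 𝒢.isSubmersion_src.contMDiff hyS).mfderiv
    𝒢.contMDiff_unit hyS) hyS (Filter.Eventually.of_forall fun z => ?_)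
    (Filter.Eventually.of_forall fun z => ?_)
  · rw [𝒢.src_unit]
  · rw [𝒢.src_unit]
    rfl

theorem smoothAlong_rproj {f : Y → G} {v : Y → EG} (hyS : y ∈ S)
    (hf : ContMDiffWithinAt I' 𝓘(ℝ, EG) ∞ f S y)
    (hv : SmoothAlong I' (fun z => 𝒢.unit (𝒢.tgt (f z))) v S y) :
    SmoothAlong I' f (fun z => 𝒢.rproj (f z) (v z)) S y := by
  have h0 : 𝒢.dtgt (f y) 0 = 0 := map_zero (mfderiv 𝓘(ℝ, EG) 𝓘(ℝ, EM) 𝒢.tgt _)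
  refine SmoothAlong.congr ((smoothAlong_vproj hyS hv).fderivPair 𝒢.isSubmersion_src
    𝒢.isSubmersion_tgt.contMDiff 𝒢.contMDiffOn_mul hyS (smoothAlong_zero hf)
    (Filter.Eventually.of_forall fun z => 𝒢.src_unit _) (Filter.Eventually.of_forall fun z => ?_))
    hyS (Filter.Eventually.of_forall fun z => (𝒢.unit_mul _).symm)
    (Filter.Eventually.of_forall fun _ => rfl)
  exact (𝒢.dsrc_vproj _ _).trans (map_zero (mfderiv 𝓘(ℝ, EG) 𝓘(ℝ, EM) 𝒢.tgt _)).symm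

end Smooth

variable (𝒢) in
/-- The string `g` with a unit inserted at position `j`. -/
def ins {k : ℕ} (j : Fin (k + 2)) (g : Fin (k + 1) → G) : Fin (k + 2) → G :=
  Fin.insertNth (α := fun _ => G) j (𝒢.unit (𝒢.vert g j)) g

theorem ins_same {k : ℕ} (j : Fin (k + 2)) (g : Fin (k + 1) → G) :
    𝒢.ins j g j = 𝒢.unit (𝒢.vert g j) := Fin.insertNth_apply_same (α := fun _ => G) _ _ _

theorem ins_succAbove {k : ℕ} (j : Fin (k + 2)) (g : Fin (k + 1) → G) (i : Fin (k + 1)) :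
    𝒢.ins j g (j.succAbove i) = g i := Fin.insertNth_apply_succAbove (α := fun _ => G) _ _ _ _

theorem ins_zero_zero {k : ℕ} (g : Fin (k + 1) → G) : 𝒢.ins 0 g 0 = 𝒢.unit (𝒢.tgt (g 0)) :=
  ins_same 0 g

theorem ins_succ_zero {k : ℕ} (j : Fin (k + 1)) (g : Fin (k + 1) → G) : 𝒢.ins j.succ g 0 = g 0 :=
  ins_succAbove j.succ g 0

theorem contMDiff_ins {k : ℕ} (j i : Fin (k + 2)) :
    ContMDiff (ModelWithCorners.pi fun _ : Fin (k + 1) => 𝓘(ℝ, EG)) 𝓘(ℝ, EG) ∞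
      (fun g : Fin (k + 1) → G => 𝒢.ins j g i) := by
  rcases Fin.eq_self_or_eq_succAbove j i with rfl | ⟨l, rfl⟩
  · simp only [ins_same]
    exact 𝒢.contMDiff_unit.comp (contMDiff_vert i)
  · simp only [ins_succAbove]
    exact contMDiff_eval_pi l

/-- Repeating a term of the sequence inserts a unit in the string. Thus the prism, defined through a
choice of sequence, becomes a function of the string itself, as its smoothness requires. -/
theorem ins_str {k : ℕ} {a : ℕ → G} (ha : ∀ i j, 𝒢.src (a i) = 𝒢.src (a j)) (j : Fin (k + 2)) :
    𝒢.ins j (𝒢.str (k + 1) a) = 𝒢.str (k + 2) (a ∘ pd j) := by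
  funext i
  rcases Fin.eq_self_or_eq_succAbove j i with rfl | ⟨l, rfl⟩
  · rw [ins_same, vert_str ha, ← 𝒢.div_self]
    simp [str, pd]
  · rw [ins_succAbove]
    simp only [str, Function.comp_apply, val_succAbove]
    congr 2
    · simp only [skip, pd]
      split_ifs <;> omega
    · simp only [skip, pd]
      split_ifs <;> omega

theorem ins_mem {k : ℕ} {g : Fin (k + 1) → G} (hg : g ∈ 𝒢.composable k) (j : Fin (k + 2)) :
    𝒢.ins j g ∈ 𝒢.composable (k + 1) := by
  obtain ⟨a, ha, -, rfl⟩ := exists_str hg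
  rw [ins_str ha]
  exact str_mem (k := k + 1) fun _ _ => ha _ _

theorem vert_ins {k : ℕ} {g : Fin (k + 1) → G} (hg : g ∈ 𝒢.composable k) {i j : Fin (k + 2)}
    (h : (i : ℕ) ≤ j) : 𝒢.vert (𝒢.ins j g) i.castSucc = 𝒢.vert g i := by
  obtain ⟨a, ha, -, rfl⟩ := exists_str hg
  rw [ins_str ha, vert_str ha]
  refine (vert_str (k := k + 1) (a := a ∘ pd j) (fun _ _ => ha _ _) _).trans ?_
  simp [pd, h]

theorem tail_ins_succ {k : ℕ} (j : Fin (k + 1)) {g g' : Fin (k + 1) → G}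
    (e : 𝒢.vert g j.succ = 𝒢.vert g' j.succ) (e' : Fin.tail g = Fin.tail g') :
    Fin.tail (𝒢.ins j.succ g) = Fin.tail (𝒢.ins j.succ g') := by
  funext i
  change 𝒢.ins j.succ g i.succ = 𝒢.ins j.succ g' i.succ
  rcases Fin.eq_self_or_eq_succAbove j i with rfl | ⟨l, rfl⟩
  · rw [ins_same, ins_same, e]
  · rw [← Fin.succ_succAbove_succ, ins_succAbove, ins_succAbove]
    exact congrFun e' l

namespace Bibundle

namespace LSec

variable {k : ℕ} {c : 𝒢.RawCochain (k + 2)} {J J' : ℕ → LSec (unitBundle 𝒢)}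

theorem mem_pl_vert {g : Fin (k + 1) → G} (hg : g ∈ 𝒢.composable k)
    (hJ : ∀ j : Fin (k + 2), 𝒢.vert g j ∈ (J j).W) (j : Fin (k + 2)) (i : Fin (k + 3)) :
    𝒢.vert (𝒢.ins j g) i ∈ (pl j J i).W := by
  rw [pl]
  split_ifs with h
  · have h1 := vert_ins hg (i := ⟨i, by omega⟩) h
    have h2 := hJ ⟨i, by omega⟩
    rw [← h1] at h2
    exact h2
  · exact mem_univ _

theorem pl_congr (h : ∀ i ≤ k + 1, J i = J' i) {j : ℕ} (hj : j ≤ k + 1) : pl j J = pl j J' := by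
  funext i
  rw [pl, pl]
  split_ifs with hi
  · exact h i (hi.trans hj)
  · rfl

/-- The integrand of the homotopy, as a function of the string `g`. -/
def homInt (c : 𝒢.RawCochain (k + 2)) (J : ℕ → LSec (unitBundle 𝒢)) (g : Fin (k + 1) → G) : EG :=
  𝒢.rproj (g 0) (pull (pl 0 J) c (𝒢.ins 0 g)) +
    ∑ j : Fin (k + 1), (-1 : ℝ) ^ ((j : ℕ) + 1) • pull (pl (j + 1) J) c (𝒢.ins j.succ g)

theorem homInt_congr (h : ∀ i ≤ k + 1, J i = J' i) (g : Fin (k + 1) → G) :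
    homInt c J g = homInt c J' g := by
  rw [homInt, homInt, pl_congr h (by omega)]
  exact congrArg₂ _ rfl (Finset.sum_congr rfl fun j _ => by rw [pl_congr h (by omega)])

theorem homInt_str {a : ℕ → G} (ha : ∀ i j, 𝒢.src (a i) = 𝒢.src (a j)) :
    homInt c J (𝒢.str (k + 1) a) = prismSum c a J := by
  rw [homInt, prismSum, Finset.sum_range fun j => (-1 : ℝ) ^ (j + 1) • prism c a J (j + 1),
    ins_str ha]
  refine congrArg₂ _ rfl (Finset.sum_congr rfl fun j _ => ?_)
  rw [ins_str ha]
  rfl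

theorem smoothAlong_homInt (hc : 𝒢.IsCochain c) {g : Fin (k + 1) → G} (hg : g ∈ 𝒢.composable k)
    (hJ : ∀ j : Fin (k + 2), 𝒢.vert g j ∈ (J j).W) :
    SmoothAlong (ModelWithCorners.pi fun _ : Fin (k + 1) => 𝓘(ℝ, EG))
      (fun g : Fin (k + 1) → G => g 0) (homInt c J) (𝒢.composable k) g := by
  have h0 : ContMDiffWithinAt (ModelWithCorners.pi fun _ : Fin (k + 1) => 𝓘(ℝ, EG)) 𝓘(ℝ, EG) ∞
      (fun g : Fin (k + 1) → G => g 0) (𝒢.composable k) g :=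
    (contMDiff_eval_pi 0).contMDiffAt.contMDiffWithinAt
  have h1 : ∀ j : Fin (k + 2), SmoothAlong (ModelWithCorners.pi fun _ : Fin (k + 1) => 𝓘(ℝ, EG))
      (fun g : Fin (k + 1) → G => 𝒢.ins j g 0) (fun g => pull (pl j J) c (𝒢.ins j g))
      (𝒢.composable k) g := by
    intro j
    have h2 := smoothAlong_pull hc (ins_mem hg j) (mem_pl_vert hg hJ j)
    exact ContMDiffWithinAt.comp g h2 (contMDiffWithinAt_pi_of_forall fun i =>
      (contMDiff_ins j i).contMDiffAt.contMDiffWithinAt) fun z hz => ins_mem hz j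
  refine (smoothAlong_rproj hg h0 ?_).add (SmoothAlong.sum h0 fun j _ => ?_)
  · exact (h1 0).congr hg (Filter.Eventually.of_forall fun z => (ins_zero_zero z).symm)
      (Filter.Eventually.of_forall fun _ => rfl)
  · refine SmoothAlong.smul ?_ contMDiffWithinAt_const
    exact (h1 j.succ).congr hg (Filter.Eventually.of_forall fun z => (ins_succ_zero j z).symm)
      (Filter.Eventually.of_forall fun _ => rfl)

theorem dsrc_homInt (g : Fin (k + 1) → G) : 𝒢.dsrc (g 0) (homInt c J g) =
    ∑ j : Fin (k + 1), (-1 : ℝ) ^ ((j : ℕ) + 1) •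
      𝒢.dsrc (𝒢.ins j.succ g 0) (pull (pl (j + 1) J) c (𝒢.ins j.succ g)) := by
  rw [homInt, dsrc_add, dsrc_rproj, zero_add]
  refine (map_sum (𝒢.dsrcₗ (g 0)) _ _).trans (Finset.sum_congr rfl fun j _ => ?_)
  rw [ins_succ_zero]
  exact 𝒢.dsrc_smul _ _ _

/-- The right-translated summand is vertical and drops out. In the others the first arrow is that of
the string, and projectability of the pullbacks applies. -/
theorem dsrc_homInt_eq (hc : 𝒢.IsCochain c) {g g' : Fin (k + 1) → G} (hg : g ∈ 𝒢.composable k)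
    (hg' : g' ∈ 𝒢.composable k) (e : 𝒢.src (g 0) = 𝒢.src (g' 0)) (e' : Fin.tail g = Fin.tail g')
    (hJ : ∀ j : Fin (k + 2), 𝒢.vert g j ∈ (J j).W) (hJ' : ∀ j : Fin (k + 2), 𝒢.vert g' j ∈ (J' j).W)
    (hl : ∀ j : Fin (k + 1), J (j + 1) = J' (j + 1)) :
    𝒢.dsrc (g 0) (homInt c J g) = 𝒢.dsrc (g' 0) (homInt c J' g') := by
  rw [dsrc_homInt, dsrc_homInt]
  refine Finset.sum_congr rfl fun j _ => congrArg _ ?_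
  refine dsrc_pull_eq hc (ins_mem hg _) (ins_mem hg' _) ?_ (tail_ins_succ j (vert_succ_eq e e' j) e')
    (mem_pl_vert hg hJ j.succ) (mem_pl_vert hg' hJ' j.succ) fun i => ?_
  · rw [ins_succ_zero, ins_succ_zero, e]
  · rw [pl, pl]
    split_ifs with h
    · exact hl ⟨i, by omega⟩
    · rfl

end LSec

namespace Dist

open LSec

variable {ι : Type*} (D : Dist (unitBundle 𝒢) ι)

open scoped Classical in
/-- The homotopy between the identity and the transport along the unit bibundle. -/
def homSucc {k : ℕ} (c : 𝒢.RawCochain (k + 2)) : 𝒢.RawCochain (k + 1) :=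
  fun g : Fin (k + 1) → G =>
    if g ∈ 𝒢.composable k then D.avg (V := EG) (𝒢.vert g) (fun I => homInt c (D.lab I) g)
    else (0 : EG)

/-- The homotopy between the identity and the transport along the unit bibundle, on cochains of
degree one. -/
def homOne (c : 𝒢.RawCochain 1) : 𝒢.RawCochain 0 :=
  fun x : M => D.avg (V := EG) (fun _ : Fin 1 => x) (fun I => prismUnit c (D.sec (I 0)) x)

theorem ev_homSucc {k : ℕ} (c : 𝒢.RawCochain (k + 2)) {g : Fin (k + 1) → G}
    (hg : g ∈ 𝒢.composable k) :
    𝒢.ev (D.homSucc c) g = D.avg (𝒢.vert g) (fun I => homInt c (D.lab I) g) := if_pos hg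

theorem ev_homSucc_of_notMem {k : ℕ} (c : 𝒢.RawCochain (k + 2)) {g : Fin (k + 1) → G}
    (hg : g ∉ 𝒢.composable k) : 𝒢.ev (D.homSucc c) g = 0 := if_neg hg

theorem isCochain_homSucc {k : ℕ} {c : 𝒢.RawCochain (k + 2)} (hc : 𝒢.IsCochain c) :
    𝒢.IsCochain (D.homSucc c) := by
  refine isCochain_iff.2 ⟨fun g hg => D.ev_homSucc_of_notMem c hg, fun g hg => ?_,
    fun g hg g' hg' e e' => ?_⟩
  · refine SmoothAlong.congr (D.smoothAlong_avg (x := 𝒢.vert) (T := fun I => homInt c (D.lab I))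
      hg (fun j => (contMDiff_vert j).contMDiffAt.contMDiffWithinAt)
      (contMDiff_eval_pi 0).contMDiffAt.contMDiffWithinAt
      fun I hI => smoothAlong_homInt hc hg (D.mem_lab_coe hI)) hg
      (Filter.Eventually.of_forall fun _ => rfl) ?_
    filter_upwards [self_mem_nhdsWithin] with z hz using D.ev_homSucc c hz
  · rw [D.ev_homSucc c hg, D.ev_homSucc c hg']
    refine (D.map_avg _ _ (𝒢.dsrcₗ _)).trans (Eq.trans ?_ (D.map_avg _ _ (𝒢.dsrcₗ _)).symm)
    refine D.avg_eq_avg_of_tail (vert_succ_eq e e') fun I I' hI hI' hII => ?_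
    refine dsrc_homInt_eq hc hg hg' e e' (D.mem_lab_coe hI) (D.mem_lab_coe hI') fun j => ?_
    have h1 := D.lab_coe I j.succ
    rw [hII, ← D.lab_coe I' j.succ] at h1
    exact h1

theorem dsrc_homOne (c : 𝒢.RawCochain 1) (x : M) :
    𝒢.dsrc (𝒢.unit x) (𝒢.evUnit (D.homOne c) x) = 0 := by
  refine (D.map_avg _ _ (𝒢.dsrcₗ (𝒢.unit x))).trans ?_
  exact (D.avg_congr fun I _ => 𝒢.dsrc_vproj _ _).trans (D.avg_const _ 0)

theorem isAlgebroidSection_homOne {c : 𝒢.RawCochain 1} (hc : 𝒢.IsCochain c) :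
    𝒢.IsAlgebroidSection (D.homOne c) := by
  refine ⟨fun x => ?_, D.dsrc_homOne c⟩
  refine contMDiffWithinAt_univ.1 (D.smoothAlong_avg (x := fun x _ => x)
    (T := fun I => prismUnit c (D.sec (I 0))) (mem_univ x) (fun _ => contMDiffWithinAt_id)
    𝒢.contMDiff_unit.contMDiffAt.contMDiffWithinAt fun I hI => ?_)
  refine smoothAlong_vproj (f := id) (mem_univ x) ?_
  have hu : (fun _ : Fin 1 => 𝒢.unit x) ∈ 𝒢.composable 0 := fun i => i.elim0
  have h2 := smoothAlong_pull hc (J := pl 0 fun _ => D.sec (I 0)) hu fun j => by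
    refine Fin.cases ?_ (fun j => ?_) j
    · change 𝒢.tgt (𝒢.unit x) ∈ (D.sec (I 0)).W
      rw [𝒢.tgt_unit]
      exact hI 0
    · exact mem_univ _
  exact ContMDiffWithinAt.comp x (f := fun x => fun _ : Fin 1 => 𝒢.unit x) h2
    (contMDiffWithinAt_pi_of_forall fun i => 𝒢.contMDiff_unit.contMDiffAt.contMDiffWithinAt)
    fun z _ i => i.elim0

theorem d_homSucc {k : ℕ} {c : 𝒢.RawCochain (k + 2)} (hc : 𝒢.IsCochain c) (hd : 𝒢.d (k + 2) c = 0) :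
    𝒢.d (k + 1) (D.homSucc c) = c - D.map (k + 2) c := by
  refine ext_ev fun g => ?_
  change _ = 𝒢.ev c g - 𝒢.ev (D.mapSucc (k + 1) c) g
  by_cases hg : g ∈ 𝒢.composable (k + 1)
  · rw [D.ev_mapSucc _ hg]
    obtain ⟨a, ha, ha', rfl⟩ := exists_str hg
    rw [ev_d_str _ ha]
    let T : (Fin (k + 3) → ι) → ℕ → EG := fun I m => prismSum c (a ∘ skip m) (D.lab I ∘ skip m)
    have h1 : ∀ m ≤ k + 2, 𝒢.ev (D.homSucc c) (𝒢.str (k + 1) (a ∘ skip m)) =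
        D.avg (𝒢.vert (𝒢.str (k + 2) a)) T m := by
      intro m hm
      rw [D.ev_homSucc _ (str_mem (a := a ∘ skip m) fun i j => ha _ _)]
      refine (D.avg_vert_face ha hm (fun J => homInt c J (𝒢.str (k + 1) (a ∘ skip m)))
        fun J J' e => homInt_congr e _).trans ?_
      refine Eq.trans ?_ (D.avg_apply _ T m).symm
      exact D.avg_congr fun I _ => homInt_str (a := a ∘ skip m) fun _ _ => ha _ _
    rw [altSum_congr h1]
    refine (D.map_avg _ _ _).trans ?_
    have h2 := D.avg_const (𝒢.vert (𝒢.str (k + 2) a)) (𝒢.ev c (𝒢.str (k + 2) a))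
    refine Eq.trans ?_ (congrArg (· - _) h2)
    rw [← D.avg_sub]
    exact D.avg_congr fun I hI => altSum_prismSum ha (D.mem_lab ha ha' hI) hc hd
  · rw [D.ev_mapSucc_of_notMem _ hg, d_eq_zero_of_notMem _ hg, (isCochain_iff.1 hc).1 g hg, sub_self]

theorem d_homOne {c : 𝒢.RawCochain 1} (hc : 𝒢.IsCochain c) (hd : 𝒢.d 1 c = 0) :
    𝒢.d 0 (D.homOne c) = D.map 1 c - c := by
  refine ext_ev fun g => ?_
  change _ = 𝒢.ev (D.mapSucc 0 c) g - 𝒢.ev c g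
  have hg : g ∈ 𝒢.composable 0 := fun i => i.elim0
  rw [D.ev_mapSucc _ hg, ev_d_zero (D.dsrc_homOne c)]
  let T : (Fin 2 → ι) → EG × EG := fun I => (prismUnit c (D.sec (I 0)) (𝒢.tgt (g 0)),
    prismUnit c (D.sec (I 1)) (𝒢.src (g 0)))
  have h2 : ((𝒢.evUnit (D.homOne c) (𝒢.tgt (g 0)), 𝒢.evUnit (D.homOne c) (𝒢.src (g 0))) : EG × EG) =
      D.avg (𝒢.vert g) T :=
    D.avg_pair g (fun s => prismUnit c s (𝒢.tgt (g 0))) fun s => prismUnit c s (𝒢.src (g 0))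
  have h3 := D.avg_const (𝒢.vert g) (𝒢.ev c g)
  rw [h2, D.map_avg, ← congrArg (D.avg (𝒢.vert g) (fun I => pull (D.lab I) c g) - ·) h3, ← D.avg_sub]
  refine D.avg_congr fun I hI => ?_
  have m0 := hI 0
  have m1 := hI 1
  rw [← D.lab_coe] at m0 m1
  have eg : g = fun _ => g 0 := funext fun i => congrArg g (Fin.ext (by omega))
  have h := dz_prismUnit (g := g 0) (J := D.lab I) m0 (fun j hj => ?_) hc hd
  · rw [← eg] at h
    exact h
  · have hc : clip 1 j = 1 := Fin.ext (min_eq_right hj)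
    rw [lab, hc]
    exact hI 1

theorem map_zero_eq {c : 𝒢.RawCochain 0} (hc : 𝒢.IsAlgebroidSection c) (hd : 𝒢.d 0 c = 0) :
    D.map 0 c = c := by
  refine ext_evUnit fun x => ?_
  exact (D.avg_congr fun I hI => pullUnit_eq hc hd (hI 0)).trans (D.avg_const _ _)

theorem map_sub_mem {k : ℕ} {c : 𝒢.RawCochain k} (hc : c ∈ 𝒢.cocycles k) :
    D.map k c - c ∈ 𝒢.coboundaries k := by
  obtain ⟨h1, h2⟩ := hc
  rw [SetLike.mem_coe, LinearMap.mem_ker] at h2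
  match k, c, h1, h2 with
  | 0, c, h1, h2 =>
    rw [D.map_zero_eq h1 h2, sub_self]
    exact Submodule.zero_mem _
  | 1, c, h1, h2 =>
    refine ⟨Submodule.sub_mem _ (D.map_mem_cochains h1) h1, D.homOne c,
      D.isAlgebroidSection_homOne h1, D.d_homOne h1 h2⟩
  | k + 2, c, h1, h2 =>
    -- From degree two on, the homotopy bounds identity minus transport, hence the sign; in degree
    -- one it has the opposite orientation.
    refine ⟨Submodule.sub_mem _ (D.map_mem_cochains h1) h1, -D.homSucc c,
      Submodule.neg_mem (𝒢.cochains (k + 1)) (D.isCochain_homSucc h1), ?_⟩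
    rw [map_neg, D.d_homSucc h1 h2, neg_sub]

end Dist

end Bibundle

end LieGroupoid

/-! ### The isomorphism in cohomology -/

namespace LieGroupoid

universe u u'

variable {EM : Type*} [NormedAddCommGroup EM] [NormedSpace ℝ EM]
  {M : Type u} [TopologicalSpace M] [ChartedSpace EM M] [IsManifold 𝓘(ℝ, EM) ∞ M]
  {EG : Type*} [NormedAddCommGroup EG] [NormedSpace ℝ EG]
  {G : Type u} [TopologicalSpace G] [ChartedSpace EG G] [IsManifold 𝓘(ℝ, EG) ∞ G]
  {EN : Type*} [NormedAddCommGroup EN] [NormedSpace ℝ EN]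
  {N : Type u'} [TopologicalSpace N] [ChartedSpace EN N] [IsManifold 𝓘(ℝ, EN) ∞ N]
  {EH : Type*} [NormedAddCommGroup EH] [NormedSpace ℝ EH]
  {H : Type u'} [TopologicalSpace H] [ChartedSpace EH H] [IsManifold 𝓘(ℝ, EH) ∞ H]

namespace Bibundle

variable {𝒢 : LieGroupoid EM M EG G} {ℋ : LieGroupoid EN N EH H}
  {EP : Type*} [NormedAddCommGroup EP] [NormedSpace ℝ EP]
  {P : Type*} [TopologicalSpace P] [ChartedSpace EP P] [IsManifold 𝓘(ℝ, EP) ∞ P]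
  {B : Bibundle 𝒢 ℋ EP P}

namespace Dist

variable {ι : Type*} (D : Dist B ι)

theorem map_mem_cocycles {k : ℕ} {c : 𝒢.RawCochain k} (hc : c ∈ 𝒢.cocycles k) :
    D.map k c ∈ ℋ.cocycles k :=
  ⟨D.map_mem_cochains hc.1, by
    rw [SetLike.mem_coe, LinearMap.mem_ker, D.d_map hc.1, LinearMap.mem_ker.1 hc.2, map_zero]⟩

theorem map_mem_coboundaries {k : ℕ} {c : 𝒢.RawCochain k} (hc : c ∈ 𝒢.coboundaries k) :
    D.map k c ∈ ℋ.coboundaries k := by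
  cases k with
  | zero =>
    obtain rfl : c = 0 := hc
    rw [map_zero]
    exact Submodule.zero_mem _
  | succ k =>
    obtain ⟨h, b, hb, rfl⟩ := hc
    exact ⟨D.map_mem_cochains h, D.map k b, D.map_mem_cochains hb, D.d_map hb⟩

/-- The linear map which a bibundle induces in deformation cohomology. -/
def cohomologyMap (k : ℕ) : 𝒢.DefCohomology k →ₗ[ℝ] ℋ.DefCohomology k :=
  Submodule.mapQ _ _ ((D.map k).restrict fun _ => D.map_mem_cocycles) fun _ hc =>
    D.map_mem_coboundaries hc

/-- Composing with the opposite direction gives transport along the unit bibundle, which changes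
cocycles by coboundaries whatever families were chosen. -/
theorem cohomologyMap_comp {ι' : Type*} (D' : Dist B.op ι') (k : ℕ) (x : 𝒢.DefCohomology k) :
    D'.cohomologyMap k (D.cohomologyMap k x) = x := by
  obtain ⟨c, rfl⟩ := Submodule.Quotient.mk_surjective _ x
  refine (Submodule.Quotient.eq _).2 ?_
  change D'.map k (D.map k c.1) - c.1 ∈ 𝒢.coboundaries k
  rw [D.map_comp]
  exact (D.comp D').map_sub_mem c.2

end Dist

/-- The transport of the opposite bibundle has a right inverse, induced by `B`, and a left inverse,
induced by the opposite of the opposite. So it is bijective, and the double opposite need not be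
compared with `B`. -/
theorem nonempty_defCohomology_equiv (B : Bibundle 𝒢 ℋ EP P)
    [FiniteDimensional ℝ EM] [T2Space M] [SecondCountableTopology M]
    [FiniteDimensional ℝ EN] [T2Space N] [SecondCountableTopology N] (k : ℕ) :
    Nonempty (𝒢.DefCohomology k ≃ₗ[ℝ] ℋ.DefCohomology k) := by
  obtain ⟨D⟩ := Dist.exists_dist B
  obtain ⟨D'⟩ := Dist.exists_dist B.op
  obtain ⟨D''⟩ := Dist.exists_dist B.op.op
  exact ⟨(LinearEquiv.ofBijective (D'.cohomologyMap k)
    ⟨Function.LeftInverse.injective (D'.cohomologyMap_comp D'' k),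
      Function.RightInverse.surjective (D.cohomologyMap_comp D' k)⟩).symm⟩

/-- The bibundle given by commuting principal actions. -/
theorem nonempty_of_isPrincipalBundle {a : LeftAction 𝒢 EP P} {b : RightAction ℋ EP P}
    (ha : a.IsPrincipalBundle (EB := EN) b.moment) (hb : b.IsPrincipalBundle (EB := EM) a.moment)
    (comm : ∀ g p h, 𝒢.src g = a.moment p → b.moment p = ℋ.tgt h →
      b.act (a.act g p) h = a.act g (b.act p h)) : Nonempty (Bibundle 𝒢 ℋ EP P) := by
  obtain ⟨-, -, f, hf, hf', hfl, hfr⟩ := ha.isDiffeo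
  obtain ⟨-, -, e, he, he', hel, her⟩ := hb.isDiffeo
  -- The inverse diffeomorphism, on the fibred product, fixes the component that is carried along;
  -- its other component is the division map.
  have f2 : ∀ p q, b.moment p = b.moment q → (f (p, q)).2 = q := fun p q h =>
    congrArg Prod.snd (hfr (x := (p, q)) h)
  have e1 : ∀ p q, a.moment p = a.moment q → (e (p, q)).1 = p := fun p q h =>
    congrArg Prod.fst (her (x := (p, q)) h)
  exact ⟨{
    α := a.moment
    β := b.moment
    l := a.act
    r := b.act
    divL := fun p q => (f (p, q)).1
    divR := fun p q => (e (p, q)).2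
    isSubmersion_α := hb.isSubmersion
    isSubmersion_β := ha.isSubmersion
    surjective_α := hb.surjective
    surjective_β := ha.surjective
    contMDiffOn_l := a.contMDiffOn_act
    contMDiffOn_r := b.contMDiffOn_act
    contMDiffOn_divL := contMDiff_fst.comp_contMDiffOn hf'
    contMDiffOn_divR := contMDiff_snd.comp_contMDiffOn he'
    α_l := a.moment_act
    β_l := ha.invariant
    α_r := hb.invariant
    β_r := b.moment_act
    unit_l := a.unit_act
    r_unit := b.act_unit
    mul_l := a.mul_act
    r_mul := b.act_mul
    comm := comm
    src_divL := fun p q h => (hf (x := (p, q)) h).trans (congrArg a.moment (f2 p q h))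
    tgt_divR := fun p q h => (he (x := (p, q)) h).symm.trans (congrArg b.moment (e1 p q h))
    l_divL := fun p q h =>
      (congrArg (a.act _) (f2 p q h).symm).trans (congrArg Prod.fst (hfr (x := (p, q)) h))
    r_divR := fun p q h =>
      (congrArg (b.act · _) (e1 p q h).symm).trans (congrArg Prod.snd (her (x := (p, q)) h))
    divL_l := fun g p h => congrArg Prod.fst (hfl (x := (g, p)) h)
    divR_r := fun p h hp => congrArg Prod.snd (hel (x := (p, h)) hp) }⟩

end Bibundle

end LieGroupoid

end

theorem mainTheorem2
    {EM : Type*} [NormedAddCommGroup EM] [NormedSpace ℝ EM] [FiniteDimensional ℝ EM]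
    {M : Type u₁} [TopologicalSpace M] [T2Space M] [SecondCountableTopology M]
    [ChartedSpace EM M] [IsManifold 𝓘(ℝ, EM) ∞ M]
    {EG : Type*} [NormedAddCommGroup EG] [NormedSpace ℝ EG] [FiniteDimensional ℝ EG]
    {G : Type u₁} [TopologicalSpace G] [ChartedSpace EG G] [IsManifold 𝓘(ℝ, EG) ∞ G]
    {EN : Type*} [NormedAddCommGroup EN] [NormedSpace ℝ EN] [FiniteDimensional ℝ EN]
    {N : Type u₂} [TopologicalSpace N] [T2Space N] [SecondCountableTopology N]
    [ChartedSpace EN N] [IsManifold 𝓘(ℝ, EN) ∞ N]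
    {EH : Type*} [NormedAddCommGroup EH] [NormedSpace ℝ EH] [FiniteDimensional ℝ EH]
    {H : Type u₂} [TopologicalSpace H] [ChartedSpace EH H] [IsManifold 𝓘(ℝ, EH) ∞ H]
    (𝒢 : LieGroupoid EM M EG G) (ℋ : LieGroupoid EN N EH H)
    (h : LieGroupoid.MoritaEquivalent.{w} 𝒢 ℋ) (k : ℕ) :
    Nonempty (𝒢.DefCohomology k ≃ₗ[ℝ] ℋ.DefCohomology k) := by
  obtain ⟨_, P, _, _, _, a, b, ha, hb, hab⟩ := h
  obtain ⟨B⟩ := LieGroupoid.Bibundle.nonempty_of_isPrincipalBundle ha hb hab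
  exact B.nonempty_defCohomology_equiv k
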